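/- Let $E$ be a finite set. An implication on $E$ is a pair $A\to B$ of subsets of $E$; it is proper if $B\neq\emptyset$ and improper if $B=\emptyset$. For a family (finite set) $\Sigma$ of implications, $\mathcal F(\Sigma)\subseteq 2^E$ consists of all $X\subseteq E$ such that $A\subseteq X$ implies $B\subseteq X$ for every proper $A\to B$ in $\Sigma$, and $A\not\subseteq X$ for every improper $A\to\emptyset$ in $\Sigma$; it is closed under intersection and is regarded as a ($\wedge$-)semilattice ordered by inclusion. Put $s(\Sigma)=\sum_{(A\to B)\in\Sigma}(|A|+|B|)$. An implicational base of $\mathcal F(\Sigma)$ is a family $\Gamma$ of implications on $E$ with $\mathcal F(\Gamma)=\mathcal F(\Sigma)$; it is optimal if $s(\Gamma)$ is minimum among all implicational bases of $\mathcal F(\Sigma)$. A semilattice $L$ is modular if every principal ideal of $L$ is a modular lattice and, for all $x,y,z\in L$, the join $x\vee y\vee z$ exists whenever $x\vee y$, $y\vee z$ and $z\vee x$ exist. An element $l\in L$ is $\vee$-irreducible if it is not the minimum element and $l=a\vee b$ implies $l=a$ or $l=b$. The family $\Sigma$ is simple if $e\mapsto\bigcap\{X\in\mathcal F(\Sigma)\mid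 e\in X\}$ is a bijection from $E$ onto the set of $\vee$-irreducible elements of $\mathcal F(\Sigma)$ (in particular, every $e\in E$ lies in some member of $\mathcal F(\Sigma)$). **Theorem.** There is an algorithm which, given a finite set $E=\{0,\dots,n-1\}$ and a simple family $\Sigma$ of implications on $E$ such that $\mathcal F(\Sigma)$ is a modular semilattice, outputs an optimal implicational base of $\mathcal F(\Sigma)$ in time polynomial in $|E|+s(\Sigma)$. (Here an algorithm is a WHILE program on binary trees, in which evaluating an expression costs the total size of the values of its subexpressions and each test costs one unit more; this model and Turing machines simulate each other with polynomial overhead. Subsets of $E$ are encoded by characteristic vectors, families of implications by lists without repetition, in any order, and $n$ in unary.) -/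

import Mathlib

namespace ImplBase

/-! ### Modular semilattices -/

section Order

variable (P : Type*) [PartialOrder P]

/-- A poset is a modular semilattice if any two elements have a meet, every principal ideal is
a modular lattice, and the join of `x, y, z` exists whenever the three pairwise joins exist. -/
structure IsModularSemilattice : Prop where
  meet_exists : ∀ x y : P, ∃ m, IsGLB {x, y} m
  ideal_modular : ∀ x : P, ∃ l : Lattice (Set.Iic x),
    l.toPartialOrder = (inferInstance : PartialOrder (Set.Iic x)) ∧ @IsModularLattice _ l
  join_exists : ∀ x y z : P, (∃ j, IsLUB {x, y} j) → (∃ j, IsLUB {y, z} j) →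
    (∃ j, IsLUB {z, x} j) → ∃ j, IsLUB {x, y, z} j

variable {P}

/-- Join-irreducible elements of a poset in which joins need not exist: `l` is not minimal, and
`l = a ∨ b` implies `l = a` or `l = b`. -/
def IsJoinIrreducible (l : P) : Prop :=
  ¬ IsMin l ∧ ∀ a b : P, IsLUB {a, b} l → l = a ∨ l = b

end Order

/-! ### Implications -/

/-- An implication `A → B`: the pair of its premise `A` and its conclusion `B`. It is proper if
`B` is nonempty. -/
abbrev Implication (E : Type*) := Finset E × Finset E

section Implications

variable {E : Type*}

/-- The family `F(Σ)`: sets `X` such that `A ⊆ X` implies `B ⊆ X` for every proper `A → B` in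
`Σ`, and `A ⊈ X` for every improper `A → ∅` in `Σ`. -/
def closedSets (S : Finset (Implication E)) : Set (Finset E) :=
  {X | ∀ I ∈ S, (I.2.Nonempty → I.1 ⊆ X → I.2 ⊆ X) ∧ (I.2 = ∅ → ¬ I.1 ⊆ X)}

/-- The size `s(Σ)`, the sum of `|A| + |B|` over all `A → B` in `Σ`. -/
def famSize (S : Finset (Implication E)) : ℕ :=
  ∑ I ∈ S, (I.1.card + I.2.card)

/-- `Σ` is an implicational base of the family `F`. -/
def IsImplBase (S : Finset (Implication E)) (F : Set (Finset E)) : Prop :=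
  closedSets S = F

/-- `Σ` is an implicational base of `F` of minimum size. -/
def IsOptimalBase (S : Finset (Implication E)) (F : Set (Finset E)) : Prop :=
  IsImplBase S F ∧ ∀ T : Finset (Implication E), IsImplBase T F → famSize S ≤ famSize T

/-- The join-irreducible members of a family of sets ordered by inclusion. -/
def irreducibles (F : Set (Finset E)) : Set (Finset E) :=
  {X | ∃ h : X ∈ F, IsJoinIrreducible (⟨X, h⟩ : F)}

open Classical in
/-- The intersection of all members of `F` that contain `e` (the whole ground set if there are
none; the ground set is then not a member of `F`). -/
noncomputable def closurePt [Fintype E] (F : Set (Finset E)) (e : E) : Finset E :=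
  Finset.univ.filter fun f => ∀ X ∈ F, e ∈ X → f ∈ X

/-- `Σ` is simple: `e ↦ ⋂ {X ∈ F(Σ) | e ∈ X}` is a bijection from the ground set onto the
join-irreducible members of `F(Σ)`. -/
def IsSimple [Fintype E] (S : Finset (Implication E)) : Prop :=
  Set.BijOn (closurePt (closedSets S)) Set.univ (irreducibles (closedSets S))

end Implications

/-! ### Computation model: WHILE programs on binary trees

The store has a variable for each natural number, holding a binary tree. Evaluating an expression
costs the total size of the values of all its subexpressions, so that copying a tree costs its
size; a test costs one more than evaluating its expression. Hence a run of cost `t` only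
ever writes data of total size at most `t`, and the model and Turing machines simulate each
other with polynomial overhead. -/

/-- Binary trees. -/
inductive Data : Type
  | nil : Data
  | cons : Data → Data → Data

namespace Data

/-- Number of nodes, leaves included. -/
def size : Data → ℕ
  | nil => 1
  | cons a b => a.size + b.size + 1

/-- Left subtree (`nil` for `nil`). -/
def hd : Data → Data
  | nil => nil
  | cons a _ => a

/-- Right subtree (`nil` for `nil`). -/
def tl : Data → Data
  | nil => nil
  | cons _ b => b

/-- A list of trees as a tree. -/
def ofList : List Data → Data
  | [] => nil
  | a :: l => cons a (ofList l)

/-- Truth values. -/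
def ofBool : Bool → Data
  | false => nil
  | true => cons nil nil

/-- Natural numbers in unary. -/
def ofNat : ℕ → Data
  | 0 => nil
  | k + 1 => cons nil (ofNat k)

end Data

/-- Contents of the variables. -/
abbrev Store := ℕ → Data

/-- Expressions. -/
inductive Expr : Type
  | var : ℕ → Expr
  | nil : Expr
  | cons : Expr → Expr → Expr
  | hd : Expr → Expr
  | tl : Expr → Expr

namespace Expr

/-- Value of an expression in a store. -/
def eval (σ : Store) : Expr → Data
  | var x => σ x
  | nil => Data.nil
  | cons e f => Data.cons (e.eval σ) (f.eval σ)
  | hd e => (e.eval σ).hd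
  | tl e => (e.eval σ).tl

/-- Cost of evaluating an expression: the sum of the sizes of the values of all its
subexpressions. -/
def cost (σ : Store) : Expr → ℕ
  | var x => (σ x).size
  | nil => 1
  | cons e f => e.cost σ + f.cost σ + ((cons e f).eval σ).size
  | hd e => e.cost σ + ((hd e).eval σ).size
  | tl e => e.cost σ + ((tl e).eval σ).size

end Expr

/-- Programs: `x := e`, sequencing, `if e ≠ nil then c else d`, and `while e ≠ nil do c`. -/
inductive Program : Type
  | assign : ℕ → Expr → Program
  | seq : Program → Program → Program
  | branch : Expr → Program → Program → Program
  | loop : Expr → Program → Program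

/-- `Runs c σ τ t`: started in the store `σ`, the program `c` halts in the store `τ` after time
`t`. -/
inductive Runs : Program → Store → Store → ℕ → Prop
  | assign (x : ℕ) (e : Expr) (σ : Store) :
      Runs (.assign x e) σ (Function.update σ x (e.eval σ)) (e.cost σ)
  | seq {c d : Program} {σ τ ρ : Store} {t u : ℕ} :
      Runs c σ τ t → Runs d τ ρ u → Runs (.seq c d) σ ρ (t + u)
  | branch_true {e : Expr} {c d : Program} {σ τ : Store} {t : ℕ} :
      e.eval σ ≠ .nil → Runs c σ τ t → Runs (.branch e c d) σ τ (e.cost σ + 1 + t)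
  | branch_false {e : Expr} {c d : Program} {σ τ : Store} {t : ℕ} :
      e.eval σ = .nil → Runs d σ τ t → Runs (.branch e c d) σ τ (e.cost σ + 1 + t)
  | loop_true {e : Expr} {c : Program} {σ τ ρ : Store} {t u : ℕ} :
      e.eval σ ≠ .nil → Runs c σ τ t → Runs (.loop e c) τ ρ u →
        Runs (.loop e c) σ ρ (e.cost σ + 1 + t + u)
  | loop_false {e : Expr} {c : Program} {σ : Store} :
      e.eval σ = .nil → Runs (.loop e c) σ σ (e.cost σ + 1)

/-- The initial store: the input in variable `0`, and `nil` everywhere else. -/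
def initStore (input : Data) : Store :=
  Function.update (fun _ => Data.nil) 0 input

/-- On the given input, `c` halts within time `T` with the given output in variable `0`. -/
def Computes (c : Program) (input output : Data) (T : ℕ) : Prop :=
  ∃ (τ : Store) (t : ℕ), Runs c (initStore input) τ t ∧ τ 0 = output ∧ t ≤ T

/-! ### Encoding of implications on the ground set `{0, …, n - 1}` -/

/-- A subset is encoded by its characteristic vector. -/
def encodeSet {n : ℕ} (A : Finset (Fin n)) : Data :=
  Data.ofList (List.ofFn fun i : Fin n => Data.ofBool (decide (i ∈ A)))

/-- An implication is encoded by the pair of its premise and its conclusion. -/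
def encodeImplication {n : ℕ} (I : Implication (Fin n)) : Data :=
  Data.cons (encodeSet I.1) (encodeSet I.2)

/-- A list of implications is encoded as the list of their encodings. -/
def encodeFamily {n : ℕ} (S : List (Implication (Fin n))) : Data :=
  Data.ofList (S.map encodeImplication)

/-- The input: the number `n` of elements of the ground set, and the implications. -/
def encodeInput (n : ℕ) (S : List (Implication (Fin n))) : Data :=
  Data.cons (Data.ofNat n) (encodeFamily S)

end ImplBase

open ImplBase

/-! Write `F` for the family, ∨ for the closure of a union, and p⁻ for the closure of p without p.
Simplicity makes p⁻ the greatest member of `F` properly below the closure of p. The flanks of p and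
q are a = p ∨ q⁻ and b = q ∨ p⁻. The pair is critical if a and b are members but a ∪ b is not. By
modularity, replacing p by a point of a \ b and q by a point of b \ a changes neither flank
(`exchange`), so critical pairs fall into classes, one for each unordered pair of flanks. If x = p ∨
q is a member and d = a ∩ b, then a and b are two of at least three atoms of the interval [d, x] of
length two, and any two of its atoms again come from a critical pair (`OnLine.pair`). If p ∨ q is
not a member, the class is inconsistent.

The output has an implication {p} → B for each p with p⁻ nonempty, where B is an irredundant
generating set of p⁻, and one implication {p, q} → C for each class of critical pairs. C is empty
for an inconsistent class and a single point otherwise. On a line whose atoms have least points c₁ <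
c₂ < ... (outside d), the pair c₁, cⱼ yields the cyclic successor of cⱼ among the points other than
c₁, and all other pairs yield c₁. Hence any two of these points produce all of them
(`representatives_subset`).

It is a base. A set X obeying the output contains every existing closure of its subsets
(`subset_of_generated`): by induction one reduces to irreducible members and to members spanned by
two points, where the implications for points and lines apply. If X were not a member, a minimal
pair of members inside X without join would consist of the closures of two points, by the condition
on triple joins, and these form an inconsistent critical pair in X (`mem_of_generated`).

It is optimal. In any base T, some implication is violated by a ∪ b but by neither flank. Its
premise meets both a \ b and b \ a, so it has at least two elements and determines the class; its
conclusion is nonempty if the join exists (`exists_critical_premise`). For each p, the conclusions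
of the implications of T whose premise contains p and lies in its closure generate p⁻, apart from p
itself. Steinitz exchange holds here, so an irredundant generating set is a smallest one
(`card_le_of_irredundant`), which bounds the size of these implications (`card_le_sum_single`). The
groups of implications used are pairwise disjoint, so the bounds add up to the size of the output.

The running time is handled by a calculus of polynomial-time computable families of trees, closed
under pairing, case distinction and folds over lists (`PolyTime.fold_invariant`). -/

namespace ImplBase

/-! ### Polynomially bounded functions -/

/-- `f` is bounded by a polynomial in the measure `m`. -/
def PolyBdd {ι : Type*} (m f : ι → ℕ) : Prop :=
  ∃ p : Polynomial ℕ, ∀ i, f i ≤ p.eval (m i)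

theorem polynomial_eval_mono (p : Polynomial ℕ) {a b : ℕ} (h : a ≤ b) :
    p.eval a ≤ p.eval b := by
  rw [Polynomial.eval_eq_sum, Polynomial.eval_eq_sum]
  exact Finset.sum_le_sum fun i _ => Nat.mul_le_mul_left _ (Nat.pow_le_pow_left h i)

namespace PolyBdd

variable {ι κ : Type*} {m f g : ι → ℕ}

theorem mono (hf : PolyBdd m f) (h : ∀ i, g i ≤ f i) : PolyBdd m g :=
  hf.imp fun _ hp i => (h i).trans (hp i)

theorem const (c : ℕ) : PolyBdd m fun _ => c := ⟨Polynomial.C c, fun _ => by simp⟩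

theorem self : PolyBdd m m := ⟨Polynomial.X, fun _ => by simp⟩

theorem add (hf : PolyBdd m f) (hg : PolyBdd m g) : PolyBdd m fun i => f i + g i := by
  obtain ⟨p, hp⟩ := hf
  obtain ⟨q, hq⟩ := hg
  exact ⟨p + q, fun i => by rw [Polynomial.eval_add]; exact add_le_add (hp i) (hq i)⟩

theorem mul (hf : PolyBdd m f) (hg : PolyBdd m g) : PolyBdd m fun i => f i * g i := by
  obtain ⟨p, hp⟩ := hf
  obtain ⟨q, hq⟩ := hg
  exact ⟨p * q, fun i => by rw [Polynomial.eval_mul]; exact Nat.mul_le_mul (hp i) (hq i)⟩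

/-- Change of index and of measure. -/
theorem reindex (hf : PolyBdd m f) {m' : κ → ℕ} (φ : κ → ι) (h : PolyBdd m' fun j => m (φ j)) :
    PolyBdd m' fun j => f (φ j) := by
  obtain ⟨p, hp⟩ := hf
  obtain ⟨q, hq⟩ := h
  exact ⟨p.comp q, fun j => by
    rw [Polynomial.eval_comp]
    exact (hp _).trans (polynomial_eval_mono p (hq j))⟩

end PolyBdd

/-! ### Polynomial-time computations on families of trees -/

/-- Uniformly in `i`, the tree `y i` can be computed from `x i` in time polynomial in `m i`; the
program reads and writes a prescribed register `k` and leaves the registers below it alone. -/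
structure PolyTime {ι : Type*} (m : ι → ℕ) (x y : ι → Data) : Prop where
  in_bdd : PolyBdd m fun i => (x i).size
  out_bdd : PolyBdd m fun i => (y i).size
  prog : ∀ k : ℕ, ∃ (c : Program) (T : ι → ℕ), PolyBdd m T ∧ ∀ i (σ : Store), σ k = x i →
    ∃ (τ : Store) (t : ℕ), Runs c σ τ t ∧ τ k = y i ∧ (∀ j < k, τ j = σ j) ∧ t ≤ T i

theorem Runs.assign_of_eval {k : ℕ} {e : Expr} {σ : Store} {v : Data} (h : e.eval σ = v) :
    Runs (.assign k e) σ (Function.update σ k v) (e.cost σ) :=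
  h ▸ .assign k e σ

theorem Data.size_hd_le (d : Data) : d.hd.size ≤ d.size := by
  cases d <;> simp [Data.size, Data.hd]; omega

theorem Data.size_tl_le (d : Data) : d.tl.size ≤ d.size := by
  cases d <;> simp [Data.size, Data.tl]; omega

namespace PolyTime

variable {ι : Type*} {m : ι → ℕ} {x y z : ι → Data}

theorem id (hx : PolyBdd m fun i => (x i).size) : PolyTime m x x where
  in_bdd := hx
  out_bdd := hx
  prog k := ⟨.assign k (.var k), _, hx, fun i σ h =>
    ⟨_, _, .assign k (.var k) σ, by simp [Expr.eval, h],
      fun j hj => by simp [Function.update_of_ne hj.ne], by simp [Expr.cost, h]⟩⟩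

theorem trans (h₁ : PolyTime m x y) (h₂ : PolyTime m y z) : PolyTime m x z where
  in_bdd := h₁.in_bdd
  out_bdd := h₂.out_bdd
  prog k := by
    obtain ⟨c, T, hT, hc⟩ := h₁.prog k
    obtain ⟨d, U, hU, hd⟩ := h₂.prog k
    refine ⟨.seq c d, _, hT.add hU, fun i σ hσ => ?_⟩
    obtain ⟨τ, t, r, hτ, hj, ht⟩ := hc i σ hσ
    obtain ⟨ρ, u, s, hρ, hj', hu⟩ := hd i τ hτ
    exact ⟨ρ, t + u, .seq r s, hρ, fun j h => (hj' j h).trans (hj j h), add_le_add ht hu⟩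

/-- A change of register: from register `k`, compute into a scratch register. -/
theorem prog_scratch (h : PolyTime m x y) (k l : ℕ) :
    ∃ (c : Program) (T : ι → ℕ), PolyBdd m T ∧ ∀ i (σ : Store), σ k = x i →
      ∃ (τ : Store) (t : ℕ), Runs c σ τ t ∧ τ l = y i ∧ (∀ j < l, τ j = σ j) ∧ t ≤ T i := by
  obtain ⟨c, T, hT, hc⟩ := h.prog l
  refine ⟨.seq (.assign l (.var k)) c, _, h.in_bdd.add hT, fun i σ hσ => ?_⟩
  obtain ⟨τ, t, r, hτ, hj, ht⟩ := hc i (Function.update σ l (σ k)) (by simp [hσ])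
  refine ⟨τ, _, .seq (.assign l (.var k) σ) r, hτ, fun j h => ?_, ?_⟩
  · rw [hj j h, Function.update_of_ne h.ne]
  · simp only [Expr.cost, hσ]; omega

theorem nil (hx : PolyBdd m fun i => (x i).size) : PolyTime m x fun _ => .nil where
  in_bdd := hx
  out_bdd := .const _
  prog k := ⟨.assign k .nil, _, .const 1, fun i σ _ =>
    ⟨_, _, .assign k .nil σ, by simp [Expr.eval],
      fun j hj => by simp [Function.update_of_ne hj.ne], by simp [Expr.cost]⟩⟩

theorem hd (h : PolyTime m x y) : PolyTime m x fun i => (y i).hd :=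
  h.trans
  { in_bdd := h.out_bdd
    out_bdd := h.out_bdd.mono fun _ => Data.size_hd_le _
    prog k := ⟨.assign k (.hd (.var k)), _, h.out_bdd.add h.out_bdd, fun i σ hσ =>
      ⟨_, _, .assign k _ σ, by simp [Expr.eval, hσ],
        fun j hj => by simp [Function.update_of_ne hj.ne], by
          have := Data.size_hd_le (y i)
          simp only [Expr.cost, Expr.eval, hσ]; omega⟩⟩ }

theorem tl (h : PolyTime m x y) : PolyTime m x fun i => (y i).tl :=
  h.trans
  { in_bdd := h.out_bdd
    out_bdd := h.out_bdd.mono fun _ => Data.size_tl_le _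
    prog k := ⟨.assign k (.tl (.var k)), _, h.out_bdd.add h.out_bdd, fun i σ hσ =>
      ⟨_, _, .assign k _ σ, by simp [Expr.eval, hσ],
        fun j hj => by simp [Function.update_of_ne hj.ne], by
          have := Data.size_tl_le (y i)
          simp only [Expr.cost, Expr.eval, hσ]; omega⟩⟩ }

theorem cons (h₁ : PolyTime m x y) (h₂ : PolyTime m x z) :
    PolyTime m x fun i => .cons (y i) (z i) where
  in_bdd := h₁.in_bdd
  out_bdd := ((h₁.out_bdd.add h₂.out_bdd).add (.const 1)).mono fun i => by simp [Data.size]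
  prog k := by
    -- Register `k` must survive the first computation, since the second one also reads the
    -- environment. The second leaves all registers below `k + 2` alone and so keeps the first
    -- result.
    obtain ⟨c, T, hT, hc⟩ := h₁.prog_scratch k (k + 1)
    obtain ⟨d, U, hU, hd⟩ := h₂.prog_scratch k (k + 2)
    refine ⟨.seq c (.seq d (.assign k (.cons (.var (k + 1)) (.var (k + 2))))), _,
      ((hT.add hU).add ((h₁.out_bdd.add h₂.out_bdd).add (h₁.out_bdd.add h₂.out_bdd))).add
        (.const 1), fun i σ hσ => ?_⟩
    obtain ⟨τ, t, r, hτ, hj, ht⟩ := hc i σ hσ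
    obtain ⟨ρ, u, s, hρ, hj', hu⟩ := hd i τ (by rw [hj k (by omega), hσ])
    have e : ρ (k + 1) = y i := by rw [hj' _ (by omega), hτ]
    refine ⟨_, _, .seq r (.seq s (.assign k _ ρ)), by simp [Expr.eval, e, hρ], fun j h => ?_, ?_⟩
    · rw [Function.update_of_ne h.ne, hj' j (by omega), hj j (by omega)]
    · simp only [Expr.cost, Expr.eval, Data.size, e, hρ]; omega

/-- The result `w` is described separately in the two cases, so that no decidability instance occurs
and `w` may be any expression. -/
theorem ite_nil {b : ι → Data} (hb : PolyTime m x b) (h₁ : PolyTime m x y)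
    (h₂ : PolyTime m x z) {w : ι → Data} (hy : ∀ i, b i ≠ .nil → w i = y i)
    (hz : ∀ i, b i = .nil → w i = z i) : PolyTime m x w where
  in_bdd := h₁.in_bdd
  out_bdd := (h₁.out_bdd.add h₂.out_bdd).mono fun i => by
    by_cases h : b i = .nil
    · rw [hz i h]; omega
    · rw [hy i h]; omega
  prog k := by
    obtain ⟨a, V, hV, ha⟩ := hb.prog_scratch k (k + 1)
    obtain ⟨c, T, hT, hc⟩ := h₁.prog k
    obtain ⟨d, U, hU, hd⟩ := h₂.prog k
    refine ⟨.seq a (.branch (.var (k + 1)) c d), _,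
      (hV.add (hb.out_bdd.add (.const 1))).add (hT.add hU), fun i σ hσ => ?_⟩
    obtain ⟨τ, t, r, hτ, hj, ht⟩ := ha i σ hσ
    have hk : τ k = x i := by rw [hj k (by omega), hσ]
    by_cases h : b i = .nil
    · obtain ⟨ρ, u, s, hρ, hj', hu⟩ := hd i τ hk
      refine ⟨ρ, _, .seq r (.branch_false (by simp [Expr.eval, hτ, h]) s), by rw [hρ, hz i h],
        fun j hl => by rw [hj' j hl, hj j (by omega)], ?_⟩
      simp only [Expr.cost, hτ]; omega
    · obtain ⟨ρ, u, s, hρ, hj', hu⟩ := hc i τ hk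
      refine ⟨ρ, _, .seq r (.branch_true (by simp [Expr.eval, hτ, h]) s), by rw [hρ, hy i h],
        fun j hl => by rw [hj' j hl, hj j (by omega)], ?_⟩
      simp only [Expr.cost, hτ]; omega

/-- Change of index, measure and environment. -/
theorem weaken {κ : Type*} {m' : κ → ℕ} {x' : κ → Data} (h : PolyTime m x y) (φ : κ → ι)
    (hm : ∀ j, m (φ j) ≤ m' j) (hx : PolyTime m' x' fun j => x (φ j)) :
    PolyTime m' x' fun j => y (φ j) := by
  have hm' : PolyBdd m' fun j => m (φ j) := PolyBdd.self.mono hm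
  refine hx.trans ⟨h.in_bdd.reindex φ hm', h.out_bdd.reindex φ hm', fun k => ?_⟩
  obtain ⟨c, T, hT, hc⟩ := h.prog k
  exact ⟨c, _, hT.reindex φ hm', fun j σ hσ => hc (φ j) σ hσ⟩

end PolyTime

theorem Data.size_ofList_map_mem_le {α : Type*} (e : α → Data) {l : List α} {a : α} (h : a ∈ l) :
    (e a).size ≤ (Data.ofList (l.map e)).size := by
  induction l with
  | nil => simp at h
  | cons b l ih =>
    rcases List.mem_cons.1 h with rfl | h
    · simp [Data.ofList, Data.size]; omega
    · have := ih h
      simp [Data.ofList, Data.size]; omega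

theorem Data.length_le_size_ofList (l : List Data) : l.length ≤ (Data.ofList l).size := by
  induction l with
  | nil => simp
  | cons b l ih => simp [Data.ofList, Data.size]; omega

/-! ### Loops over lists. -/

section Fold

variable {ι : Type*} {m : ι → ℕ} {x : ι → Data} {α β : ι → Type*} (ea : ∀ i, α i → Data)
  (eb : ∀ i, β i → Data) (f : ∀ i, β i → α i → β i)

/-- The loop of the program for a fold over a list: `k` holds the environment, `k + 1` the rest
of the list and `k + 2` the state. -/
theorem runs_fold_loop {k : ℕ} {c : Program}
    {U : (Σ i, β i × α i) → ℕ}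
    (hc : ∀ (j : Σ i, β i × α i) (σ : Store),
      σ (k + 3) = .cons (x j.1) (.cons (ea j.1 j.2.2) (eb j.1 j.2.1)) →
      ∃ (τ : Store) (t : ℕ), Runs c σ τ t ∧ τ (k + 3) = eb j.1 (f j.1 j.2.1 j.2.2) ∧
        (∀ l < k + 3, τ l = σ l) ∧ t ≤ U j)
    (i : ι) (I : List (α i) → β i → Prop) (Q B V X N : ℕ) (hX : (x i).size ≤ X)
    (hQ : ∀ b a l', I (a :: l') b → I l' (f i b a) ∧ (eb i (f i b a)).size ≤ (eb i b).size + Q)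
    (l : List (α i)) :
    (∀ b a, a ∈ l → (eb i b).size ≤ B → U ⟨i, b, a⟩ ≤ V) →
    (Data.ofList (l.map (ea i))).size ≤ N →
    ∀ (b : β i) (σ : Store), I l b → (eb i b).size + l.length * Q ≤ B → σ k = x i →
      σ (k + 1) = Data.ofList (l.map (ea i)) → σ (k + 2) = eb i b →
      ∃ (τ : Store) (t : ℕ),
        Runs (.loop (.var (k + 1))
          (.seq (.assign (k + 3) (.cons (.var k) (.cons (.hd (.var (k + 1))) (.var (k + 2)))))
            (.seq c (.seq (.assign (k + 2) (.var (k + 3)))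
              (.assign (k + 1) (.tl (.var (k + 1)))))))) σ τ t ∧
        τ (k + 2) = eb i (l.foldl (f i) b) ∧ (∀ j ≤ k, τ j = σ j) ∧
        t ≤ (l.length + 1) * (2 * X + 8 * N + 4 * B + V + 4) := by
  induction l with
  | nil =>
    intro _ hN b σ _ _ _ h₁ h₂
    refine ⟨σ, _, .loop_false (by simp [Expr.eval, h₁, Data.ofList]), by simp [h₂],
      fun _ _ => rfl, ?_⟩
    simp only [Expr.cost, h₁]
    simp at hN ⊢
    omega
  | cons a l ih =>
    intro hV hN b σ hI hB h₀ h₁ h₂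
    -- `B` dominates the present state plus `Q` for every remaining element. A step uses up one `Q`,
    -- so this bound passes to the rest of the list.
    have hlen : (a :: l).length * Q = l.length * Q + Q := by simp [add_mul]
    have hN' : (Data.ofList (l.map (ea i))).size + (ea i a).size + 1 ≤ N := by
      simp [Data.ofList, Data.size] at hN; omega
    set σ₁ := Function.update σ (k + 3) (.cons (x i) (.cons (ea i a) (eb i b))) with hσ₁
    obtain ⟨σ₂, t, r, e₂, hj₂, ht⟩ := hc ⟨i, b, a⟩ σ₁ (by simp [hσ₁])
    set b' := f i b a with hb'
    obtain ⟨hI', hb'Q⟩ : I l b' ∧ (eb i b').size ≤ (eb i b).size + Q := hQ b a l hI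
    set σ₃ := Function.update σ₂ (k + 2) (eb i b') with hσ₃
    set σ₄ := Function.update σ₃ (k + 1) (Data.ofList (l.map (ea i))) with hσ₄
    have low : ∀ j ≤ k, σ₄ j = σ j := fun j hj => by
      rw [hσ₄, Function.update_of_ne (by omega), hσ₃, Function.update_of_ne (by omega),
        hj₂ j (by omega), hσ₁, Function.update_of_ne (by omega)]
    have e21 : σ₂ (k + 1) = Data.ofList ((a :: l).map (ea i)) := by
      rw [hj₂ _ (by omega), hσ₁, Function.update_of_ne (by omega), h₁]
    obtain ⟨τ, u, s, eτ, hjτ, hu⟩ := ih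
      (fun b a' h => hV b a' (by simp [h])) (by omega) b' σ₄ hI' (by omega) (by rw [low k le_rfl, h₀])
      (by simp [hσ₄]) (by rw [hσ₄, Function.update_of_ne (by omega)]; simp [hσ₃])
    have r₁ : Runs (.assign (k + 3) (.cons (.var k) (.cons (.hd (.var (k + 1)))
        (.var (k + 2))))) σ σ₁ _ :=
      .assign_of_eval (by simp [Expr.eval, h₀, h₁, h₂, Data.ofList, Data.hd])
    have r₃ : Runs (.assign (k + 2) (.var (k + 3))) σ₂ σ₃ _ :=
      .assign_of_eval (by simp [Expr.eval, e₂])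
    have e31 : σ₃ (k + 1) = Data.ofList ((a :: l).map (ea i)) := by
      rw [hσ₃, Function.update_of_ne (by omega), e21]
    have r₄ : Runs (.assign (k + 1) (.tl (.var (k + 1)))) σ₃ σ₄ _ :=
      .assign_of_eval (by simp [Expr.eval, e31, Data.ofList, Data.tl])
    refine ⟨τ, _, .loop_true (by simp [Expr.eval, h₁, Data.ofList])
      (.seq r₁ (.seq r (.seq r₃ r₄))) s, by simp [eτ, hb'],
      fun j hj => by rw [hjτ j hj, low j hj], ?_⟩
    have hVt := hV b a (by simp) (by omega)
    have : (a :: l).length + 1 = (l.length + 1) + 1 := by simp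
    rw [this, add_mul _ 1, one_mul]
    simp only [Expr.cost, Expr.eval, h₀, h₁, h₂, e₂, e31, List.map_cons, Data.ofList, Data.hd,
      Data.tl, Data.size]
    simp only [← hb'] at *
    omega

/-- Folding over a list takes polynomial time if each step does and the size of the state grows
by a polynomially bounded amount in each step. The latter is only required for states that satisfy
an invariant, which may depend on the rest of the list. -/
theorem PolyTime.fold_invariant (I : ∀ i, List (α i) → β i → Prop) {l : ∀ i, List (α i)} {s : ∀ i, β i}
    (hl : PolyTime m x fun i => Data.ofList ((l i).map (ea i)))
    (hs : PolyTime m x fun i => eb i (s i))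
    {Q : ι → ℕ} (hQ : PolyBdd m Q)
    (hI : ∀ i, I i (l i) (s i))
    (hinc : ∀ i b a l', I i (a :: l') b →
      I i l' (f i b a) ∧ (eb i (f i b a)).size ≤ (eb i b).size + Q i)
    (hstep : ∀ (m' : (Σ i, β i × α i) → ℕ) (x' : (Σ i, β i × α i) → Data),
      (∀ j, m j.1 ≤ m' j) →
      (∀ y, PolyTime m x y → PolyTime m' x' fun j => y j.1) →
      (PolyTime m' x' fun j => ea j.1 j.2.2) → (PolyTime m' x' fun j => eb j.1 j.2.1) →
      PolyTime m' x' fun j => eb j.1 (f j.1 j.2.1 j.2.2)) :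
    PolyTime m x fun i => eb i ((l i).foldl (f i) (s i)) := by
  have hx := hl.in_bdd
  -- The loop body sees the environment, the current element and the state, and its time is measured
  -- in the sizes of all three. `hstep` is stated for an arbitrary such environment, so that its
  -- users need not know how the three are packed.
  set m' : (Σ i, β i × α i) → ℕ := fun j => m j.1 + (eb j.1 j.2.1).size + (ea j.1 j.2.2).size
    with hm'
  set x' : (Σ i, β i × α i) → Data := fun j =>
    .cons (x j.1) (.cons (ea j.1 j.2.2) (eb j.1 j.2.1)) with hx'
  have hmm : ∀ j, m j.1 ≤ m' j := fun j => by simp only [hm']; omega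
  have hxb : PolyBdd m' fun j => (x' j).size :=
    (((hx.reindex Sigma.fst (PolyBdd.self.mono hmm)).add PolyBdd.self).add (.const 2)).mono
      fun j => by simp only [hx', hm', Data.size]; omega
  have hid := PolyTime.id hxb
  have hst : PolyTime m' x' fun j => eb j.1 (f j.1 j.2.1 j.2.2) :=
    hstep m' x' hmm (fun y hy => hy.weaken Sigma.fst hmm hid.hd) hid.tl.hd hid.tl.tl
  set N : ι → ℕ := fun i => (Data.ofList ((l i).map (ea i))).size with hN
  have hNb : PolyBdd m N := hl.out_bdd
  set B : ι → ℕ := fun i => (eb i (s i)).size + N i * Q i with hBdef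
  have hBb : PolyBdd m B := hs.out_bdd.add (hNb.mul hQ)
  have hlenN : ∀ i, (l i).length ≤ N i := fun i => by
    simpa using Data.length_le_size_ofList ((l i).map (ea i))
  have grow : ∀ i (l' : List (α i)) b, I i l' b →
      (eb i (l'.foldl (f i) b)).size ≤ (eb i b).size + l'.length * Q i := by
    intro i l'
    induction l' with
    | nil => intro b _; simp
    | cons a l' ih =>
      intro b h
      obtain ⟨h', h2⟩ := hinc i b a l' h
      have h1 := ih (f i b a) h'
      simp only [List.foldl_cons, List.length_cons, add_mul, one_mul]
      omega
  refine ⟨hx, hBb.mono fun i => (grow i (l i) (s i) (hI i)).trans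
    (by simpa only [hBdef] using Nat.add_le_add_left (Nat.mul_le_mul_right _ (hlenN i)) _), ?_⟩
  intro k
  obtain ⟨c₁, T₁, hT₁, h₁⟩ := hl.prog_scratch k (k + 1)
  obtain ⟨c₂, T₂, hT₂, h₂⟩ := hs.prog_scratch k (k + 2)
  obtain ⟨c, U, ⟨p, hp⟩, hc⟩ := hst.prog (k + 3)
  -- `m + B + N` dominates `m'` for every element and state met during the loop, so a single value
  -- of the step polynomial bounds every iteration.
  set V : ι → ℕ := fun i => p.eval (m i + B i + N i) with hV
  have hVb : PolyBdd m V :=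
    PolyBdd.reindex (m := fun n : ℕ => n) (f := fun n => p.eval n) ⟨p, fun _ => le_rfl⟩
      (fun i => m i + B i + N i) ((PolyBdd.self.add hBb).add hNb)
  refine ⟨.seq c₁ (.seq c₂ (.seq (.loop (.var (k + 1))
          (.seq (.assign (k + 3) (.cons (.var k) (.cons (.hd (.var (k + 1))) (.var (k + 2)))))
            (.seq c (.seq (.assign (k + 2) (.var (k + 3)))
              (.assign (k + 1) (.tl (.var (k + 1)))))))) (.assign k (.var (k + 2))))), _,
    (hT₁.add hT₂).add (((hNb.add (.const 1)).mul
      ((((((PolyBdd.const 2).mul hx).add ((PolyBdd.const 8).mul hNb)).add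
        ((PolyBdd.const 4).mul hBb)).add hVb).add (.const 4))).add hBb), fun i σ hσ => ?_⟩
  obtain ⟨σ₁, t₁, r₁, e₁, j₁, ht₁⟩ := h₁ i σ hσ
  obtain ⟨σ₂, t₂, r₂, e₂, j₂, ht₂⟩ := h₂ i σ₁ (by rw [j₁ k (by omega), hσ])
  obtain ⟨τ, t₃, r₃, e₃, j₃, ht₃⟩ := runs_fold_loop (x := x) ea eb f hc i (I i) (Q i) (B i) (V i)
    (x i).size (N i) le_rfl (hinc i) (l i)
    (fun b a ha hb => (hp _).trans (polynomial_eval_mono p (by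
      have := Data.size_ofList_map_mem_le (ea i) ha
      simp only [hm']
      simp only [hN]
      omega))) le_rfl (s i) σ₂ (hI i)
    (by simpa only [hBdef] using Nat.add_le_add_left (Nat.mul_le_mul_right _ (hlenN i)) _)
    (by rw [j₂ k (by omega), j₁ k (by omega), hσ]) (by rw [j₂ _ (by omega), e₁]) e₂
  refine ⟨_, _, .seq r₁ (.seq r₂ (.seq r₃ (.assign k _ τ))), by simp [Expr.eval, e₃],
    fun j hj => ?_, ?_⟩
  · rw [Function.update_of_ne hj.ne, j₃ j hj.le, j₂ j (by omega), j₁ j (by omega)]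
  · have hg : (eb i ((l i).foldl (f i) (s i))).size ≤ B i :=
      (grow i (l i) (s i) (hI i)).trans
        (by simpa only [hBdef] using Nat.add_le_add_left (Nat.mul_le_mul_right _ (hlenN i)) _)
    have h4 : t₃ ≤ (N i + 1) * (2 * (x i).size + 8 * N i + 4 * B i + V i + 4) :=
      ht₃.trans (Nat.mul_le_mul_right _ (by have := hlenN i; omega))
    simp only [Expr.cost, e₃]
    omega

/-- The invariant is that the remaining elements belong to the original list. -/
theorem PolyTime.fold {l : ∀ i, List (α i)} {s : ∀ i, β i}
    (hl : PolyTime m x fun i => Data.ofList ((l i).map (ea i)))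
    (hs : PolyTime m x fun i => eb i (s i))
    {Q : ι → ℕ} (hQ : PolyBdd m Q)
    (hinc : ∀ i b a, a ∈ l i → (eb i (f i b a)).size ≤ (eb i b).size + Q i)
    (hstep : ∀ (m' : (Σ i, β i × α i) → ℕ) (x' : (Σ i, β i × α i) → Data),
      (∀ j, m j.1 ≤ m' j) →
      (∀ y, PolyTime m x y → PolyTime m' x' fun j => y j.1) →
      (PolyTime m' x' fun j => ea j.1 j.2.2) → (PolyTime m' x' fun j => eb j.1 j.2.1) →
      PolyTime m' x' fun j => eb j.1 (f j.1 j.2.1 j.2.2)) :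
    PolyTime m x fun i => eb i ((l i).foldl (f i) (s i)) :=
  .fold_invariant ea eb f (fun i l' _ => ∀ a ∈ l', a ∈ l i) hl hs hQ (fun _ _ h => h)
    (fun i b a _ h => ⟨fun a' h' => h a' (List.mem_cons_of_mem _ h'), hinc i b a (h a (by simp))⟩)
    hstep

end Fold

/-! ### Decidable predicates, lists and sets -/

/-- Uniformly in `i`, the truth of `P i` can be decided from `x i` in time polynomial in `m i`. -/
def PolyDec {ι : Type*} (m : ι → ℕ) (x : ι → Data) (P : ι → Prop) : Prop :=
  ∃ y, PolyTime m x y ∧ ∀ i, y i ≠ .nil ↔ P i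

section Basic

variable {ι κ : Type*} {m : ι → ℕ} {x y z : ι → Data} {P Q : ι → Prop}

theorem PolyTime.const (hx : PolyBdd m fun i => (x i).size) (d : Data) :
    PolyTime m x fun _ => d := by
  induction d with
  | nil => exact .nil hx
  | cons a b iha ihb => exact iha.cons ihb

theorem PolyDec.in_bdd (h : PolyDec m x P) : PolyBdd m fun i => (x i).size :=
  h.choose_spec.1.in_bdd

theorem PolyTime.ite [∀ i, Decidable (P i)] (hP : PolyDec m x P) (hy : PolyTime m x y)
    (hz : PolyTime m x z) : PolyTime m x fun i => if P i then y i else z i := by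
  obtain ⟨b, hb, h⟩ := hP
  exact .ite_nil hb hy hz (fun i hi => if_pos ((h i).1 hi)) fun i hi => if_neg (by simp [← h, hi])

/-- A case distinction between values of an encoded type. -/
theorem PolyTime.ite_enc [∀ i, Decidable (P i)] {β : ι → Type*} (e : ∀ i, β i → Data)
    {u v : ∀ i, β i} (hP : PolyDec m x P)
    (hy : PolyTime m x fun i => e i (u i)) (hz : PolyTime m x fun i => e i (v i)) :
    PolyTime m x fun i => e i (if P i then u i else v i) := by
  have h := PolyTime.ite hP hy hz
  have e' : (fun i => e i (if P i then u i else v i)) =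
      fun i => if P i then e i (u i) else e i (v i) := by
    funext i; split <;> rfl
  rwa [e']

namespace PolyDec

theorem congr (hP : PolyDec m x P) (h : ∀ i, P i ↔ Q i) : PolyDec m x Q := by
  obtain ⟨y, hy, e⟩ := hP
  exact ⟨y, hy, fun i => (e i).trans (h i)⟩

theorem not (hP : PolyDec m x P) : PolyDec m x fun i => ¬ P i := by
  classical
  exact ⟨_, PolyTime.ite hP (.nil hP.in_bdd) (.const hP.in_bdd (.cons .nil .nil)), fun i => by
    by_cases h : P i <;> simp [h]⟩

theorem and (hP : PolyDec m x P) (hQ : PolyDec m x Q) : PolyDec m x fun i => P i ∧ Q i := by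
  classical
  obtain ⟨y, hy, e⟩ := hQ
  exact ⟨_, PolyTime.ite hP hy (.nil hP.in_bdd), fun i => by
    by_cases h : P i <;> simp [h, ← e]⟩

theorem imp (hP : PolyDec m x P) (hQ : PolyDec m x Q) : PolyDec m x fun i => P i → Q i :=
  (hP.and hQ.not).not.congr fun i => by tauto

theorem or (hP : PolyDec m x P) (hQ : PolyDec m x Q) : PolyDec m x fun i => P i ∨ Q i :=
  (hP.not.and hQ.not).not.congr fun i => by tauto

theorem lift {m' : κ → ℕ} {x' : κ → Data} {φ : κ → ι}
    (L : ∀ y, PolyTime m x y → PolyTime m' x' fun j => y (φ j)) (hP : PolyDec m x P) :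
    PolyDec m' x' fun j => P (φ j) := by
  obtain ⟨y, hy, e⟩ := hP
  exact ⟨_, L y hy, fun j => e (φ j)⟩

end PolyDec

theorem PolyTime.dec_ofBool {b : ι → Bool} (h : PolyTime m x fun i => .ofBool (b i)) :
    PolyDec m x fun i => b i = true :=
  ⟨_, h, fun i => by cases h : b i <;> simp [Data.ofBool, h]⟩

theorem PolyDec.ofBool [∀ i, Decidable (P i)] (h : PolyDec m x P) :
    PolyTime m x fun i => .ofBool (decide (P i)) := by
  have := PolyTime.ite_enc (fun _ => Data.ofBool) (u := fun _ => true) (v := fun _ => false) h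
    (.const h.in_bdd _) (.const h.in_bdd _)
  simpa using this

theorem Data.size_ofBool_le (b : Bool) : (Data.ofBool b).size ≤ 3 := by
  cases b <;> simp [Data.ofBool, Data.size]

/-- Folds whose states are bounded by their type. -/
theorem PolyTime.fold_bdd {α β : ι → Type*} (ea : ∀ i, α i → Data)
    (eb : ∀ i, β i → Data) (f : ∀ i, β i → α i → β i) {l : ∀ i, List (α i)} {s : ∀ i, β i}
    {Q : ι → ℕ} (hQ : PolyBdd m Q) (hb : ∀ i b, (eb i b).size ≤ Q i)
    (hl : PolyTime m x fun i => Data.ofList ((l i).map (ea i)))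
    (hs : PolyTime m x fun i => eb i (s i))
    (hstep : ∀ (m' : (Σ i, β i × α i) → ℕ) (x' : (Σ i, β i × α i) → Data),
      (∀ j, m j.1 ≤ m' j) →
      (∀ y, PolyTime m x y → PolyTime m' x' fun j => y j.1) →
      (PolyTime m' x' fun j => ea j.1 j.2.2) → (PolyTime m' x' fun j => eb j.1 j.2.1) →
      PolyTime m' x' fun j => eb j.1 (f j.1 j.2.1 j.2.2)) :
    PolyTime m x fun i => eb i ((l i).foldl (f i) (s i)) :=
  .fold ea eb f hl hs hQ (fun i _ _ _ => (hb i _).trans (Nat.le_add_left _ _)) hstep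

theorem PolyDec.exists_mem {α : ι → Type*} (ea : ∀ i, α i → Data) {l : ∀ i, List (α i)}
    (hl : PolyTime m x fun i => Data.ofList ((l i).map (ea i))) {R : ∀ i, α i → Prop}
    (hR : ∀ (m' : (Σ i, Bool × α i) → ℕ) (x' : (Σ i, Bool × α i) → Data),
      (∀ j, m j.1 ≤ m' j) →
      (∀ y, PolyTime m x y → PolyTime m' x' fun j => y j.1) →
      (PolyTime m' x' fun j => ea j.1 j.2.2) → PolyDec m' x' fun j => R j.1 j.2.2) :
    PolyDec m x fun i => ∃ a ∈ l i, R i a := by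
  classical
  have h := PolyTime.fold_bdd (m := m) (x := x) ea (fun _ => Data.ofBool)
    (fun i b a => Decidable.decide (b = true ∨ R i a)) (l := l) (s := fun _ => false) (.const 3)
    (fun _ => Data.size_ofBool_le) hl (.const hl.in_bdd _)
    (fun m' x' hm L ha hb => (hb.dec_ofBool.or (hR m' x' hm L ha)).ofBool)
  refine h.dec_ofBool.congr fun i => ?_
  have : ∀ (l : List (α i)) (b : Bool),
      l.foldl (fun b a => decide (b = true ∨ R i a)) b = true ↔ b = true ∨ ∃ a ∈ l, R i a := by
    intro l
    induction l with
    | nil => simp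
    | cons a l ih => intro b; rw [List.foldl_cons, ih]; simp [or_assoc]
  exact (this (l i) false).trans (by simp)

theorem PolyDec.forall_mem {α : ι → Type*} (ea : ∀ i, α i → Data) {l : ∀ i, List (α i)}
    (hl : PolyTime m x fun i => Data.ofList ((l i).map (ea i))) {R : ∀ i, α i → Prop}
    (hR : ∀ (m' : (Σ i, Bool × α i) → ℕ) (x' : (Σ i, Bool × α i) → Data),
      (∀ j, m j.1 ≤ m' j) →
      (∀ y, PolyTime m x y → PolyTime m' x' fun j => y j.1) →
      (PolyTime m' x' fun j => ea j.1 j.2.2) → PolyDec m' x' fun j => R j.1 j.2.2) :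
    PolyDec m x fun i => ∀ a ∈ l i, R i a :=
  (PolyDec.exists_mem ea hl (R := fun i a => ¬ R i a)
    fun m' x' hm L ha => (hR m' x' hm L ha).not).not.congr fun i => by push Not; rfl

theorem List.foldl_flip_cons {α : Type*} (l acc : List α) :
    l.foldl (fun acc a => a :: acc) acc = l.reverse ++ acc := by
  induction l generalizing acc with
  | nil => rfl
  | cons a l ih => simp [ih]

/-- A fold can only prepend cheaply, so lists come out reversed. This form builds concatenations
directly, and with an empty second list it restores the order. -/
theorem PolyTime.reverse_append {α : ι → Type*} (ea : ∀ i, α i → Data)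
    {l l' : ∀ i, List (α i)} (hl : PolyTime m x fun i => Data.ofList ((l i).map (ea i)))
    (hl' : PolyTime m x fun i => Data.ofList ((l' i).map (ea i))) :
    PolyTime m x fun i => Data.ofList (((l i).reverse ++ l' i).map (ea i)) := by
  have h := PolyTime.fold (m := m) (x := x) ea (fun i l => Data.ofList (l.map (ea i)))
    (fun _ acc a => a :: acc) hl hl' (Q := fun i => (Data.ofList ((l i).map (ea i))).size + 1)
    (hl.out_bdd.add (.const 1))
    (fun i b a ha => by
      have := Data.size_ofList_map_mem_le (ea i) ha
      simp [Data.ofList, Data.size]; omega)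
    (fun m' x' hm L ha hb => ha.cons hb)
  simpa only [List.foldl_flip_cons] using h

theorem PolyTime.reverse {α : ι → Type*} (ea : ∀ i, α i → Data)
    {l : ∀ i, List (α i)} (hl : PolyTime m x fun i => Data.ofList ((l i).map (ea i))) :
    PolyTime m x fun i => Data.ofList ((l i).reverse.map (ea i)) := by
  have := hl.reverse_append ea (l' := fun i => []) (.nil hl.in_bdd)
  simpa using this

/-! ### Operations on characteristic vectors -/

theorem encodeSet_eq {n : ℕ} (A : Finset (Fin n)) :
    encodeSet A = .ofList (((List.finRange n).map fun i => decide (i ∈ A)).map .ofBool) := by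
  simp [encodeSet, List.ofFn_eq_map, Function.comp_def]

theorem size_ofList_ofBool_le (l : List Bool) :
    (Data.ofList (l.map .ofBool)).size ≤ 4 * l.length + 1 := by
  induction l with
  | nil => simp [Data.ofList, Data.size]
  | cons b l ih =>
    have := Data.size_ofBool_le b
    simp [Data.ofList, Data.size]; omega

theorem size_encodeSet_le {n : ℕ} (A : Finset (Fin n)) : (encodeSet A).size ≤ 4 * n + 1 := by
  rw [encodeSet_eq]
  simpa using size_ofList_ofBool_le ((List.finRange n).map fun i => decide (i ∈ A))

theorem foldl_zip_eq {α : Type*} (g : Bool → Bool → Bool) (u v : α → Bool) (l : List α)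
    (acc : List Bool) :
    ((l.map u).foldl (fun (s : List Bool × List Bool) a =>
      (s.1.tail, g a (s.1.headD false) :: s.2)) (l.map v, acc)).2 =
      (l.map fun i => g (u i) (v i)).reverse ++ acc := by
  induction l generalizing acc with
  | nil => rfl
  | cons a l ih =>
    simp only [List.map_cons, List.foldl_cons, List.tail_cons, List.headD_cons, ih,
      List.reverse_cons, List.append_assoc, List.singleton_append]

/-- A single pass over the bits of `A`: the state holds the unread bits of `B` and the result so far
in reverse. -/
theorem PolyTime.bitwise {n : ι → ℕ} {A B C : ∀ i, Finset (Fin (n i))} (g : Bool → Bool → Bool)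
    (hA : PolyTime m x fun i => encodeSet (A i)) (hB : PolyTime m x fun i => encodeSet (B i))
    (hC : ∀ i e, decide (e ∈ C i) = g (decide (e ∈ A i)) (decide (e ∈ B i))) :
    PolyTime m x fun i => encodeSet (C i) := by
  simp only [encodeSet_eq] at hA hB ⊢
  simp only [hC]
  have hx := hA.in_bdd
  have h := PolyTime.fold (m := m) (x := x) (α := fun _ => Bool)
    (β := fun _ => List Bool × List Bool) (fun _ => Data.ofBool)
    (fun _ s => .cons (.ofList (s.1.map .ofBool)) (.ofList (s.2.map .ofBool)))
    (fun _ s a => (s.1.tail, g a (s.1.headD false) :: s.2)) hA (s := fun i => (_, []))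
    (hB.cons (.nil hx)) (.const 4)
    (fun i b a _ => by
      rcases b with ⟨_ | ⟨b, l⟩, r⟩ <;> simp only [List.tail, List.headD, List.map,
        Data.ofList, Data.size]
      · have := Data.size_ofBool_le (g a false); omega
      · have := Data.size_ofBool_le (g a b); omega)
    (fun m' x' hm L ha hb => by
      have hx' := ha.in_bdd
      have e : ∀ l : List Bool, (Data.ofList (l.map .ofBool)).hd = .ofBool (l.headD false) := by
        rintro (_ | ⟨a, l⟩) <;> rfl
      have e' : ∀ l : List Bool, (Data.ofList (l.map .ofBool)).tl = .ofList (l.tail.map .ofBool) := by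
        rintro (_ | ⟨a, l⟩) <;> rfl
      have h1 : PolyTime m' x' fun j => (Data.ofList (j.2.1.1.map .ofBool)).hd := hb.hd.hd
      have h2 : PolyTime m' x' fun j => (Data.ofList (j.2.1.1.map .ofBool)).tl := hb.hd.tl
      simp only [e, e'] at h1 h2
      refine h2.cons (.cons ?_ hb.tl)
      have hh := PolyTime.ite_enc (fun _ => Data.ofBool) (u := fun _ => _) (v := fun _ => _)
        ha.dec_ofBool
        (PolyTime.ite_enc (fun _ => Data.ofBool) (u := fun _ => _) (v := fun _ => _)
          h1.dec_ofBool (.const hx' (.ofBool (g true true))) (.const hx' (.ofBool (g true false))))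
        (PolyTime.ite_enc (fun _ => Data.ofBool) (u := fun _ => _) (v := fun _ => _)
          h1.dec_ofBool (.const hx' (.ofBool (g false true))) (.const hx' (.ofBool (g false false))))
      convert hh using 3 with j
      rcases h : j.snd.2 <;> rcases h' : (j.snd.1.1.headD false) <;> simp)
  have h3 := (h.tl).reverse (α := fun _ => Bool) (fun _ => Data.ofBool)
  simpa only [Data.tl, foldl_zip_eq, List.append_nil, List.reverse_reverse] using h3

variable {n : ι → ℕ} {A B : ∀ i, Finset (Fin (n i))}

theorem PolyTime.union (hA : PolyTime m x fun i => encodeSet (A i))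
    (hB : PolyTime m x fun i => encodeSet (B i)) :
    PolyTime m x fun i => encodeSet (A i ∪ B i) :=
  hA.bitwise (fun a b => a || b) hB fun i e => by simp

theorem PolyTime.sdiff (hA : PolyTime m x fun i => encodeSet (A i))
    (hB : PolyTime m x fun i => encodeSet (B i)) :
    PolyTime m x fun i => encodeSet (A i \ B i) :=
  hA.bitwise (fun a b => a && !b) hB fun i e => by simp

theorem PolyTime.dec_nonempty (hA : PolyTime m x fun i => encodeSet (A i)) :
    PolyDec m x fun i => (A i).Nonempty := by
  simp only [encodeSet_eq] at hA
  refine (PolyDec.exists_mem (α := fun _ => Bool) (fun _ => Data.ofBool) hA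
    (R := fun _ b => b = true) fun m' x' hm L ha => ha.dec_ofBool).congr fun i => ?_
  simp [Finset.Nonempty]

theorem PolyTime.dec_eq_empty (hA : PolyTime m x fun i => encodeSet (A i)) :
    PolyDec m x fun i => A i = ∅ :=
  hA.dec_nonempty.not.congr fun i => by simp

theorem PolyTime.dec_subset (hA : PolyTime m x fun i => encodeSet (A i))
    (hB : PolyTime m x fun i => encodeSet (B i)) : PolyDec m x fun i => A i ⊆ B i :=
  (hA.sdiff hB).dec_eq_empty.congr fun i => by simp

theorem PolyTime.dec_eq (hA : PolyTime m x fun i => encodeSet (A i))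
    (hB : PolyTime m x fun i => encodeSet (B i)) : PolyDec m x fun i => A i = B i :=
  ((hA.dec_subset hB).and (hB.dec_subset hA)).congr fun _ => Finset.Subset.antisymm_iff.symm

theorem PolyTime.dec_mem {p : ∀ i, Fin (n i)} (hp : PolyTime m x fun i => encodeSet {p i})
    (hA : PolyTime m x fun i => encodeSet (A i)) : PolyDec m x fun i => p i ∈ A i :=
  (hp.dec_subset hA).congr fun i => by simp

theorem PolyTime.dec_eq_point {p q : ∀ i, Fin (n i)} (hp : PolyTime m x fun i => encodeSet {p i})
    (hq : PolyTime m x fun i => encodeSet {q i}) : PolyDec m x fun i => p i = q i :=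
  (hp.dec_mem hq).congr fun i => by simp

theorem PolyTime.fold_set {α : ι → Type*} (ea : ∀ i, α i → Data)
    (f : ∀ i, Finset (Fin (n i)) → α i → Finset (Fin (n i))) {l : ∀ i, List (α i)}
    (hn : PolyBdd m n)
    (hl : PolyTime m x fun i => Data.ofList ((l i).map (ea i)))
    (hA : PolyTime m x fun i => encodeSet (A i))
    (hstep : ∀ (m' : (Σ i, Finset (Fin (n i)) × α i) → ℕ)
      (x' : (Σ i, Finset (Fin (n i)) × α i) → Data),
      (∀ y, PolyTime m x y → PolyTime m' x' fun j => y j.1) →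
      (PolyTime m' x' fun j => ea j.1 j.2.2) → (PolyTime m' x' fun j => encodeSet j.2.1) →
      PolyTime m' x' fun j => encodeSet (f j.1 j.2.1 j.2.2)) :
    PolyTime m x fun i => encodeSet ((l i).foldl (f i) (A i)) :=
  .fold_bdd ea (fun _ => encodeSet) f (((PolyBdd.const 4).mul hn).add (.const 1))
    (fun _ => size_encodeSet_le) hl hA fun m' x' _ L => hstep m' x' L

end Basic

/-! ### The list of all singletons -/

/-- A unary number is literally a zero vector. It therefore encodes the empty set and supplies the
zeros of the unit vectors. -/
theorem Data.ofNat_eq (k : ℕ) : Data.ofNat k = .ofList ((List.replicate k false).map .ofBool) := by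
  induction k with
  | zero => rfl
  | succ k ih => simp [List.replicate_succ, Data.ofNat, Data.ofList, Data.ofBool, ih]

theorem Data.size_ofNat (k : ℕ) : (Data.ofNat k).size = 2 * k + 1 := by
  induction k with
  | zero => rfl
  | succ k ih => simp [Data.ofNat, Data.size, ih]; omega

section Points

variable {ι : Type*} {m : ι → ℕ} {x : ι → Data}

theorem PolyTime.bdd_of_nat {n : ι → ℕ} (hn : PolyTime m x fun i => .ofNat (n i)) : PolyBdd m n :=
  hn.out_bdd.mono fun i => by rw [Data.size_ofNat]; omega

/-- The characteristic vector of length `n` with a single bit, at position `u`. -/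
def unitVector (n u : ℕ) : List Bool :=
  List.replicate u false ++ true :: List.replicate (n - u - 1) false

theorem encodeSet_singleton {n : ℕ} (p : Fin n) :
    encodeSet {p} = .ofList ((unitVector n p).map .ofBool) := by
  rw [encodeSet_eq]
  congr 2
  apply List.ext_getElem
  · simp [unitVector]; omega
  · intro i h₁ h₂
    simp only [List.getElem_map, List.getElem_finRange, unitVector, Finset.mem_singleton]
    rcases lt_trichotomy i p with h | h | h
    · rw [List.getElem_append_left (by simpa using h)]
      simp [Fin.ext_iff]; omega
    · subst h
      rw [List.getElem_append_right (by simp)]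
      simp
    · rw [List.getElem_append_right (by simp; omega)]
      obtain ⟨c, rfl⟩ : ∃ c, i = p + c + 1 := ⟨i - p - 1, by omega⟩
      simp only [List.length_replicate, show (p : ℕ) + c + 1 - p = c + 1 by omega,
        List.getElem_cons_succ, List.getElem_replicate]
      simp [Fin.ext_iff]; omega

/-- The state carries both `u` and `n - u` in unary, because the zeros before and after the one in
position `u` are copied from them. The invariant keeps `u` at most `n`, which bounds the size of the
vectors. -/
theorem PolyTime.points {n : ι → ℕ} (hn : PolyTime m x fun i => .ofNat (n i)) :
    PolyTime m x fun i =>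
      Data.ofList ((List.finRange (n i)).map fun p => encodeSet ({p} : Finset (Fin (n i)))) := by
  have hx := hn.in_bdd
  have hl : PolyTime m x fun i =>
      Data.ofList ((List.replicate (n i) false).map .ofBool) := by simpa only [Data.ofNat_eq] using hn
  have h := PolyTime.fold_invariant (m := m) (x := x) (α := fun _ => Bool)
    (β := fun _ => ℕ × List (List Bool)) (fun _ => .ofBool)
    (fun i s => .cons (.ofNat s.1) (.cons (.ofNat (n i - s.1))
      (.ofList (s.2.map fun w => .ofList (w.map .ofBool)))))
    (fun i s _ => (s.1 + 1, unitVector (n i) s.1 :: s.2))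
    (fun i l s => s.1 + l.length = n i) hl (s := fun _ => (0, []))
    ((PolyTime.nil hx).cons (hn.cons (.nil hx)))
    (((PolyBdd.const 8).mul hn.bdd_of_nat).add (.const 12))
    (fun i => by simp)
    (fun i b a l' h => by
      have h0 : b.1 + (l'.length + 1) = n i := h
      refine ⟨by simp only; omega, ?_⟩
      have := size_ofList_ofBool_le (unitVector (n i) b.1)
      simp only [unitVector, List.length_append, List.length_cons, List.length_replicate] at this
      simp only [List.map_cons, Data.ofList, Data.size, Data.size_ofNat]
      simp only [unitVector]
      omega)
    (fun m' x' hm L ha hb => by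
      have hx' := ha.in_bdd
      have hu : PolyTime m' x' fun j => .ofNat j.2.1.1 := hb.hd
      have hv : PolyTime m' x' fun j => (Data.ofNat (n j.1 - j.2.1.1)).tl := hb.tl.hd.tl
      have e : ∀ k : ℕ, (Data.ofNat k).tl = .ofNat (k - 1) := by rintro (_ | k) <;> rfl
      simp only [e] at hv
      refine .cons (.cons (.nil hx') hu) (.cons ?_ (.cons ?_ hb.tl.tl))
      · simpa only [Nat.sub_sub] using hv
      · have hw : PolyTime m' x' fun j =>
            Data.ofList ((true :: List.replicate (n j.1 - j.2.1.1 - 1) false).map .ofBool) := by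
          simp only [List.map_cons, Data.ofList, ← Data.ofNat_eq]
          exact (PolyTime.const hx' (.ofBool true)).cons hv
        simp only [Data.ofNat_eq] at hu
        have := PolyTime.reverse_append (α := fun _ => Bool) (fun _ => Data.ofBool) hu hw
        simpa only [List.reverse_replicate, unitVector] using this)
  have h' := PolyTime.reverse (α := fun _ => List Bool)
    (fun _ (w : List Bool) => Data.ofList (w.map .ofBool)) h.tl.tl
  have e : ∀ (N k u : ℕ) (acc : List (List Bool)), ((List.replicate k false).foldl
      (fun (s : ℕ × List (List Bool)) _ => (s.1 + 1, unitVector N s.1 :: s.2)) (u, acc)).2 =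
      ((List.range' u k).map (unitVector N)).reverse ++ acc := by
    intro N k
    induction k with
    | zero => simp
    | succ k ih => intro u acc; simp [List.replicate_succ, ih, List.range'_succ]
  convert h' using 2 with i
  rw [e, List.append_nil, List.reverse_reverse, List.map_map, ← List.range_eq_range',
    ← List.map_coe_finRange_eq_range, List.map_map]
  congr 1
  apply List.map_congr_left
  intro p _
  exact encodeSet_singleton p

end Points

/-! ### The algorithm -/

section Algorithm

variable {n : ℕ} (S : List (Implication (Fin n)))

/-- Adds to `X`, for each implication in turn, the conclusion if the premise is contained. -/
def saturate (X : Finset (Fin n)) : Finset (Fin n) :=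
  S.foldl (fun X I => if I.1 ⊆ X then X ∪ I.2 else X) X

/-- The closure of `A` under the implications, those with empty conclusion ignored. -/
def implClosure (A : Finset (Fin n)) : Finset (Fin n) :=
  (List.finRange n).foldl (fun X _ => saturate S X) A

/-- The closure of `p` without `p`. -/
def below (p : Fin n) : Finset (Fin n) := implClosure S {p} \ {p}

/-- The least element of `X`, as a set. -/
def lowest (X : Finset (Fin n)) : Finset (Fin n) :=
  (List.finRange n).foldl (fun Y r => if Y = ∅ ∧ r ∈ X then {r} else Y) ∅

/-- A subset of `D`, irredundant among those that generate `D`. -/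
def irredundant (D : Finset (Fin n)) : Finset (Fin n) :=
  (List.finRange n).foldl
    (fun B q => if D ⊆ implClosure S (B \ {q}) then B \ {q} else B) D

/-- The closure of `p` and the elements below `q`. -/
def side (p q : Fin n) : Finset (Fin n) := implClosure S ({p} ∪ below S q)

/-- The two sides exist, but their union is not closed. -/
def IsCritical (p q : Fin n) : Prop :=
  side S p q ∈ closedSets S.toFinset ∧ side S q p ∈ closedSets S.toFinset ∧
    side S p q ∪ side S q p ∉ closedSets S.toFinset

/-- `p` and `q` represent their class of critical pairs. -/
def IsSelected (p q : Fin n) : Prop :=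
  p < q ∧ IsCritical S p q ∧ lowest (side S p q \ side S q p) = {p} ∧
    lowest (side S q p \ side S p q) = {q}

open Classical in
/-- The representatives in `x \ a` of the classes of points that have the same join with `d`. -/
noncomputable def representatives (x a d : Finset (Fin n)) : Finset (Fin n) :=
  (x \ a).filter fun r => lowest (implClosure S (d ∪ {r}) \ d) = {r}

/-- The element of `U` that follows `q` cyclically. -/
def next (U : Finset (Fin n)) (q : Fin n) : Finset (Fin n) :=
  if (U.filter (q < ·)).Nonempty then lowest (U.filter (q < ·)) else lowest U

open Classical in
/-- The conclusion of the output implication with premise `{p, q}`. -/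
noncomputable def conclusion (p q : Fin n) : Finset (Fin n) :=
  let a := side S p q
  -- This is the intersection of the two sides, written with the set operations already implemented.
  let d := a \ (a \ side S q p)
  let x := implClosure S ({p} ∪ {q})
  if x ∈ closedSets S.toFinset then
    -- The least point of the line, paired with `q`, yields the cyclic successor of `q` among the
    -- other representatives; every other pair yields the least point.
    if lowest (x \ d) = {p} then next (representatives S x a d) q else lowest (x \ d)
  else ∅

/-- The output implications with a single element as premise. -/
def singleImplications : List (Implication (Fin n)) :=
  (List.finRange n).foldl (fun acc p => if (irredundant S (below S p)).Nonempty then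
    ({p}, irredundant S (below S p)) :: acc else acc) []

open Classical in
/-- The implications which the algorithm finds for a nonempty ground set. -/
noncomputable def optimalBase : List (Implication (Fin n)) :=
  (List.finRange n).foldl (fun acc p => (List.finRange n).foldl (fun acc q =>
    if IsSelected S p q then ({p} ∪ {q}, conclusion S p q) :: acc else acc) acc)
    (singleImplications S)

end Algorithm

/-! ### Least elements of sets of points. -/

section Lowest

variable {n : ℕ} {X : Finset (Fin n)}

theorem lowest_eq_find (X : Finset (Fin n)) :
    lowest X = ((List.finRange n).find? (· ∈ X)).toFinset := by
  have h₁ : ∀ (l : List (Fin n)) (Y : Finset (Fin n)), Y ≠ ∅ →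
      l.foldl (fun Y r => if Y = ∅ ∧ r ∈ X then {r} else Y) Y = Y := by
    intro l
    induction l with
    | nil => simp
    | cons r l ih => intro Y hY; simp [hY, ih]
  have h₂ : ∀ l : List (Fin n), l.foldl (fun Y r => if Y = ∅ ∧ r ∈ X then {r} else Y) ∅ =
      (l.find? (· ∈ X)).toFinset := by
    intro l
    induction l with
    | nil => simp
    | cons r l ih =>
      by_cases h : r ∈ X
      · simp [h, h₁]
      · simp [h, ih]
  exact h₂ _

theorem lowest_eq_singleton {p : Fin n} : lowest X = {p} ↔ p ∈ X ∧ ∀ q ∈ X, p ≤ q := by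
  rw [lowest_eq_find]
  have h : ∀ p, (List.finRange n).find? (· ∈ X) = some p → p ∈ X ∧ ∀ q ∈ X, p ≤ q := by
    intro p hp
    obtain ⟨hX, as, bs, e, h⟩ := List.find?_eq_some_iff_append.1 hp
    refine ⟨by simpa using hX, fun q hq => ?_⟩
    have hs := List.pairwise_lt_finRange n
    have hm : q ∈ List.finRange n := List.mem_finRange q
    rw [e] at hs hm
    rcases List.mem_append.1 hm with h' | h'
    · exact absurd hq (by simpa using h q h')
    · rcases List.mem_cons.1 h' with rfl | h'
      · exact le_rfl
      · exact (List.rel_of_pairwise_cons (List.pairwise_append.1 hs).2.1 h').le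
  constructor
  · intro hp
    apply h p
    rcases e : (List.finRange n).find? (· ∈ X) with _ | r <;> rw [e] at hp
    · simp at hp
    · simpa using hp
  · rintro ⟨hp, hp'⟩
    rcases e : (List.finRange n).find? (· ∈ X) with _ | r
    · simpa [hp] using List.find?_eq_none.1 e p (List.mem_finRange p)
    · obtain ⟨hr, hr'⟩ := h r e
      simp [le_antisymm (hr' p hp) (hp' r hr)]

theorem exists_lowest (hX : X.Nonempty) : ∃ p ∈ X, lowest X = {p} ∧ ∀ q ∈ X, p ≤ q := by
  obtain ⟨p, hp, h⟩ := X.exists_minimal hX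
  have h' : ∀ q ∈ X, p ≤ q := fun q hq => (le_total p q).elim (fun h => h) fun h' => h hq h'
  exact ⟨p, hp, lowest_eq_singleton.2 ⟨hp, h'⟩, h'⟩

end Lowest

/-! ### The algorithm takes polynomial time -/

/-- The ground set and the implications can be computed from `x`. -/
structure PolyContext {ι : Type*} (m : ι → ℕ) (x : ι → Data) (n : ι → ℕ)
    (S : ∀ i, List (Implication (Fin (n i)))) : Prop where
  nat : PolyTime m x fun i => .ofNat (n i)
  family : PolyTime m x fun i => Data.ofList ((S i).map encodeImplication)
  points : PolyTime m x fun i =>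
    Data.ofList ((List.finRange (n i)).map fun p => encodeSet ({p} : Finset (Fin (n i))))

namespace PolyContext

variable {ι κ : Type*} {m : ι → ℕ} {x : ι → Data} {n : ι → ℕ}
  {S : ∀ i, List (Implication (Fin (n i)))}

theorem lift {m' : κ → ℕ} {x' : κ → Data} {φ : κ → ι} (C : PolyContext m x n S)
    (L : ∀ y, PolyTime m x y → PolyTime m' x' fun j => y (φ j)) :
    PolyContext m' x' (fun j => n (φ j)) (fun j => S (φ j)) :=
  ⟨L _ C.nat, L _ C.family, L _ C.points⟩

theorem bdd (C : PolyContext m x n S) : PolyBdd m n := C.nat.bdd_of_nat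

variable {A B X Y D a d : ∀ i, Finset (Fin (n i))} {p q : ∀ i, Fin (n i)}

theorem empty (C : PolyContext m x n S) :
    PolyTime m x fun i => encodeSet (∅ : Finset (Fin (n i))) := by
  have := C.nat
  simp only [Data.ofNat_eq] at this
  convert this using 2 with i
  rw [encodeSet_eq]
  congr 2
  apply List.ext_getElem <;> simp

theorem saturate (C : PolyContext m x n S) (hX : PolyTime m x fun i => encodeSet (X i)) :
    PolyTime m x fun i => encodeSet (saturate (S i) (X i)) :=
  .fold_set (fun _ => encodeImplication) _ C.bdd C.family hX fun _ _ _ ha hb =>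
    .ite_enc (fun _ => encodeSet) (ha.hd.dec_subset hb) (hb.union ha.tl) hb

theorem implClosure (C : PolyContext m x n S) (hX : PolyTime m x fun i => encodeSet (X i)) :
    PolyTime m x fun i => encodeSet (implClosure (S i) (X i)) :=
  .fold_set (fun _ p => encodeSet {p}) _ C.bdd C.points hX fun _ _ L _ hb =>
    (C.lift L).saturate hb

theorem dec_closed (C : PolyContext m x n S) (hX : PolyTime m x fun i => encodeSet (X i)) :
    PolyDec m x fun i => X i ∈ closedSets (S i).toFinset := by
  refine (PolyDec.forall_mem (fun _ => encodeImplication) C.family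
    (R := fun i I => (I.2.Nonempty → I.1 ⊆ X i → I.2 ⊆ X i) ∧ (I.2 = ∅ → ¬ I.1 ⊆ X i))
    fun m' x' hm L ha => ?_).congr fun i => by simp [closedSets]
  have hX' := L _ hX
  exact (ha.tl.dec_nonempty.imp ((ha.hd.dec_subset hX').imp (ha.tl.dec_subset hX'))).and
    (ha.tl.dec_eq_empty.imp (ha.hd.dec_subset hX').not)

theorem lowest (C : PolyContext m x n S) (hX : PolyTime m x fun i => encodeSet (X i)) :
    PolyTime m x fun i => encodeSet (lowest (X i)) :=
  .fold_set (fun _ p => encodeSet {p}) _ C.bdd C.points C.empty fun _ _ L ha hb =>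
    .ite_enc (fun _ => encodeSet) (hb.dec_eq_empty.and (ha.dec_mem (L _ hX))) ha hb

theorem below (C : PolyContext m x n S) (hp : PolyTime m x fun i => encodeSet {p i}) :
    PolyTime m x fun i => encodeSet (below (S i) (p i)) :=
  (C.implClosure hp).sdiff hp

theorem irredundant (C : PolyContext m x n S) (hD : PolyTime m x fun i => encodeSet (D i)) :
    PolyTime m x fun i => encodeSet (irredundant (S i) (D i)) :=
  .fold_set (fun _ p => encodeSet {p}) _ C.bdd C.points hD fun _ _ L ha hb =>
    .ite_enc (fun _ => encodeSet)
      ((L _ hD).dec_subset ((C.lift L).implClosure (hb.sdiff ha))) (hb.sdiff ha) hb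

theorem side (C : PolyContext m x n S) (hp : PolyTime m x fun i => encodeSet {p i})
    (hq : PolyTime m x fun i => encodeSet {q i}) :
    PolyTime m x fun i => encodeSet (side (S i) (p i) (q i)) :=
  C.implClosure (hp.union (C.below hq))

theorem dec_critical (C : PolyContext m x n S) (hp : PolyTime m x fun i => encodeSet {p i})
    (hq : PolyTime m x fun i => encodeSet {q i}) :
    PolyDec m x fun i => IsCritical (S i) (p i) (q i) :=
  (C.dec_closed (C.side hp hq)).and ((C.dec_closed (C.side hq hp)).and
    (C.dec_closed ((C.side hp hq).union (C.side hq hp))).not)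

theorem filter (C : PolyContext m x n S) (hX : PolyTime m x fun i => encodeSet (X i))
    (P : ∀ i, Fin (n i) → Prop) [∀ i, DecidablePred (P i)]
    (hP : ∀ (m' : (Σ i, Finset (Fin (n i)) × Fin (n i)) → ℕ)
      (x' : (Σ i, Finset (Fin (n i)) × Fin (n i)) → Data),
      (∀ y, PolyTime m x y → PolyTime m' x' fun j => y j.1) →
      (PolyTime m' x' fun j => encodeSet {j.2.2}) → PolyDec m' x' fun j => P j.1 j.2.2) :
    PolyTime m x fun i => encodeSet ((X i).filter (P i)) := by
  have h := PolyTime.fold_set (m := m) (x := x) (fun _ p => encodeSet {p})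
    (fun i (Y : Finset (Fin (n i))) r => if r ∈ X i ∧ P i r then Y ∪ {r} else Y)
    C.bdd C.points C.empty fun m' x' L ha hb =>
      .ite_enc (fun _ => encodeSet) ((ha.dec_mem (L _ hX)).and (hP m' x' L ha)) (hb.union ha) hb
  convert h using 2 with i
  have e : ∀ (l : List (Fin (n i))) (Y : Finset (Fin (n i))),
      l.foldl (fun Y r => if r ∈ X i ∧ P i r then Y ∪ {r} else Y) Y =
        Y ∪ (X i).filter fun r => P i r ∧ r ∈ l := by
    intro l
    induction l with
    | nil => simp
    | cons r l ih =>
      intro Y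
      rw [List.foldl_cons, ih]
      ext s
      split_ifs with h <;> simp only [Finset.mem_union, Finset.mem_filter, List.mem_cons,
        Finset.mem_singleton] <;> grind
  congr 1
  rw [e]
  ext s
  simp

/-- For distinct points, the order is read off from the least element of their pair. -/
theorem dec_lt (C : PolyContext m x n S) (hp : PolyTime m x fun i => encodeSet {p i})
    (hq : PolyTime m x fun i => encodeSet {q i}) : PolyDec m x fun i => p i < q i :=
  (((C.lowest (hp.union hq)).dec_eq hp).and (hp.dec_eq_point hq).not).congr fun i => by
    simp [lowest_eq_singleton, lt_iff_le_and_ne]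

theorem representatives (C : PolyContext m x n S) (hX : PolyTime m x fun i => encodeSet (X i))
    (ha : PolyTime m x fun i => encodeSet (a i)) (hd : PolyTime m x fun i => encodeSet (d i)) :
    PolyTime m x fun i => encodeSet (representatives (S i) (X i) (a i) (d i)) :=
  C.filter (hX.sdiff ha) _ fun _ _ L hr =>
    ((C.lift L).lowest (((C.lift L).implClosure ((L _ hd).union hr)).sdiff (L _ hd))).dec_eq hr

theorem next (C : PolyContext m x n S) (hX : PolyTime m x fun i => encodeSet (X i))
    (hq : PolyTime m x fun i => encodeSet {q i}) :
    PolyTime m x fun i => encodeSet (next (X i) (q i)) := by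
  have h := C.filter hX (fun i r => q i < r) fun _ _ L hr => (C.lift L).dec_lt (L _ hq) hr
  exact .ite_enc (fun _ => encodeSet) h.dec_nonempty (C.lowest h) (C.lowest hX)

open Classical in
theorem conclusion (C : PolyContext m x n S) (hp : PolyTime m x fun i => encodeSet {p i})
    (hq : PolyTime m x fun i => encodeSet {q i}) :
    PolyTime m x fun i => encodeSet (conclusion (S i) (p i) (q i)) := by
  have ha := C.side hp hq
  have hd := ha.sdiff (ha.sdiff (C.side hq hp))
  have hx := C.implClosure (hp.union hq)
  have hm := C.lowest (hx.sdiff hd)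
  exact .ite_enc (fun _ => encodeSet) (C.dec_closed hx)
    (.ite_enc (fun _ => encodeSet) (hm.dec_eq hp) (C.next (C.representatives hx ha hd) hq) hm)
    C.empty

theorem dec_selected (C : PolyContext m x n S) (hp : PolyTime m x fun i => encodeSet {p i})
    (hq : PolyTime m x fun i => encodeSet {q i}) :
    PolyDec m x fun i => IsSelected (S i) (p i) (q i) := by
  have ha := C.side hp hq
  have hb := C.side hq hp
  exact (C.dec_lt hp hq).and ((C.dec_critical hp hq).and
    (((C.lowest (ha.sdiff hb)).dec_eq hp).and ((C.lowest (hb.sdiff ha)).dec_eq hq)))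

theorem _root_.ImplBase.size_encodeImplication_le {n : ℕ} (I : Implication (Fin n)) :
    (encodeImplication I).size ≤ 8 * n + 3 := by
  have h₁ := size_encodeSet_le I.1
  have h₂ := size_encodeSet_le I.2
  simp only [encodeImplication, Data.size]
  omega

/-- Prepending an implication to a list if a condition holds. -/
theorem push {P : ι → Prop} [∀ i, Decidable (P i)] {l : ∀ i, List (Implication (Fin (n i)))}
    (hP : PolyDec m x P) (hA : PolyTime m x fun i => encodeSet (A i))
    (hB : PolyTime m x fun i => encodeSet (B i))
    (hl : PolyTime m x fun i => encodeFamily (l i)) :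
    PolyTime m x fun i => encodeFamily (if P i then (A i, B i) :: l i else l i) :=
  .ite_enc (fun _ => encodeFamily) hP ((hA.cons hB).cons hl) hl

theorem _root_.ImplBase.size_encodeFamily_push_le {n : ℕ} (P : Prop) [Decidable P]
    (I : Implication (Fin n)) (l : List (Implication (Fin n))) :
    (encodeFamily (if P then I :: l else l)).size ≤ (encodeFamily l).size + (8 * n + 4) := by
  have := size_encodeImplication_le I
  split
  · simp only [encodeFamily, List.map_cons, Data.ofList, Data.size]; omega
  · omega

theorem singleImplications (C : PolyContext m x n S) :
    PolyTime m x fun i => encodeFamily (singleImplications (S i)) :=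
  .fold (fun _ p => encodeSet {p}) (fun _ => encodeFamily) _ C.points (.nil C.nat.in_bdd)
    (((PolyBdd.const 8).mul C.bdd).add (.const 4))
    (fun _ _ _ _ => size_encodeFamily_push_le _ _ _) fun _ _ _ L ha hb =>
      have h := (C.lift L).irredundant ((C.lift L).below ha)
      push h.dec_nonempty ha h hb

open Classical in
theorem optimalBase (C : PolyContext m x n S) :
    PolyTime m x fun i => encodeFamily (optimalBase (S i)) := by
  have hQ : PolyBdd m fun i => 8 * n i + 4 := ((PolyBdd.const 8).mul C.bdd).add (.const 4)
  refine .fold (fun _ p => encodeSet {p}) (fun _ => encodeFamily) _ C.points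
    C.singleImplications (C.bdd.mul hQ) (fun i b p _ => ?_) fun _ _ hm L hp hb => ?_
  · have : ∀ (l : List (Fin (n i))) (b : List (Implication (Fin (n i)))),
        (encodeFamily (l.foldl (fun acc q => if IsSelected (S i) p q then
          ({p} ∪ {q}, ImplBase.conclusion (S i) p q) :: acc else acc) b)).size ≤
        (encodeFamily b).size + l.length * (8 * n i + 4) := by
      intro l
      induction l with
      | nil => simp
      | cons q l ih =>
        intro b
        rw [List.foldl_cons, List.length_cons, add_mul, one_mul]
        refine (ih _).trans ?_
        have := size_encodeFamily_push_le (IsSelected (S i) p q)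
          ({p} ∪ {q}, ImplBase.conclusion (S i) p q) b
        omega
    simpa using this (List.finRange (n i)) b
  · have C' := C.lift L
    exact .fold (fun _ p => encodeSet {p}) (fun _ => encodeFamily) _ C'.points hb
      (hQ.reindex Sigma.fst (PolyBdd.self.mono hm))
      (fun _ _ _ _ => size_encodeFamily_push_le _ _ _) fun _ _ _ L' hq hb' =>
        push ((C'.lift L').dec_selected (L' _ hp) hq) ((L' _ hp).union hq)
          ((C'.lift L').conclusion (L' _ hp) hq) hb'

end PolyContext

open Classical in
/-- The output of the algorithm. -/
noncomputable def algorithmOutput {n : ℕ} (S : List (Implication (Fin n))) :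
    List (Implication (Fin n)) :=
  -- Over the empty ground set `optimalBase S` is empty, which is wrong if `S` contains `∅ → ∅`.
  -- Every family then has size 0, so the input itself is optimal.
  if n = 0 then S else optimalBase S

theorem exists_program : ∃ (c : Program) (p : Polynomial ℕ),
    ∀ (n : ℕ) (S : List (Implication (Fin n))),
      Computes c (encodeInput n S) (encodeFamily (algorithmOutput S)) (p.eval (n + S.length)) := by
  set m : (Σ n, List (Implication (Fin n))) → ℕ := fun i => i.1 + i.2.length with hm
  have hsize : PolyBdd m fun i => (encodeInput i.1 i.2).size := by
    refine ((((PolyBdd.const 2).mul PolyBdd.self).add (PolyBdd.self.mul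
      (((PolyBdd.const 8).mul PolyBdd.self).add (.const 4)))).add (.const 3)).mono fun i => ?_
    have h : (encodeFamily i.2).size ≤ i.2.length * (8 * i.1 + 4) + 1 := by
      obtain ⟨n, l⟩ := i
      simp only
      induction l with
      | nil => simp [encodeFamily, Data.ofList, Data.size]
      | cons I l ih =>
        have := size_encodeImplication_le I
        simp only [encodeFamily] at ih
        simp only [encodeFamily, List.map_cons, Data.ofList, Data.size, List.length_cons, add_mul]
        omega
    have h' : i.2.length * (8 * i.1 + 4) ≤ m i * (8 * m i + 4) :=
      Nat.mul_le_mul (by simp [hm]) (by simp only [hm]; omega)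
    have h'' : i.1 ≤ m i := by simp [hm]
    simp only [encodeInput, Data.size, Data.size_ofNat]
    omega
  have hid := PolyTime.id hsize
  have C : PolyContext m (fun i => encodeInput i.1 i.2) (fun i => i.1) (fun i => i.2) :=
    ⟨hid.hd, hid.tl, .points hid.hd⟩
  have h := PolyTime.ite_nil hid.hd C.optimalBase hid.tl
    (w := fun i => encodeFamily (algorithmOutput i.2))
    (fun i hi => by
      rw [algorithmOutput, if_neg]
      rintro h
      exact hi (by simp [encodeInput, Data.hd, h, Data.ofNat]))
    (fun i hi => by
      rw [algorithmOutput, if_pos]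
      · rfl
      · rcases i with ⟨_ | n, S⟩
        · rfl
        · simp [encodeInput, Data.hd, Data.ofNat] at hi)
  obtain ⟨c, T, ⟨p, hp⟩, hc⟩ := h.prog 0
  refine ⟨c, p, fun n S => ?_⟩
  obtain ⟨τ, t, r, hτ, -, ht⟩ := hc ⟨n, S⟩ (initStore (encodeInput n S)) (by simp [initStore])
  exact ⟨τ, t, r, hτ, ht.trans (hp ⟨n, S⟩)⟩

/-! ### Closure in simple modular families of sets -/

section Geometry

variable {E : Type*} [DecidableEq E]

/-- A family `F` of sets, with a closure operator `cl`, which is a modular semilattice in which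
the join-irreducible members are the closures of the elements. -/
structure IsModularFamily (F : Set (Finset E)) (cl : Finset E → Finset E) : Prop where
  le_cl : ∀ A, A ⊆ cl A
  mono : ∀ A B, A ⊆ B → cl A ⊆ cl B
  idem : ∀ A, cl (cl A) = cl A
  closed : ∀ X ∈ F, cl X = X
  mem_of_subset : ∀ A, ∀ X ∈ F, A ⊆ X → cl A ∈ F
  inter_mem : ∀ X ∈ F, ∀ Y ∈ F, X ∩ Y ∈ F
  modular : ∀ X ∈ F, ∀ Y ∈ F, ∀ Z ∈ F, X ⊆ Z → cl (Y ∪ Z) ∈ F →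
    cl (X ∪ Y) ∩ Z ⊆ cl (X ∪ (Y ∩ Z))
  join_mem : ∀ X ∈ F, ∀ Y ∈ F, ∀ Z ∈ F, cl (X ∪ Y) ∈ F → cl (Y ∪ Z) ∈ F → cl (Z ∪ X) ∈ F →
    cl (X ∪ Y ∪ Z) ∈ F
  point_mem : ∀ p, cl {p} ∈ F
  below_mem : ∀ p, cl {p} \ {p} ∈ F

/-- The elements below `p`. -/
def lower (cl : Finset E → Finset E) (p : E) : Finset E := cl {p} \ {p}

/-- The join of `p` and the elements below `q`. -/
def flank (cl : Finset E → Finset E) (p q : E) : Finset E := cl ({p} ∪ lower cl q)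

/-- The two flanks of `p` and `q` exist, but their union is not a member. -/
def CriticalPair (F : Set (Finset E)) (cl : Finset E → Finset E) (p q : E) : Prop :=
  flank cl p q ∈ F ∧ flank cl q p ∈ F ∧ flank cl p q ∪ flank cl q p ∉ F

/-- `p` and `q` are a critical pair with join `x` whose flanks meet in `d`. -/
def OnLine (F : Set (Finset E)) (cl : Finset E → Finset E) (d x : Finset E) (p q : E) : Prop :=
  CriticalPair F cl p q ∧ cl ({p} ∪ {q}) = x ∧ flank cl p q ∩ flank cl q p = d

namespace IsModularFamily

variable {F : Set (Finset E)} {cl : Finset E → Finset E} (h : IsModularFamily F cl)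

include h

theorem cl_subset {A X : Finset E} (hX : X ∈ F) (hA : A ⊆ X) : cl A ⊆ X :=
  h.closed X hX ▸ h.mono A X hA

theorem cl_subset_cl {A B : Finset E} (hA : A ⊆ cl B) : cl A ⊆ cl B :=
  h.idem B ▸ h.mono A (cl B) hA

theorem cl_mem {A B : Finset E} (hB : cl B ∈ F) (hA : A ⊆ cl B) : cl A ∈ F :=
  h.mem_of_subset A _ hB hA

theorem cl_cl_union (A B : Finset E) : cl (cl A ∪ B) = cl (A ∪ B) := by
  apply Finset.Subset.antisymm
  · exact h.cl_subset_cl (Finset.union_subset (h.mono _ _ Finset.subset_union_left)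
      (Finset.subset_union_right.trans (h.le_cl _)))
  · exact h.mono _ _ (Finset.union_subset_union_left (h.le_cl A))

theorem cl_union_cl (A B : Finset E) : cl (A ∪ cl B) = cl (A ∪ B) := by
  rw [Finset.union_comm, h.cl_cl_union, Finset.union_comm]

theorem mem_cl_self (p : E) : p ∈ cl {p} := h.le_cl _ (by simp)

omit h in
theorem lower_subset (p : E) : lower cl p ⊆ cl {p} := Finset.sdiff_subset

omit h in
theorem not_mem_lower (p : E) : p ∉ lower cl p := by simp [lower]

theorem cl_point_subset {p : E} {X : Finset E} (hX : X ∈ F) (hp : p ∈ X) : cl {p} ⊆ X :=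
  h.cl_subset hX (by simpa using hp)

theorem lower_subset_of_mem {p : E} {X : Finset E} (hX : X ∈ F) (hp : p ∈ X) : lower cl p ⊆ X :=
  (lower_subset p).trans (h.cl_point_subset hX hp)

omit h in
theorem inter_lower {p : E} {X : Finset E} (hp : p ∉ X) : cl {p} ∩ X ⊆ lower cl p := by
  intro t ht
  simp only [Finset.mem_inter] at ht
  simp only [lower, Finset.mem_sdiff, Finset.mem_singleton]
  exact ⟨ht.1, fun e => hp (e ▸ ht.2)⟩

theorem cl_lower (p : E) : cl (lower cl p) = lower cl p := h.closed _ (h.below_mem p)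

/-- The modular law for joins with a point. -/
theorem modular_point {A Z : Finset E} {p : E} (hZ : Z ∈ F) (hA : A ⊆ Z) (hp : p ∉ Z)
    (hc : cl (Z ∪ {p}) ∈ F) : cl (A ∪ {p}) ∩ Z ⊆ cl (A ∪ lower cl p) := by
  have h1 := h.modular (cl A) (h.mem_of_subset A Z hZ hA) (cl {p}) (h.point_mem p) Z hZ
    (h.cl_subset hZ hA) (by rwa [h.cl_cl_union, Finset.union_comm])
  rw [h.cl_cl_union, h.cl_union_cl, h.cl_cl_union] at h1
  exact h1.trans (h.mono _ _ (Finset.union_subset_union_right (inter_lower hp)))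

/-- Adding a point all of whose lower elements are present gives a cover. -/
theorem subset_of_cover {c d : Finset E} {p : E} (hd : d ∈ F) (hp : lower cl p ⊆ d)
    (hj : cl (d ∪ {p}) ∈ F) (hc : c ∈ F) (hdc : d ⊆ c) (hca : c ⊆ cl (d ∪ {p})) (hpc : p ∉ c) :
    c ⊆ d := by
  have h1 := h.modular_point hc hdc hpc (h.cl_mem hj (Finset.union_subset hca
    (Finset.subset_union_right.trans (h.le_cl _))))
  rw [Finset.inter_eq_right.2 hca, Finset.union_eq_left.2 hp, h.closed d hd] at h1
  exact h1

/-- Otherwise `d ∨ u` would omit `p` and hence lie in `d`, although it contains `u`. -/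
theorem cl_union_eq_of_cover {d : Finset E} {p u : E} (hd : d ∈ F) (hp : lower cl p ⊆ d)
    (hj : cl (d ∪ {p}) ∈ F) (hu : u ∈ cl (d ∪ {p})) (hud : u ∉ d) :
    cl (d ∪ {u}) = cl (d ∪ {p}) := by
  have hsub : cl (d ∪ {u}) ⊆ cl (d ∪ {p}) := h.cl_subset_cl
    (Finset.union_subset (Finset.subset_union_left.trans (h.le_cl _)) (by simpa using hu))
  have hF := h.cl_mem hj ((h.le_cl _).trans hsub)
  refine hsub.antisymm (h.cl_subset_cl
    (Finset.union_subset (Finset.subset_union_left.trans (h.le_cl _)) ?_))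
  by_contra hpc
  rw [Finset.singleton_subset_iff] at hpc
  exact hud (h.subset_of_cover hd hp hj hF (Finset.subset_union_left.trans (h.le_cl _)) hsub hpc
    (h.le_cl _ (by simp)))

/-- If some `t` below `u` were outside `d`, then `d ∨ t = d ∨ p` would contain `u`, so `u` would lie
in the join of `lower cl u` and `d`. The modular law in the closure of `u` then puts `u` into `lower
cl u`. -/
theorem lower_subset_of_cover {d : Finset E} {p u : E} (hd : d ∈ F) (hp : lower cl p ⊆ d)
    (hj : cl (d ∪ {p}) ∈ F) (hu : u ∈ cl (d ∪ {p})) (hud : u ∉ d) : lower cl u ⊆ d := by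
  intro t ht
  by_contra htd
  have hta : t ∈ cl (d ∪ {p}) := h.lower_subset_of_mem hj hu ht
  have h1 := h.cl_union_eq_of_cover hd hp hj hta htd
  have h2 := h.modular _ (h.below_mem u) d hd (cl {u}) (h.point_mem u) (lower_subset u) (by
    rw [h.cl_union_cl]
    exact h.cl_mem hj (Finset.union_subset (Finset.subset_union_left.trans (h.le_cl _))
      (by simpa using hu)))
  have h3 : u ∈ cl (lower cl u ∪ d) := by
    rw [← h1] at hu
    exact h.mono _ _ (Finset.union_subset Finset.subset_union_right
      (Finset.subset_union_left.trans' (by simpa using ht))) hu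
  have h4 := h2 (Finset.mem_inter.2 ⟨h3, h.mem_cl_self u⟩)
  rw [Finset.inter_comm] at h4
  rw [show cl {u} \ {u} = lower cl u from rfl,
    Finset.union_eq_left.2 (inter_lower hud), h.cl_lower] at h4
  exact not_mem_lower u h4

/-! ### Exchange properties of critical pairs and of lines. -/

section Critical

variable {p q u v r : E} {d x : Finset E}

omit h in
theorem _root_.ImplBase.CriticalPair.symm (hc : CriticalPair F cl p q) : CriticalPair F cl q p :=
  ⟨hc.2.1, hc.1, by rw [Finset.union_comm]; exact hc.2.2⟩

omit h in
theorem _root_.ImplBase.OnLine.symm (hl : OnLine F cl d x p q) : OnLine F cl d x q p :=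
  ⟨hl.1.symm, by rw [Finset.union_comm]; exact hl.2.1, by rw [Finset.inter_comm]; exact hl.2.2⟩

theorem mem_flank (p q : E) : p ∈ flank cl p q := h.le_cl _ (by simp)

theorem lower_subset_flank (p q : E) : lower cl q ⊆ flank cl p q :=
  Finset.subset_union_right.trans (h.le_cl _)

theorem flank_subset {X : Finset E} (hX : X ∈ F) (hp : p ∈ X) (hq : lower cl q ⊆ X) :
    flank cl p q ⊆ X :=
  h.cl_subset hX (Finset.union_subset (by simpa using hp) hq)

/-- If `p` were in the flank of `q`, that flank would contain the other one and the union would be a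
member. -/
theorem not_mem_flank (hc : CriticalPair F cl p q) : p ∉ flank cl q p := by
  intro hp
  refine hc.2.2 ?_
  rw [Finset.union_eq_right.2 (h.flank_subset hc.2.1 hp
    (h.lower_subset_of_mem hc.2.1 (h.mem_flank q p)))]
  exact hc.2.1

theorem flank_inter_mem (hc : CriticalPair F cl p q) : flank cl p q ∩ flank cl q p ∈ F :=
  h.inter_mem _ hc.1 _ hc.2.1

theorem lower_subset_inter (hc : CriticalPair F cl p q) :
    lower cl p ⊆ flank cl p q ∩ flank cl q p :=
  Finset.subset_inter (h.lower_subset_of_mem hc.1 (h.mem_flank p q)) (h.lower_subset_flank q p)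

theorem flank_eq (hc : CriticalPair F cl p q) :
    cl (flank cl p q ∩ flank cl q p ∪ {p}) = flank cl p q := by
  apply Finset.Subset.antisymm
  · exact h.cl_subset hc.1 (Finset.union_subset Finset.inter_subset_left
      (by simpa using h.mem_flank p q))
  · have h1 := h.lower_subset_inter hc.symm
    rw [Finset.inter_comm] at h1
    exact (congrArg cl (Finset.union_comm _ _)).subset.trans
      (h.mono _ _ (Finset.union_subset_union_left h1))

/-- Let `d'` be the join on the right. Adding `p` to `d'` gives a cover of `d'`, namely a flank, and
the intersection of the flanks lies between the two without containing `p`. -/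
theorem flank_inter_eq (hc : CriticalPair F cl p q) :
    flank cl p q ∩ flank cl q p = cl (lower cl p ∪ lower cl q) := by
  have h1 := h.lower_subset_inter hc
  have h2 := h.lower_subset_inter hc.symm
  rw [Finset.inter_comm] at h2
  have h3 : cl (lower cl p ∪ lower cl q) ⊆ flank cl p q ∩ flank cl q p :=
    h.cl_subset (h.flank_inter_mem hc) (Finset.union_subset h1 h2)
  refine Finset.Subset.antisymm ?_ h3
  have hle := h.le_cl (lower cl p ∪ lower cl q)
  have h4 : flank cl p q ⊆ cl (cl (lower cl p ∪ lower cl q) ∪ {p}) := by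
    refine h.cl_subset_cl (Finset.union_subset ?_ ?_)
    · exact Finset.subset_union_right.trans (h.le_cl _)
    · exact (Finset.subset_union_right.trans hle).trans
        (Finset.subset_union_left.trans (h.le_cl _))
  have h5 : cl (cl (lower cl p ∪ lower cl q) ∪ {p}) ⊆ flank cl p q :=
    h.cl_subset hc.1 (Finset.union_subset (h3.trans Finset.inter_subset_left)
      (by simpa using h.mem_flank p q))
  exact h.subset_of_cover (p := p) (h.mem_of_subset _ _ (h.flank_inter_mem hc)
    (Finset.union_subset h1 h2)) (Finset.subset_union_left.trans hle)
    (h.mem_of_subset _ _ hc.1 ((h.le_cl _).trans h5)) (h.flank_inter_mem hc) h3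
    (Finset.inter_subset_left.trans h4)
    (fun hp => h.not_mem_flank hc (Finset.mem_inter.1 hp).2)

theorem lower_subset_inter_of_mem (hc : CriticalPair F cl p q) (hu : u ∈ flank cl p q)
    (hu' : u ∉ flank cl q p) : lower cl u ⊆ flank cl p q ∩ flank cl q p :=
  h.lower_subset_of_cover (h.flank_inter_mem hc) (h.lower_subset_inter hc)
    (by rw [h.flank_eq hc]; exact hc.1) (by rwa [h.flank_eq hc])
    fun hu'' => hu' (Finset.mem_inter.1 hu'').2

/-- The first flank covers the intersection of the flanks, so all points below `u` lie in that
intersection. This gives one inclusion for each flank; modularity gives the other ones. -/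
theorem exchange_left (hc : CriticalPair F cl p q) (hu : u ∈ flank cl p q)
    (hu' : u ∉ flank cl q p) : flank cl u q = flank cl p q ∧ flank cl q u = flank cl q p := by
  have hlu := h.lower_subset_inter_of_mem hc hu hu'
  have hlq := h.lower_subset_inter hc.symm
  rw [Finset.inter_comm] at hlq
  have hud : u ∉ flank cl p q ∩ flank cl q p := fun hu'' => hu' (Finset.mem_inter.1 hu'').2
  have hsub : flank cl u q ⊆ flank cl p q :=
    h.flank_subset hc.1 hu (hlq.trans Finset.inter_subset_left)
  have hF : flank cl u q ∈ F := h.mem_of_subset _ _ hc.1 ((h.le_cl _).trans hsub)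
  have hp : p ∈ flank cl u q := by
    -- Without `p`, the modular law places `u` in the join of `lower cl q` and `lower cl p`, which
    -- is the intersection of the flanks.
    by_contra hp
    have h1 := h.modular_point hF (h.lower_subset_flank u q) hp
      (h.mem_of_subset _ _ hc.1 (Finset.union_subset hsub (by simpa using h.mem_flank p q)))
    rw [Finset.union_comm _ {p}, Finset.union_comm _ (lower cl p), ← h.flank_inter_eq hc] at h1
    exact hud (h1 (Finset.mem_inter.2 ⟨hu, h.mem_flank u q⟩))
  have heq : flank cl u q = flank cl p q :=
    hsub.antisymm (h.flank_subset hF hp (h.lower_subset_flank u q))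
  refine ⟨heq, Finset.Subset.antisymm ?_ ?_⟩
  · exact h.flank_subset hc.2.1 (h.mem_flank q p) (hlu.trans Finset.inter_subset_right)
  · have hd' : cl (lower cl u ∪ lower cl q) ⊆ flank cl p q ∩ flank cl q p :=
      h.cl_subset (h.flank_inter_mem hc) (Finset.union_subset hlu hlq)
    have hle := h.le_cl (lower cl u ∪ lower cl q)
    have h1 : flank cl p q ∩ flank cl q p ⊆ cl (lower cl u ∪ lower cl q) := by
      have h2 : cl (cl (lower cl u ∪ lower cl q) ∪ {u}) ⊆ flank cl p q :=
        h.cl_subset hc.1 (Finset.union_subset (hd'.trans Finset.inter_subset_left)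
          (by simpa using hu))
      refine h.subset_of_cover (p := u) (h.mem_of_subset _ _ (h.flank_inter_mem hc)
        (Finset.union_subset hlu hlq)) (Finset.subset_union_left.trans hle)
        (h.mem_of_subset _ _ hc.1 ((h.le_cl _).trans h2)) (h.flank_inter_mem hc) hd' ?_ hud
      refine Finset.inter_subset_left.trans (heq ▸ h.cl_subset_cl (Finset.union_subset ?_ ?_))
      · exact Finset.subset_union_right.trans (h.le_cl _)
      · exact (Finset.subset_union_right.trans hle).trans
          (Finset.subset_union_left.trans (h.le_cl _))
    have hFq : flank cl q u ∈ F := h.mem_of_subset _ _ hc.2.1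
      (Finset.union_subset (by simpa using h.mem_flank q p) (hlu.trans Finset.inter_subset_right))
    refine h.flank_subset hFq (h.mem_flank q u) ((h.lower_subset_inter hc).trans (h1.trans
      (h.cl_subset hFq (Finset.union_subset (h.lower_subset_flank q u) ?_))))
    exact h.lower_subset_of_mem hFq (h.mem_flank q u)

/-- Any two points of the flanks, one of each and outside the other, have the same flanks. -/
theorem exchange (hc : CriticalPair F cl p q) (hu : u ∈ flank cl p q) (hu' : u ∉ flank cl q p)
    (hv : v ∈ flank cl q p) (hv' : v ∉ flank cl p q) :
    flank cl u v = flank cl p q ∧ flank cl v u = flank cl q p ∧ CriticalPair F cl u v := by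
  obtain ⟨e₁, e₂⟩ := h.exchange_left hc hu hu'
  have hc' : CriticalPair F cl u q := by
    simp only [CriticalPair, e₁, e₂]
    exact hc
  obtain ⟨e₃, e₄⟩ := h.exchange_left hc'.symm (e₂ ▸ hv) (e₁ ▸ hv')
  refine ⟨e₄.trans e₁, e₃.trans e₂, ?_⟩
  simp only [CriticalPair, e₁, e₂, e₃, e₄]
  exact hc

theorem flank_subset_of_join {W : Finset E} (hW : W ∈ F) (hp : p ∈ W) (hq : q ∈ W) :
    flank cl p q ⊆ W :=
  h.flank_subset hW hp (h.lower_subset_of_mem hW hq)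

/-- A member containing `u` and `v` contains their flanks, which are those of `p` and `q`.
Inconsistency is thus a property of the class. -/
theorem exchange_not_mem (hc : CriticalPair F cl p q) (hpq : cl ({p} ∪ {q}) ∉ F)
    (hu : u ∈ flank cl p q) (hu' : u ∉ flank cl q p) (hv : v ∈ flank cl q p)
    (hv' : v ∉ flank cl p q) : cl ({u} ∪ {v}) ∉ F := by
  intro hF
  obtain ⟨e₁, e₂, -⟩ := h.exchange hc hu hu' hv hv'
  have h1 := h.flank_subset_of_join hF (p := u) (q := v) (h.le_cl _ (by simp))
    (h.le_cl _ (by simp))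
  have h2 := h.flank_subset_of_join hF (p := v) (q := u) (h.le_cl _ (by simp))
    (h.le_cl _ (by simp))
  rw [e₁] at h1
  rw [e₂] at h2
  exact hpq (h.mem_of_subset _ _ hF (Finset.union_subset (by simpa using h1 (h.mem_flank p q))
    (by simpa using h2 (h.mem_flank q p))))

theorem OnLine.flank_subset (hl : OnLine F cl d x p q) (hx : x ∈ F) : flank cl p q ⊆ x :=
  h.flank_subset_of_join hx (hl.2.1 ▸ h.le_cl _ (by simp)) (hl.2.1 ▸ h.le_cl _ (by simp))

theorem OnLine.mem (hl : OnLine F cl d x p q) : d ∈ F := hl.2.2 ▸ h.flank_inter_mem hl.1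

theorem OnLine.cl_union (hl : OnLine F cl d x p q) : cl (d ∪ {p}) = flank cl p q :=
  hl.2.2 ▸ h.flank_eq hl.1

theorem OnLine.eq_of_mem (hl : OnLine F cl d x p q) (hu : u ∈ flank cl p q) (hud : u ∉ d) :
    cl (d ∪ {u}) = flank cl p q := by
  have e := OnLine.cl_union h hl
  rw [← e] at hu ⊢
  exact h.cl_union_eq_of_cover (OnLine.mem h hl) (hl.2.2 ▸ h.lower_subset_inter hl.1)
    (e ▸ hl.1.1) hu hud

theorem OnLine.exchange (hl : OnLine F cl d x p q) (hx : x ∈ F) (hu : u ∈ flank cl p q)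
    (hv : v ∈ flank cl q p) (hu' : u ∉ d) (hv' : v ∉ d) : OnLine F cl d x u v := by
  have hl2 := hl.2.2
  obtain ⟨e₁, e₂, hc⟩ := h.exchange hl.1 hu (fun h' => hu' (hl2 ▸ Finset.mem_inter.2 ⟨hu, h'⟩))
    hv (fun h' => hv' (hl2 ▸ Finset.mem_inter.2 ⟨h', hv⟩))
  refine ⟨hc, Finset.Subset.antisymm (h.cl_subset hx (Finset.union_subset ?_ ?_)) ?_,
    by rw [e₁, e₂, hl2]⟩
  · simpa using OnLine.flank_subset h hl hx hu
  · simpa using OnLine.flank_subset h hl.symm hx hv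
  · have hF : cl ({u} ∪ {v}) ∈ F := h.mem_of_subset _ x hx (Finset.union_subset
      (by simpa using OnLine.flank_subset h hl hx hu)
      (by simpa using OnLine.flank_subset h hl.symm hx hv))
    have h1 := h.flank_subset_of_join hF (p := u) (q := v) (h.le_cl _ (by simp))
      (h.le_cl _ (by simp))
    have h2 := h.flank_subset_of_join hF (p := v) (q := u) (h.le_cl _ (by simp))
      (h.le_cl _ (by simp))
    rw [e₁] at h1
    rw [e₂] at h2
    rw [← hl.2.1]
    exact h.cl_subset hF (Finset.union_subset (by simpa using h1 (h.mem_flank p q))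
      (by simpa using h2 (h.mem_flank q p)))

/-- A point of `x` off both flanks gives a third atom `d ∨ r` of the interval from `d` to `x`, and
this atom forms a critical pair with that of `p`. -/
theorem OnLine.third (hl : OnLine F cl d x p q) (hx : x ∈ F) (hr : r ∈ x)
    (hra : r ∉ flank cl p q) (hrb : r ∉ flank cl q p) : OnLine F cl d x p r := by
  obtain ⟨hc, hpq, hd⟩ := hl
  have hl : OnLine F cl d x p q := ⟨hc, hpq, hd⟩
  have hdF := OnLine.mem h hl
  have hpx : p ∈ x := hpq ▸ h.le_cl _ (by simp)
  have hqx : q ∈ x := hpq ▸ h.le_cl _ (by simp)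
  have hax := OnLine.flank_subset h hl hx
  have hbx := OnLine.flank_subset h hl.symm hx
  have hda : d ⊆ flank cl p q := hd ▸ Finset.inter_subset_left
  have hrd : r ∉ d := fun h' => hra (hda h')
  -- Adding `q` to the flank of `p` gives `x`, which covers that flank, so the points below `r` lie
  -- in the flank. Applied to both flanks, this puts them into `d`.
  have key : ∀ {p q : E}, OnLine F cl d x p q → r ∉ flank cl p q → lower cl r ⊆ flank cl p q := by
    intro p q hl hra
    have hqx : q ∈ x := hl.2.1 ▸ h.le_cl _ (by simp)
    have hj : cl (flank cl p q ∪ {q}) = x := by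
      refine (h.cl_subset hx (Finset.union_subset (OnLine.flank_subset h hl hx)
        (by simpa using hqx))).antisymm ?_
      rw [← hl.2.1]
      exact h.mono _ _ (Finset.union_subset_union_left (by simpa using h.mem_flank p q))
    exact h.lower_subset_of_cover hl.1.1 (h.lower_subset_flank p q) (hj ▸ hx) (hj ▸ hr) hra
  have hlr : lower cl r ⊆ d := hd ▸ Finset.subset_inter (key hl hra) (key hl.symm hrb)
  have hlp : lower cl p ⊆ d := hd ▸ h.lower_subset_inter hc
  -- the join of `p` and `r`
  have hZx : cl ({p} ∪ {r}) ⊆ x :=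
    h.cl_subset hx (Finset.union_subset (by simpa using hpx) (by simpa using hr))
  have hZF : cl ({p} ∪ {r}) ∈ F := h.mem_of_subset _ x hx ((h.le_cl _).trans hZx)
  have hrZ : r ∈ cl ({p} ∪ {r}) := h.le_cl _ (by simp)
  have hpZ : p ∈ cl ({p} ∪ {r}) := h.le_cl _ (by simp)
  have hpr : cl ({p} ∪ {r}) = x := by
    refine hZx.antisymm ?_
    -- Otherwise the modular law puts `r` into the join of `p` with `lower cl q`, which is the flank
    -- of `p`.
    have hq : q ∈ cl ({p} ∪ {r}) := by
      by_contra hq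
      have h1 := h.modular_point hZF (A := {p}) (by simpa using hpZ) hq
        (h.mem_of_subset _ x hx (Finset.union_subset hZx (by simpa using hqx)))
      exact hra (h1 (Finset.mem_inter.2 ⟨by rw [hpq]; exact hr, hrZ⟩))
    rw [← hpq]
    exact h.cl_subset hZF (Finset.union_subset (by simpa using hpZ) (by simpa using hq))
  have hcr : cl (d ∪ {r}) ⊆ x := h.cl_subset hx
    (Finset.union_subset (hda.trans hax) (by simpa using hr))
  have hcrF : cl (d ∪ {r}) ∈ F := h.mem_of_subset _ x hx ((h.le_cl _).trans hcr)
  have cover_r : ∀ s ∈ cl (d ∪ {r}), s ∉ d → cl (d ∪ {s}) = cl (d ∪ {r}) :=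
    fun s hs hsd => h.cl_union_eq_of_cover hdF hlr hcrF hs hsd
  have hr_mem : r ∈ cl (d ∪ {r}) := h.le_cl _ (by simp)
  have hpd : p ∉ d := fun h' => h.not_mem_flank hc (Finset.inter_subset_right (hd ▸ h'))
  have hqd : q ∉ d := fun h' => h.not_mem_flank hc.symm (hda h')
  have hpc : p ∉ cl (d ∪ {r}) := fun h' => by
    have := cover_r p h' hpd
    rw [OnLine.cl_union h hl] at this
    exact hra (this ▸ hr_mem)
  have hqc : q ∉ cl (d ∪ {r}) := fun h' => by
    have := cover_r q h' hqd
    rw [OnLine.cl_union h hl.symm] at this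
    exact hrb (this ▸ hr_mem)
  -- `x` covers the smaller flank, since `r` generates it from there. The larger one omits `r`, so
  -- the two coincide; the next equality uses the same argument with `p` as generator.
  have e₁ : flank cl p r = flank cl p q := by
    have hsub := h.flank_subset hc.1 (h.mem_flank p q) (hlr.trans hda)
    refine hsub.antisymm ?_
    have hF : flank cl p r ∈ F := h.mem_of_subset _ _ hc.1 ((h.le_cl _).trans hsub)
    have h1 : cl (flank cl p r ∪ {r}) = x := by
      refine (h.cl_subset hx (Finset.union_subset (hsub.trans hax) (by simpa using hr))).antisymm ?_
      rw [← hpr]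
      exact h.mono _ _ (Finset.union_subset_union_left (by simpa using h.mem_flank p r))
    exact h.subset_of_cover hF (h.lower_subset_flank p r) (h1 ▸ hx) hc.1 hsub (h1 ▸ hax) hra
  have e₂ : flank cl r p = cl (d ∪ {r}) := by
    have hsub : flank cl r p ⊆ cl (d ∪ {r}) := h.flank_subset hcrF hr_mem
      (hlp.trans (Finset.subset_union_left.trans (h.le_cl _)))
    refine hsub.antisymm ?_
    have hF : flank cl r p ∈ F := h.mem_of_subset _ _ hcrF ((h.le_cl _).trans hsub)
    have h1 : cl (flank cl r p ∪ {p}) = x := by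
      refine (h.cl_subset hx (Finset.union_subset (hsub.trans hcr) (by simpa using hpx))).antisymm
        ?_
      rw [← hpr, Finset.union_comm]
      exact h.mono _ _ (Finset.union_subset_union_left (by simpa using h.mem_flank r p))
    exact h.subset_of_cover hF (h.lower_subset_flank r p) (h1 ▸ hx) hcrF hsub (h1 ▸ hcr) hpc
  have hcrit : CriticalPair F cl p r := by
    refine ⟨e₁ ▸ hc.1, e₂ ▸ hcrF, fun hF => ?_⟩
    rw [e₁, e₂] at hF
    have h1 : x ⊆ flank cl p q ∪ cl (d ∪ {r}) := by
      rw [← hpr]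
      exact h.cl_subset hF (Finset.union_subset_union (by simpa using h.mem_flank p q)
        (by simpa using hr_mem))
    rcases Finset.mem_union.1 (h1 hqx) with h' | h'
    · exact h.not_mem_flank hc.symm h'
    · exact hqc h'
  refine ⟨hcrit, hpr, Finset.Subset.antisymm ?_ ?_⟩
  · rw [h.flank_inter_eq hcrit]
    exact h.cl_subset hdF (Finset.union_subset hlp hlr)
  · rw [e₁, e₂]
    exact Finset.subset_inter hda (Finset.subset_union_left.trans (h.le_cl _))

/-- All pairs of points of `x` with different joins with `d` are critical pairs. -/
theorem OnLine.pair (hl : OnLine F cl d x p q) (hx : x ∈ F) (hu : u ∈ x) (hv : v ∈ x)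
    (hud : u ∉ d) (hvd : v ∉ d) (huv : v ∉ cl (d ∪ {u})) : OnLine F cl d x u v := by
  have left : ∀ {p q : E}, OnLine F cl d x p q → u ∈ flank cl p q → OnLine F cl d x u v := by
    intro p q hl hup
    have hqd : q ∉ d := fun h' => h.not_mem_flank hl.1.symm (Finset.inter_subset_left (hl.2.2 ▸ h'))
    have hl' := OnLine.exchange h hl hx hup (h.mem_flank q p) hud hqd
    rw [OnLine.cl_union h hl'] at huv
    by_cases hvq : v ∈ flank cl q u
    · exact OnLine.exchange h hl' hx (h.mem_flank u q) hvq hud hvd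
    · exact OnLine.third h hl' hx hv huv hvq
  by_cases hup : u ∈ flank cl p q
  · exact left hl hup
  by_cases huq : u ∈ flank cl q p
  · exact left hl.symm huq
  -- If `u` is on neither flank, then `u` and `p` are themselves a critical pair on this line.
  exact left (OnLine.third h hl hx hu hup huq).symm (h.mem_flank u p)

end Critical

end IsModularFamily

end Geometry

/-! ### Lower covers, generation of members, and bounds for arbitrary bases. -/

section Geometry

variable {E : Type*} [DecidableEq E]

/-- `w` is a lower cover of `W` in `F`. -/
def LowerCover (F : Set (Finset E)) (w W : Finset E) : Prop :=
  w ∈ F ∧ w ⊂ W ∧ ∀ c ∈ F, w ⊆ c → c ⊆ W → c = w ∨ c = W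

theorem exists_lowerCover {F : Set (Finset E)} {y W : Finset E} (hy : y ∈ F) (hyW : y ⊂ W) :
    ∃ w, LowerCover F w W ∧ y ⊆ w := by
  classical
  obtain ⟨w, hw, hmax⟩ := (W.powerset.filter fun w => w ∈ F ∧ w ≠ W ∧ y ⊆ w).exists_max_image
    Finset.card ⟨y, by simp [hy, hyW.1, hyW.ne]⟩
  simp only [Finset.mem_filter, Finset.mem_powerset] at hw hmax
  refine ⟨w, ⟨hw.2.1, Finset.ssubset_iff_subset_ne.2 ⟨hw.1, hw.2.2.1⟩, fun c hc hwc hcW => ?_⟩,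
    hw.2.2.2⟩
  by_contra! hne
  exact hne.1 (Finset.eq_of_subset_of_card_le hwc
    (hmax c ⟨hcW, hc, hne.2, hw.2.2.2.trans hwc⟩)).symm

omit [DecidableEq E] in
theorem LowerCover.eq_of_subset {F : Set (Finset E)} {w w' W : Finset E} (h : LowerCover F w W)
    (h' : LowerCover F w' W) (hs : w ⊆ w') : w = w' :=
  ((h.2.2 w' h'.1 hs h'.2.1.1).resolve_right h'.2.1.ne).symm

namespace IsModularFamily

variable {F : Set (Finset E)} {cl : Finset E → Finset E} (h : IsModularFamily F cl)

include h

/-- Each `lower cl q` is a member that omits `q`, and the closure of the empty set lies in all of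
them. -/
theorem cl_empty : cl ∅ = ∅ := by
  rw [Finset.eq_empty_iff_forall_notMem]
  intro q hq
  exact not_mem_lower (cl := cl) q (h.cl_subset (h.below_mem q) (Finset.empty_subset _) hq)

theorem empty_mem {X : Finset E} (hX : X ∈ F) : ∅ ∈ F :=
  h.cl_empty ▸ h.mem_of_subset ∅ X hX (Finset.empty_subset _)

theorem lower_ssubset (p : E) : lower cl p ⊂ cl {p} :=
  (Finset.ssubset_iff_of_subset (lower_subset p)).2 ⟨p, h.mem_cl_self p, not_mem_lower p⟩

theorem cl_ssubset_of_mem_lower {p t : E} (ht : t ∈ lower cl p) : cl {t} ⊂ cl {p} :=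
  (h.cl_point_subset (h.below_mem p) ht).trans_ssubset (h.lower_ssubset p)

theorem cl_point_eq_lower_union (p : E) : cl {p} = lower cl p ∪ {p} := by
  rw [lower, Finset.sdiff_union_of_subset (h.le_cl _)]

theorem cl_point_injective {p q : E} (hpq : cl {p} = cl {q}) : p = q := by
  by_contra hne
  have hp : p ∈ lower cl q := by
    simp only [lower, Finset.mem_sdiff, Finset.mem_singleton]
    exact ⟨hpq ▸ h.mem_cl_self p, hne⟩
  exact (h.cl_ssubset_of_mem_lower hp).ne hpq

section Covers

variable {w w₁ w₂ w' W : Finset E}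

/-- A lower cover of `W` meets the members below `W` in lower covers. -/
theorem eq_or_eq_of_lowerCover (hw : LowerCover F w W) (hW : W ∈ F) (hw' : w' ∈ F) (hwW : w' ⊆ W)
    {c : Finset E} (hc : c ∈ F) (hwc : w ∩ w' ⊆ c) (hcw : c ⊆ w') : c = w ∩ w' ∨ c = w' := by
  by_cases hcw' : c ⊆ w
  · exact .inl ((Finset.subset_inter hcw' hcw).antisymm hwc)
  right
  have hcup : w ∪ c ⊆ W := Finset.union_subset hw.2.1.1 (hcw.trans hwW)
  have h1 := (hw.2.2 _ (h.mem_of_subset _ W hW hcup) (Finset.subset_union_left.trans (h.le_cl _))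
    (h.cl_subset hW hcup)).resolve_left fun e =>
      hcw' (e ▸ Finset.subset_union_right.trans (h.le_cl _))
  have h2 := h.modular c hc w hw.1 w' hw' hcw
    (h.mem_of_subset _ W hW (Finset.union_subset hw.2.1.1 hwW))
  rw [Finset.union_comm, h1, Finset.inter_eq_right.2 hwW, Finset.union_eq_left.2 hwc,
    h.closed c hc] at h2
  exact hcw.antisymm h2

/-- Since `w₂` covers its intersection with `w`, the set `w₁ ∩ w₂` would be equal to `w ∩ w₂` or to
`w₂`. The first is contained in `w`, and the second forces `w₁ = w₂`. -/
theorem not_inter_subset (hW : W ∈ F) (hw₁ : LowerCover F w₁ W) (hw₂ : LowerCover F w₂ W)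
    (hw : LowerCover F w W) (hne : w₁ ≠ w₂) (hd : ¬ w₁ ∩ w₂ ⊆ w) : ¬ w ∩ w₂ ⊆ w₁ := by
  intro hs
  rcases h.eq_or_eq_of_lowerCover hw hW hw₂.1 hw₂.2.1.1 (h.inter_mem _ hw₁.1 _ hw₂.1)
    (Finset.subset_inter hs Finset.inter_subset_right) Finset.inter_subset_right with e | e
  · exact hd (e ▸ Finset.inter_subset_left)
  · exact hne (hw₂.eq_of_subset hw₁ (Finset.inter_eq_right.1 e)).symm

end Covers

/-- Every point of the line is half of a critical pair on it, so that `cl (d ∪ {r})` is a flank and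
the results on flanks apply to it. -/
theorem OnLine.partner {d x : Finset E} {p q r : E} (hl : OnLine F cl d x p q) (hx : x ∈ F)
    (hr : r ∈ x) (hrd : r ∉ d) : ∃ s, OnLine F cl d x r s := by
  have left : ∀ {p q : E}, OnLine F cl d x p q → r ∈ flank cl p q → OnLine F cl d x r q :=
    fun {p q} hl hrp => OnLine.exchange h hl hx hrp (h.mem_flank q p) hrd fun h' =>
      h.not_mem_flank hl.1.symm (Finset.inter_subset_left (hl.2.2 ▸ h'))
  by_cases hrp : r ∈ flank cl p q
  · exact ⟨q, left hl hrp⟩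
  by_cases hrq : r ∈ flank cl q p
  · exact ⟨p, left hl.symm hrq⟩
  exact ⟨p, (OnLine.third h hl hx hr hrp hrq).symm⟩

section Closed

variable {X : Finset E}

/-- A set that is closed under implications for the points and the lines contains the joins of its
subsets. -/
theorem subset_of_generated
    (hpoint : ∀ p ∈ X, ∃ B ⊆ X, B ⊆ lower cl p ∧ lower cl p ⊆ cl B)
    (hline : ∀ d x p q, x ∈ F → OnLine F cl d x p q → flank cl p q ⊆ X → flank cl q p ⊆ X →
      ∀ r ∈ x, r ∉ d → ∃ u ∈ X, u ∉ d ∧ u ∈ cl (d ∪ {r}))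
    {A : Finset E} (hA : A ⊆ X) (hF : cl A ∈ F) : cl A ⊆ X := by
  classical
  generalize hWA : cl A = W at hF ⊢
  induction W using Finset.strongInduction generalizing A with
  | H W ih =>
  have ih' : ∀ B ⊆ X, cl B ⊂ W → cl B ⊆ X := fun B hB hs =>
    ih (cl B) hs hB rfl (h.mem_of_subset B W hF ((h.le_cl B).trans hs.1))
  have hAW : A ⊆ W := hWA ▸ h.le_cl A
  -- If `W` is the closure of a point, that point belongs to `A`, and its implication together with
  -- the induction hypothesis gives the points below it.
  by_cases hirr : ∃ p, cl {p} = W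
  · obtain ⟨p, rfl⟩ := hirr
    have hp : p ∈ A := by
      by_contra hp
      have h1 : A ⊆ lower cl p := fun t ht => by
        simp only [lower, Finset.mem_sdiff, Finset.mem_singleton]
        exact ⟨hAW ht, fun e => hp (e ▸ ht)⟩
      exact not_mem_lower p (h.cl_subset (h.below_mem p) h1 (hWA ▸ h.mem_cl_self p))
    obtain ⟨B, hB, hBp, hpB⟩ := hpoint p (hA hp)
    have h1 := ih' B hB ((h.cl_subset (h.below_mem p) hBp).trans_ssubset (h.lower_ssubset p))
    rw [h.cl_point_eq_lower_union]
    exact Finset.union_subset (hpB.trans h1) (by simpa using hA hp)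
  push Not at hirr
  have hpt : ∀ p ∈ W, cl {p} ⊂ W := fun p hp =>
    Finset.ssubset_iff_subset_ne.2 ⟨h.cl_point_subset hF hp, hirr p⟩
  rcases W.eq_empty_or_nonempty with rfl | hne
  · simp
  -- two proper members in `X` with join `W`
  obtain ⟨y, hy, hmax⟩ := (W.powerset.filter fun y => y ∈ F ∧ y ≠ W ∧ y ⊆ X).exists_max_image
    Finset.card ⟨∅, by simp [h.empty_mem hF, hne.ne_empty.symm]⟩
  simp only [Finset.mem_filter, Finset.mem_powerset] at hy hmax
  obtain ⟨hyW, hyF, hyne, hyX⟩ := hy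
  obtain ⟨p, hpA, hpy⟩ : ∃ p ∈ A, p ∉ y := by
    by_contra! hs
    exact hyne (hyW.antisymm (hWA ▸ h.cl_subset hyF hs))
  have hzX : cl {p} ⊆ X := ih' {p} (by simpa using hA hpA) (hpt p (hAW hpA))
  -- A proper join would lie in `X` by induction, against the maximality of `y`.
  have hyz : cl (y ∪ cl {p}) = W := by
    rw [h.cl_union_cl]
    by_contra hne'
    have hsub : cl (y ∪ {p}) ⊆ W :=
      h.cl_subset hF (Finset.union_subset hyW (by simpa using hAW hpA))
    have h1 := ih' (y ∪ {p}) (Finset.union_subset hyX (by simpa using hA hpA))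
      (Finset.ssubset_iff_subset_ne.2 ⟨hsub, hne'⟩)
    have h2 : y ⊆ cl (y ∪ {p}) := Finset.subset_union_left.trans (h.le_cl _)
    have h3 := Finset.eq_of_subset_of_card_le h2
      (hmax _ ⟨hsub, h.mem_of_subset _ W hF ((h.le_cl _).trans hsub), hne', h1⟩)
    exact hpy (h3 ▸ h.le_cl (y ∪ {p}) (by simp))
  -- members of `X` above one of two members of `X` with join `W`
  have join : ∀ y z w, y ∈ F → z ∈ F → w ∈ F → y ⊆ X → z ⊆ X → cl (y ∪ z) = W → y ⊆ w →
      w ⊂ W → w ⊆ X := by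
    intro y z w hy hz hw hyX hzX hj hyw hwW
    have hzW : z ⊆ W := hj ▸ Finset.subset_union_right.trans (h.le_cl _)
    -- Modularity gives `w = y ∨ (z ∩ w)`, the closure of a subset of `X` properly below `W`.
    have h1 := h.modular y hy z hz w hw hyw
      (h.mem_of_subset _ W hF (Finset.union_subset hzW hwW.1))
    rw [hj, Finset.inter_eq_right.2 hwW.1] at h1
    have h2 : cl (y ∪ (z ∩ w)) ⊆ w := h.cl_subset hw
      (Finset.union_subset hyw Finset.inter_subset_right)
    exact h1.trans (ih' _ (Finset.union_subset hyX (Finset.inter_subset_left.trans hzX))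
      (h2.trans_ssubset hwW))
  obtain ⟨w₁, hw₁, hyw₁⟩ := exists_lowerCover hyF (Finset.ssubset_iff_subset_ne.2 ⟨hyW, hyne⟩)
  obtain ⟨w₂, hw₂, hzw₂⟩ := exists_lowerCover (h.point_mem p) (hpt p (hAW hpA))
  have hX₁ : w₁ ⊆ X := join _ _ _ hyF (h.point_mem p) hw₁.1 hyX hzX hyz hyw₁ hw₁.2.1
  have hX₂ : w₂ ⊆ X := join _ _ _ (h.point_mem p) hyF hw₂.1 hzX hyX
    (by rw [Finset.union_comm]; exact hyz) hzw₂ hw₂.2.1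
  have hne₁₂ : w₁ ≠ w₂ := by
    rintro rfl
    exact hw₁.2.1.2 (hyz ▸ h.cl_subset hw₁.1 (Finset.union_subset hyw₁ hzw₂))
  -- Here `w ∩ w₂` and `w₁` lie in `X` and have join `W`, so `join` applies to `w` above `w ∩ w₂`.
  have other : ∀ w₁ w₂ w, LowerCover F w₁ W → LowerCover F w₂ W → LowerCover F w W → w₁ ≠ w₂ →
      w₁ ⊆ X → w₂ ⊆ X → ¬ w₁ ∩ w₂ ⊆ w → w ⊆ X := by
    intro w₁ w₂ w hw₁ hw₂ hw hne hX₁ hX₂ hd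
    refine join (w ∩ w₂) w₁ w (h.inter_mem _ hw.1 _ hw₂.1) hw₁.1 hw.1
      (Finset.inter_subset_right.trans hX₂) hX₁ ?_ Finset.inter_subset_left hw.2.1
    have hcup : w ∩ w₂ ∪ w₁ ⊆ W :=
      Finset.union_subset (Finset.inter_subset_left.trans hw.2.1.1) hw₁.2.1.1
    refine (hw₁.2.2 _ (h.mem_of_subset _ W hF hcup) (Finset.subset_union_right.trans (h.le_cl _))
      (h.cl_subset hF hcup)).resolve_left fun e => ?_
    exact h.not_inter_subset hF hw₁ hw₂ hw hne hd
      (e ▸ Finset.subset_union_left.trans (h.le_cl _))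
  -- Each point of `W` lies in a lower cover `w`. If `w` contains `w₁ ∩ w₂`, it cannot also contain
  -- `w₁ ∩ w₃`: both would equal `w₁ ∩ w`, and `w₃` would contain `w₁ ∩ w₂`. So `other` applies to
  -- `w₁, w₂` or to `w₁, w₃`.
  have all : ∀ w₃, LowerCover F w₃ W → ¬ w₁ ∩ w₂ ⊆ w₃ → W ⊆ X := by
    intro w₃ hw₃ hd r hr
    have hX₃ := other w₁ w₂ w₃ hw₁ hw₂ hw₃ hne₁₂ hX₁ hX₂ hd
    obtain ⟨w, hw, hrw⟩ := exists_lowerCover (h.point_mem r) (hpt r hr)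
    refine (?_ : w ⊆ X) (hrw (h.mem_cl_self r))
    by_cases hdw : w₁ ∩ w₂ ⊆ w
    · by_cases e : w₁ = w
      · exact e ▸ hX₁
      refine other w₁ w₃ w hw₁ hw₃ hw (fun e => hd (e ▸ Finset.inter_subset_left)) hX₁ hX₃
        fun hd' => ?_
      have hF' := h.inter_mem _ hw₁.1 _ hw.1
      have hsub : ¬ w₁ ∩ w = w₁ := fun e' =>
        e (hw₁.eq_of_subset hw (Finset.inter_eq_left.1 e'))
      have e₂ := (h.eq_or_eq_of_lowerCover hw₂ hF hw₁.1 hw₁.2.1.1 hF'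
        (Finset.subset_inter Finset.inter_subset_right (by rwa [Finset.inter_comm]))
        Finset.inter_subset_left).resolve_right hsub
      have e₃ := (h.eq_or_eq_of_lowerCover hw₃ hF hw₁.1 hw₁.2.1.1 hF'
        (Finset.subset_inter Finset.inter_subset_right (by rwa [Finset.inter_comm]))
        Finset.inter_subset_left).resolve_right hsub
      rw [Finset.inter_comm] at hd
      exact hd (e₂ ▸ e₃ ▸ Finset.inter_subset_left)
    · exact other w₁ w₂ w hw₁ hw₂ hw hne₁₂ hX₁ hX₂ hdw
  -- minimal points
  have minimal : ∀ w₁ w₂, LowerCover F w₁ W → LowerCover F w₂ W → w₁ ≠ w₂ →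
      ∃ p ∈ w₁, p ∉ w₂ ∧ lower cl p ⊆ w₂ := by
    intro w₁ w₂ hw₁ hw₂ hne
    obtain ⟨p, hp, hmin⟩ := (w₁ \ w₂).exists_min_image (fun p => (cl {p}).card)
      (Finset.sdiff_nonempty.2 fun hs => hne (hw₁.eq_of_subset hw₂ hs))
    simp only [Finset.mem_sdiff] at hp hmin
    refine ⟨p, hp.1, hp.2, fun t ht => ?_⟩
    by_contra ht₂
    exact (hmin t ⟨h.lower_subset_of_mem hw₁.1 hp.1 ht, ht₂⟩).not_gt
      (Finset.card_lt_card (h.cl_ssubset_of_mem_lower ht))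
  obtain ⟨p, hp₁, hp₂, hlp⟩ := minimal w₁ w₂ hw₁ hw₂ hne₁₂
  obtain ⟨q, hq₂, hq₁, hlq⟩ := minimal w₂ w₁ hw₂ hw₁ hne₁₂.symm
  have hVW : cl ({p} ∪ {q}) ⊆ W := h.cl_subset hF
    (Finset.union_subset (by simpa using hw₁.2.1.1 hp₁) (by simpa using hw₂.2.1.1 hq₂))
  have hVF := h.mem_of_subset _ W hF ((h.le_cl _).trans hVW)
  have hpV : p ∈ cl ({p} ∪ {q}) := h.le_cl _ (by simp)
  have hqV : q ∈ cl ({p} ∪ {q}) := h.le_cl _ (by simp)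
  -- If `p` and `q` generate `W`, then `w₁` and `w₂` are their flanks, and either the union of the
  -- flanks is all of `W` or the pair is critical. Otherwise some lower cover contains both points
  -- but not `w₁ ∩ w₂`, and `all` finishes.
  by_cases hV : cl ({p} ∪ {q}) = W
  · have flank_eq_cover : ∀ p q w, w ∈ F → w ⊆ W → p ∈ w → q ∉ w → lower cl q ⊆ w →
        cl ({p} ∪ {q}) = W → flank cl p q = w := by
      intro p q w hw hwW hp hq hlq hV
      have hsub := h.flank_subset hw hp hlq
      have hj : cl (flank cl p q ∪ {q}) = W := by
        refine (h.cl_subset hF (Finset.union_subset (hsub.trans hwW) ?_)).antisymm ?_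
        · rw [← hV, Finset.singleton_subset_iff]; exact h.le_cl _ (by simp)
        · rw [← hV]
          exact h.mono _ _ (Finset.union_subset_union_left (by simpa using h.mem_flank p q))
      exact hsub.antisymm (h.subset_of_cover (h.mem_of_subset _ _ hw ((h.le_cl _).trans hsub))
        (h.lower_subset_flank p q) (hj ▸ hF) hw hsub (hj ▸ hwW) hq)
    have e₁ := flank_eq_cover p q w₁ hw₁.1 hw₁.2.1.1 hp₁ hq₁ hlq hV
    have e₂ := flank_eq_cover q p w₂ hw₂.1 hw₂.2.1.1 hq₂ hp₂ hlp
      (by rw [Finset.union_comm]; exact hV)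
    by_cases hU : w₁ ∪ w₂ ∈ F
    · rw [← hV]
      exact (h.cl_subset hU (Finset.union_subset_union (by simpa using hp₁)
        (by simpa using hq₂))).trans (Finset.union_subset hX₁ hX₂)
    have hl : OnLine F cl (w₁ ∩ w₂) W p q := 
      ⟨⟨by rw [e₁]; exact hw₁.1, by rw [e₂]; exact hw₂.1, by rwa [e₁, e₂]⟩, hV, by rw [e₁, e₂]⟩
    intro r hr
    by_cases hrd : r ∈ w₁ ∩ w₂
    · exact hX₁ (Finset.inter_subset_left hrd)
    obtain ⟨u, hu, hud, hur⟩ := hline _ _ p q hF hl (e₁ ▸ hX₁) (e₂ ▸ hX₂) r hr hrd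
    obtain ⟨s, hs⟩ := OnLine.partner h hl hF hr hrd
    have e := OnLine.cl_union h hs
    have hud' := OnLine.eq_of_mem h hs (e ▸ hur) hud
    have hsW : s ∈ W := hs.2.1 ▸ h.le_cl _ (by simp)
    -- The point `u` of `X` generates the same atom as `r`. The atom is a proper part of `W`
    -- generated inside `X`, so the induction hypothesis covers it.
    have hlt : cl (w₁ ∩ w₂ ∪ {u}) ⊂ W := by
      rw [hud', Finset.ssubset_iff_of_subset (OnLine.flank_subset h hs hF)]
      exact ⟨s, hsW, h.not_mem_flank hs.1.symm⟩
    have h1 := ih' _ (Finset.union_subset (Finset.inter_subset_left.trans hX₁) (by simpa using hu))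
      hlt
    rw [hud'] at h1
    exact h1 (h.mem_flank r s)
  · obtain ⟨w₃, hw₃, hVw⟩ := exists_lowerCover hVF (Finset.ssubset_iff_subset_ne.2 ⟨hVW, hV⟩)
    refine all w₃ hw₃ fun hd => ?_
    have hcup : w₁ ∩ w₂ ∪ {p} ⊆ w₁ :=
      Finset.union_subset Finset.inter_subset_left (by simpa using hp₁)
    have h1 := (h.eq_or_eq_of_lowerCover hw₂ hF hw₁.1 hw₁.2.1.1
      (h.mem_of_subset _ _ hw₁.1 hcup) (by
        rw [Finset.inter_comm]; exact Finset.subset_union_left.trans (h.le_cl _))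
      (h.cl_subset hw₁.1 hcup)).resolve_left fun e =>
        hp₂ (Finset.inter_subset_left (e ▸ h.le_cl _ (by simp)))
    have h2 : w₁ ⊆ w₃ := by
      rw [← h1]
      exact h.cl_subset hw₃.1 (Finset.union_subset hd (by simpa using hVw hpV))
    exact hq₁ (hw₁.eq_of_subset hw₃ h2 ▸ hVw hqV)

/-- If `y` is not the closure of a point, it is the join of a lower cover `y'` and the closure of a
point outside `y'`. Both have joins with `z` by minimality, so the condition on triple joins yields
the join of `y` and `z`. -/
theorem exists_point_of_minimal {y z : Finset E} (hy : y ∈ F) (hz : z ∈ F)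
    (hyz : cl (y ∪ z) ∉ F) (hmin : ∀ y' ∈ F, y' ⊂ y → cl (y' ∪ z) ∈ F) : ∃ p, cl {p} = y := by
  by_contra! hirr
  rcases y.eq_empty_or_nonempty with rfl | hne
  · rw [Finset.empty_union, h.closed z hz] at hyz
    exact hyz hz
  obtain ⟨y', hy', -⟩ := exists_lowerCover (h.empty_mem hy)
    (Finset.ssubset_iff_subset_ne.2 ⟨Finset.empty_subset _, hne.ne_empty.symm⟩)
  obtain ⟨p, hp, hpy⟩ := Finset.exists_of_ssubset hy'.2.1
  have hpy' : cl {p} ⊂ y := Finset.ssubset_iff_subset_ne.2 ⟨h.cl_point_subset hy hp, hirr p⟩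
  have hcup : y' ∪ cl {p} ⊆ y := Finset.union_subset hy'.2.1.1 hpy'.1
  have e := (hy'.2.2 _ (h.mem_of_subset _ y hy hcup) (Finset.subset_union_left.trans (h.le_cl _))
    (h.cl_subset hy hcup)).resolve_left fun e => hpy
      (e ▸ h.le_cl _ (Finset.mem_union_right _ (h.mem_cl_self p)))
  have h1 := h.join_mem y' hy'.1 (cl {p}) (h.point_mem p) z hz (e ▸ hy)
    (hmin _ (h.point_mem p) hpy') (by rw [Finset.union_comm]; exact hmin y' hy'.1 hy'.2.1)
  rw [← h.cl_cl_union, e] at h1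
  exact hyz h1

/-- A set that is closed under implications for the points, the lines and the inconsistent
critical pairs is a member. -/
theorem mem_of_generated (hE : ∅ ∈ F)
    (hpoint : ∀ p ∈ X, ∃ B ⊆ X, B ⊆ lower cl p ∧ lower cl p ⊆ cl B)
    (hline : ∀ d x p q, x ∈ F → OnLine F cl d x p q → flank cl p q ⊆ X → flank cl q p ⊆ X →
      ∀ r ∈ x, r ∉ d → ∃ u ∈ X, u ∉ d ∧ u ∈ cl (d ∪ {r}))
    (hpair : ∀ p q, CriticalPair F cl p q → cl ({p} ∪ {q}) ∉ F → flank cl p q ⊆ X →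
      flank cl q p ⊆ X → False) : X ∈ F := by
  classical
  have gen : ∀ A ⊆ X, cl A ∈ F → cl A ⊆ X := fun A hA hF =>
    h.subset_of_generated hpoint hline hA hF
  by_cases hX : cl X ∈ F
  · rwa [(gen X subset_rfl hX).antisymm (h.le_cl X)] at hX
  exfalso
  obtain ⟨y₀, z₀, hy₀, hz₀, hyX₀, hzX₀, hyz₀⟩ :
      ∃ y z, y ∈ F ∧ z ∈ F ∧ y ⊆ X ∧ z ⊆ X ∧ cl (y ∪ z) ∉ F := by
    -- If all such joins existed, a maximal member inside `X` could be enlarged by any further point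
    -- of `X`; it would be `X` itself.
    by_contra! hall
    obtain ⟨y, hy, hmax⟩ := (X.powerset.filter fun y => y ∈ F).exists_max_image
      Finset.card ⟨∅, by simp [hE]⟩
    simp only [Finset.mem_filter, Finset.mem_powerset] at hy hmax
    obtain ⟨p, hpX, hpy⟩ : ∃ p ∈ X, p ∉ y := by
      by_contra! hs
      rw [← hy.1.antisymm hs, h.closed y hy.2] at hX
      exact hX hy.2
    have hp : cl {p} ⊆ X := gen {p} (by simpa using hpX) (h.point_mem p)
    have h1 := hall y (cl {p}) hy.2 (h.point_mem p) hy.1 hp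
    have h2 := gen _ (Finset.union_subset hy.1 hp) h1
    have h3 := Finset.eq_of_subset_of_card_le (Finset.subset_union_left.trans (h.le_cl _))
      (hmax _ ⟨h2, h1⟩)
    exact hpy (h3 ▸ h.le_cl _ (Finset.mem_union_right _ (h.mem_cl_self p)))
  obtain ⟨⟨y, z⟩, hyz, hmin⟩ := ((X.powerset ×ˢ X.powerset).filter fun s =>
    s.1 ∈ F ∧ s.2 ∈ F ∧ cl (s.1 ∪ s.2) ∉ F).exists_min_image (fun s => s.1.card + s.2.card)
      ⟨(y₀, z₀), by simp [*]⟩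
  simp only [Finset.mem_filter, Finset.mem_product, Finset.mem_powerset] at hyz hmin
  obtain ⟨⟨hyX, hzX⟩, hy, hz, hyz⟩ := hyz
  have hmin₁ : ∀ y' ∈ F, y' ⊂ y → cl (y' ∪ z) ∈ F := by
    intro y' hy' hlt
    by_contra hc
    have := hmin (y', z) ⟨⟨hlt.1.trans hyX, hzX⟩, hy', hz, hc⟩
    have := Finset.card_lt_card hlt
    simp only at *
    omega
  have hmin₂ : ∀ z' ∈ F, z' ⊂ z → cl (y ∪ z') ∈ F := by
    intro z' hz' hlt
    by_contra hc
    have := hmin (y, z') ⟨⟨hyX, hlt.1.trans hzX⟩, hy, hz', hc⟩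
    have := Finset.card_lt_card hlt
    simp only at *
    omega
  obtain ⟨p, rfl⟩ := h.exists_point_of_minimal hy hz hyz hmin₁
  obtain ⟨q, rfl⟩ := h.exists_point_of_minimal hz hy (by rwa [Finset.union_comm])
    fun z' hz' hlt => by rw [Finset.union_comm]; exact hmin₂ z' hz' hlt
  have hpq : cl ({p} ∪ {q}) ∉ F := by rwa [h.cl_cl_union, h.cl_union_cl] at hyz
  have hF₁ : flank cl p q ∈ F := by
    have := hmin₂ _ (h.below_mem q) (h.lower_ssubset q)
    rwa [h.cl_cl_union] at this
  have hF₂ : flank cl q p ∈ F := by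
    have := hmin₁ _ (h.below_mem p) (h.lower_ssubset p)
    rw [h.cl_union_cl, Finset.union_comm] at this
    exact this
  have hpX := hyX (h.mem_cl_self p)
  have hqX := hzX (h.mem_cl_self q)
  refine hpair p q ⟨hF₁, hF₂, fun hU => ?_⟩ hpq
    (gen _ (Finset.union_subset (by simpa using hpX) ((lower_subset q).trans hzX)) hF₁)
    (gen _ (Finset.union_subset (by simpa using hqX) ((lower_subset p).trans hyX)) hF₂)
  exact hpq (h.mem_of_subset _ _ hU (Finset.union_subset_union (by simpa using h.mem_flank p q)
    (by simpa using h.mem_flank q p)))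

end Closed

/-! ### Irredundant generating sets -/

/-- Steinitz exchange. If no `b` worked, modularity would place every `b` in `C ∨ lower cl a`. Since
`B` generates `a`, also `a` would lie there, and a second use of the modular law puts `a` into
`lower cl a`. Nonemptiness of `B` gives `a ∉ cl C`. -/
theorem exists_exchange {D C B : Finset E} {a : E} (hD : D ∈ F) (hC : C ⊆ D) (ha : a ∈ D)
    (hCa : D ⊆ cl (C ∪ {a})) (hBD : B ⊆ D) (hB : D ⊆ cl B) (hne : B.Nonempty) :
    ∃ b ∈ B, D ⊆ cl (C ∪ {b}) := by
  by_contra! hall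
  have sub : ∀ {s : Finset E}, s ⊆ D → C ∪ s ⊆ D := fun hs => Finset.union_subset hC hs
  have memF : ∀ {s : Finset E}, s ⊆ D → cl s ∈ F := fun hs => h.mem_of_subset _ D hD hs
  have eD : cl (C ∪ {a}) = D := (h.cl_subset hD (sub (by simpa using ha))).antisymm hCa
  have hlow : lower cl a ⊆ D := h.lower_subset_of_mem hD ha
  have hnot : ∀ b ∈ B, a ∉ cl (C ∪ {b}) := fun b hb hab => hall b hb (eD ▸ h.cl_subset_cl
    (Finset.union_subset (Finset.subset_union_left.trans (h.le_cl _)) (by simpa using hab)))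
  have haC : a ∉ cl C := by
    obtain ⟨b, hb⟩ := hne
    exact fun hC' => hnot b hb (h.mono _ _ Finset.subset_union_left hC')
  have hBe : B ⊆ cl (C ∪ lower cl a) := by
    intro b hb
    have hbD : {b} ⊆ D := by simpa using hBD hb
    have h1 := h.modular_point (memF (sub hbD))
      (Finset.subset_union_left.trans (h.le_cl _)) (hnot b hb)
      (memF (Finset.union_subset (h.cl_subset hD (sub hbD)) (by simpa using ha)))
    exact h1 (Finset.mem_inter.2 ⟨eD ▸ hBD hb, h.le_cl _ (by simp)⟩)
  have haD : a ∈ cl (lower cl a ∪ cl C) := by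
    rw [h.cl_union_cl, Finset.union_comm]
    exact h.cl_subset_cl hBe (hB ha)
  have h2 := h.modular (lower cl a) (h.below_mem a) (cl C) (memF hC) (cl {a}) (h.point_mem a)
    (lower_subset a) (memF (Finset.union_subset (h.cl_subset hD hC) (h.cl_point_subset hD ha)))
    (Finset.mem_inter.2 ⟨haD, h.mem_cl_self a⟩)
  rw [Finset.inter_comm (cl C), Finset.union_eq_left.2 (inter_lower haC), h.cl_lower] at h2
  exact not_mem_lower a h2

/-- An irredundant generating set has the least number of elements. -/
theorem card_le_of_irredundant {D A B : Finset E} (hD : D ∈ F) (hAD : A ⊆ D) (hA : D ⊆ cl A)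
    (hBD : B ⊆ D) (hB : D ⊆ cl B) (hirr : ∀ q ∈ B, ¬ D ⊆ cl (B \ {q})) : B.card ≤ A.card := by
  rcases B.eq_empty_or_nonempty with rfl | hne
  · simp
  -- The elements of `A` are exchanged one by one for elements of `B`. The resulting part of `B`
  -- generates `D`, so by irredundancy it is all of `B`.
  have key : ∀ A : Finset E, A ⊆ D → ∀ C ⊆ D, D ⊆ cl (C ∪ A) →
      ∃ B' ⊆ B, B'.card ≤ A.card ∧ D ⊆ cl (C ∪ B') := by
    intro A
    induction A using Finset.induction_on with
    | empty => exact fun _ C _ hC => ⟨∅, by simp, by simp, hC⟩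
    | insert a A ha ih =>
      intro hAD C hC hCA
      rw [Finset.insert_subset_iff] at hAD
      obtain ⟨b, hb, hb'⟩ := h.exists_exchange hD (C := C ∪ A) (Finset.union_subset hC hAD.2)
        hAD.1 (by rw [Finset.union_assoc, Finset.union_comm A]; exact hCA) hBD hB hne
      obtain ⟨B', hB', hcard, hgen⟩ := ih hAD.2 (C ∪ {b})
        (Finset.union_subset hC (by simpa using hBD hb))
        (by rw [Finset.union_right_comm]; exact hb')
      refine ⟨{b} ∪ B', Finset.union_subset (by simpa using hb) hB', ?_, ?_⟩
      · rw [Finset.card_insert_of_notMem ha]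
        exact (Finset.card_union_le _ _).trans (by simp; omega)
      · rwa [← Finset.union_assoc]
  obtain ⟨B', hB', hcard, hgen⟩ := key A hAD ∅ (Finset.empty_subset _) (by simpa using hA)
  rw [Finset.empty_union] at hgen
  refine le_trans (Finset.card_le_card fun q hq => ?_) hcard
  by_contra hq'
  refine hirr q hq (hgen.trans (h.mono _ _ fun t ht => ?_))
  simp only [Finset.mem_sdiff, Finset.mem_singleton]
  exact ⟨hB' ht, fun e => hq' (e ▸ ht)⟩

/-! ### Lower bounds for implicational bases -/

section Bases

variable {T : Finset (Implication E)} (hT : closedSets T = F)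

include hT

omit [DecidableEq E] h in
theorem conclusion_subset {I : Implication E} (hI : I ∈ T) {X : Finset E} (hX : X ∈ F)
    (hs : I.1 ⊆ X) : I.2.Nonempty ∧ I.2 ⊆ X := by
  rw [← hT] at hX
  have hne : I.2.Nonempty := by
    rw [Finset.nonempty_iff_ne_empty]
    exact fun he => (hX I hI).2 he hs
  exact ⟨hne, (hX I hI).1 hne hs⟩

omit h in
theorem exists_violated {X : Finset E} (hX : X ∉ F) :
    ∃ I ∈ T, I.1 ⊆ X ∧ (I.2.Nonempty → ¬ I.2 ⊆ X) := by
  rw [← hT] at hX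
  simp only [closedSets, Set.mem_ofPred_eq, not_forall] at hX
  obtain ⟨I, hI, h'⟩ := hX
  refine ⟨I, hI, ?_⟩
  rcases I.2.eq_empty_or_nonempty with he | hne
  · simp [he] at h' ⊢
    exact h'
  · simp [hne, hne.ne_empty] at h' ⊢
    exact h'

/-- The conclusions of these implications, without `p`, form a set `B'` that generates `lower cl p`,
because `cl B' ∪ {p}` violates nothing in `T`. The summand 1 pays for one premise: there is one, as
`B'` is not empty. -/
theorem card_le_sum_single {p : E} {B : Finset E} (hBne : B.Nonempty) (hBp : B ⊆ lower cl p)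
    (hB : lower cl p ⊆ cl B) (hirr : ∀ q ∈ B, ¬ lower cl p ⊆ cl (B \ {q})) :
    1 + B.card ≤ ∑ I ∈ T.filter fun I => p ∈ I.1 ∧ I.1 ⊆ cl {p}, (I.1.card + I.2.card) := by
  set K := T.filter fun I => p ∈ I.1 ∧ I.1 ⊆ cl {p} with hK
  set B' := (K.biUnion fun I => I.2).erase p with hB'
  have hB'p : B' ⊆ lower cl p := by
    intro t ht
    simp only [hB', Finset.mem_erase, Finset.mem_biUnion, hK, Finset.mem_filter] at ht
    obtain ⟨htp, I, ⟨hI, -, hIp⟩, htI⟩ := ht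
    simp only [lower, Finset.mem_sdiff, Finset.mem_singleton]
    exact ⟨(conclusion_subset hT hI (h.point_mem p) hIp).2 htI, htp⟩
  have hclB' : cl B' ⊆ lower cl p := h.cl_subset (h.below_mem p) hB'p
  have hgen : lower cl p ⊆ cl B' := by
    have hY : cl B' ∪ {p} ∈ F := by
      by_contra hY
      obtain ⟨I, hI, hs, hv⟩ := exists_violated hT hY
      have hIp : I.1 ⊆ cl {p} := hs.trans (Finset.union_subset
        (hclB'.trans (lower_subset p)) (h.le_cl _))
      obtain ⟨hne, h2⟩ := conclusion_subset hT hI (h.point_mem p) hIp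
      refine hv hne ?_
      by_cases hp : p ∈ I.1
      · intro t ht
        by_cases htp : t = p
        · simp [htp]
        · refine Finset.mem_union_left _ (h.le_cl _ ?_)
          simp only [hB', Finset.mem_erase, Finset.mem_biUnion, hK, Finset.mem_filter]
          exact ⟨htp, I, ⟨hI, hp, hIp⟩, ht⟩
      · refine (conclusion_subset hT hI (h.mem_of_subset _ _ (h.below_mem p) hB'p)
          fun t ht => ?_).2.trans Finset.subset_union_left
        exact (Finset.mem_union.1 (hs ht)).resolve_right fun e =>
          hp (Finset.mem_singleton.1 e ▸ ht)
    have h1 := h.cl_point_subset hY (p := p) (by simp)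
    intro t ht
    refine (Finset.mem_union.1 (h1 (lower_subset p ht))).resolve_right fun e => ?_
    exact not_mem_lower p (Finset.mem_singleton.1 e ▸ ht)
  have hcard := h.card_le_of_irredundant (h.below_mem p) hB'p hgen hBp hB hirr
  have hB'card : B'.card ≤ ∑ I ∈ K, I.2.card :=
    (Finset.card_erase_le).trans Finset.card_biUnion_le
  have hKne : K.Nonempty := by
    rw [Finset.nonempty_iff_ne_empty]
    intro he
    have : B'.card = 0 := by simp [hB', he]
    have := hBne.card_pos
    omega
  obtain ⟨I, hI⟩ := hKne
  have hone : 1 ≤ ∑ I ∈ K, I.1.card :=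
    le_trans (Finset.card_pos.2 ⟨p, (Finset.mem_filter.1 hI).2.1⟩)
      (Finset.single_le_sum (f := fun I : Implication E => I.1.card) (fun _ _ => Nat.zero_le _) hI)
  rw [Finset.sum_add_distrib]
  omega

/-- An implication violated by the union but by neither flank has a premise contained in neither of
them. -/
theorem exists_critical_premise {p q : E} (hc : CriticalPair F cl p q) :
    ∃ I ∈ T, I.1 ⊆ flank cl p q ∪ flank cl q p ∧ ¬ I.1 ⊆ flank cl p q ∧ ¬ I.1 ⊆ flank cl q p ∧
      2 ≤ I.1.card ∧ (cl ({p} ∪ {q}) ∈ F → 1 ≤ I.2.card) := by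
  obtain ⟨I, hI, hs, hv⟩ := exists_violated hT hc.2.2
  have h1 : ¬ I.1 ⊆ flank cl p q := fun h' => by
    obtain ⟨hne, h2⟩ := conclusion_subset hT hI hc.1 h'
    exact hv hne (h2.trans Finset.subset_union_left)
  have h2 : ¬ I.1 ⊆ flank cl q p := fun h' => by
    obtain ⟨hne, h2⟩ := conclusion_subset hT hI hc.2.1 h'
    exact hv hne (h2.trans Finset.subset_union_right)
  refine ⟨I, hI, hs, h1, h2, ?_, fun hF => ?_⟩
  · obtain ⟨s, hs', hs1⟩ := Finset.not_subset.1 h1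
    obtain ⟨t, ht', ht1⟩ := Finset.not_subset.1 h2
    have hs2 := (Finset.mem_union.1 (hs hs')).resolve_left hs1
    exact Finset.one_lt_card.2 ⟨s, hs', t, ht', fun e => ht1 (e ▸ hs2)⟩
  · have h3 := h.flank_subset_of_join hF (p := p) (q := q) (h.le_cl _ (by simp))
      (h.le_cl _ (by simp))
    have h4 := h.flank_subset_of_join hF (p := q) (q := p) (h.le_cl _ (by simp))
      (h.le_cl _ (by simp))
    exact (conclusion_subset hT hI hF (hs.trans (Finset.union_subset h3 h4))).1.card_pos

end Bases

end IsModularFamily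

end Geometry

/-! ### The closure under a list of implications -/

section Closure

variable {n : ℕ} (S : List (Implication (Fin n)))

theorem subset_saturate (X : Finset (Fin n)) : X ⊆ saturate S X := by
  induction S generalizing X with
  | nil => exact subset_rfl
  | cons I S ih =>
    refine subset_trans ?_ (ih _)
    beta_reduce
    split_ifs
    · exact Finset.subset_union_left
    · exact subset_rfl

theorem saturate_mono {X Y : Finset (Fin n)} (hXY : X ⊆ Y) : saturate S X ⊆ saturate S Y := by
  induction S generalizing X Y with
  | nil => exact hXY
  | cons I S ih =>
    refine ih ?_
    beta_reduce
    by_cases hX : I.1 ⊆ X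
    · rw [if_pos hX, if_pos (hX.trans hXY)]
      exact Finset.union_subset_union_left hXY
    · rw [if_neg hX]
      split_ifs
      · exact hXY.trans Finset.subset_union_left
      · exact hXY

theorem saturate_eq_self_iff {X : Finset (Fin n)} :
    saturate S X = X ↔ ∀ I ∈ S, I.1 ⊆ X → I.2 ⊆ X := by
  induction S generalizing X with
  | nil => simp [saturate]
  | cons I S ih =>
    have h1 : saturate (I :: S) X = saturate S (if I.1 ⊆ X then X ∪ I.2 else X) := rfl
    simp only [List.mem_cons, forall_eq_or_imp]
    rw [h1, ← ih]
    constructor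
    · intro h
      have h2 := subset_saturate S (if I.1 ⊆ X then X ∪ I.2 else X)
      rw [h] at h2
      have h3 : I.1 ⊆ X → I.2 ⊆ X := fun hI => by
        rw [if_pos hI] at h2
        exact Finset.subset_union_right.trans h2
      refine ⟨h3, ?_⟩
      by_cases hI : I.1 ⊆ X
      · rwa [if_pos hI, Finset.union_eq_left.2 (h3 hI)] at h
      · rwa [if_neg hI] at h
    · rintro ⟨h3, h⟩
      by_cases hI : I.1 ⊆ X
      · rwa [if_pos hI, Finset.union_eq_left.2 (h3 hI)]
      · rwa [if_neg hI]

theorem implClosure_eq_iterate (A : Finset (Fin n)) : implClosure S A = (saturate S)^[n] A := by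
  rw [implClosure, List.foldl_const, List.length_finRange]

/-- A round that changes the set adds an element, so after `k` rounds the set is stable or has at
least `k` elements. -/
theorem saturate_implClosure (A : Finset (Fin n)) :
    saturate S (implClosure S A) = implClosure S A := by
  rw [implClosure_eq_iterate]
  have key : ∀ k, saturate S ((saturate S)^[k] A) = (saturate S)^[k] A ∨
      k ≤ ((saturate S)^[k] A).card := by
    intro k
    induction k with
    | zero => simp
    | succ k ih =>
      rw [Function.iterate_succ_apply']
      by_cases hfix : saturate S ((saturate S)^[k] A) = (saturate S)^[k] A
      · exact .inl (by rw [hfix, hfix])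
      · have := Finset.card_lt_card
          (Finset.ssubset_iff_subset_ne.2 ⟨subset_saturate S _, Ne.symm hfix⟩)
        have := ih.resolve_left hfix
        exact .inr (by omega)
  refine (key n).elim id fun hcard => ?_
  have : (saturate S)^[n] A = Finset.univ :=
    Finset.eq_univ_of_card _ (le_antisymm (Finset.card_le_univ _) (by simpa using hcard))
  rw [this]
  exact (Finset.subset_univ _).antisymm (subset_saturate S _)

theorem subset_implClosure (A : Finset (Fin n)) : A ⊆ implClosure S A := by
  have : ∀ k, A ⊆ (saturate S)^[k] A := by
    intro k
    induction k with
    | zero => exact subset_rfl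
    | succ k ih =>
      rw [Function.iterate_succ_apply']
      exact ih.trans (subset_saturate S _)
  exact (implClosure_eq_iterate S A).symm ▸ this n

theorem implClosure_mono {A B : Finset (Fin n)} (hAB : A ⊆ B) :
    implClosure S A ⊆ implClosure S B := by
  rw [implClosure_eq_iterate, implClosure_eq_iterate]
  have : ∀ k, (saturate S)^[k] A ⊆ (saturate S)^[k] B := by
    intro k
    induction k with
    | zero => exact hAB
    | succ k ih =>
      rw [Function.iterate_succ_apply', Function.iterate_succ_apply']
      exact saturate_mono S ih
  exact this n

theorem implClosure_eq_self {X : Finset (Fin n)} (hX : saturate S X = X) :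
    implClosure S X = X := by
  rw [implClosure_eq_iterate]
  exact Function.iterate_fixed hX n

theorem mem_closedSets_iff {X : Finset (Fin n)} : X ∈ closedSets S.toFinset ↔
    saturate S X = X ∧ ∀ I ∈ S, I.2 = ∅ → ¬ I.1 ⊆ X := by
  rw [saturate_eq_self_iff]
  simp only [closedSets, Set.mem_ofPred_eq, List.mem_toFinset]
  constructor
  · refine fun h => ⟨fun I hI hs => ?_, fun I hI => (h I hI).2⟩
    rcases I.2.eq_empty_or_nonempty with he | hne
    · simp [he]
    · exact (h I hI).1 hne hs
  · exact fun h I hI => ⟨fun _ => h.1 I hI, h.2 I hI⟩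

end Closure

/-! ### The closed sets of a simple modular family -/

/-- The modular law in terms of bounds. -/
theorem le_of_exists_modular {P : Type*} [hP : PartialOrder P]
    (hl : ∃ l : Lattice P, l.toPartialOrder = hP ∧ @IsModularLattice P l)
    {x y z j i k t : P} (hxz : x ≤ z) (hj : IsLUB {x, y} j) (hi : IsGLB {j, z} i)
    (hk : IsGLB {y, z} k) (ht : IsLUB {x, k} t) : i ≤ t := by
  obtain ⟨l, rfl, hm⟩ := hl
  rw [hj.unique isLUB_pair] at hi
  rw [hk.unique isGLB_pair] at ht
  rw [hi.unique isGLB_pair, ht.unique isLUB_pair]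
  exact IsModularLattice.sup_inf_le_assoc_of_le y hxz

section Family

variable {n : ℕ} {S : List (Implication (Fin n))}

theorem isModularFamily (hs : IsSimple S.toFinset)
    (hm : IsModularSemilattice (closedSets S.toFinset)) :
    IsModularFamily (closedSets S.toFinset) (implClosure S) := by
  set F := closedSets S.toFinset with hF
  set cl := implClosure S with hcl
  have hle := subset_implClosure S
  have closed : ∀ X ∈ F, cl X = X := fun X hX =>
    implClosure_eq_self S ((mem_closedSets_iff S).1 hX).1
  have min : ∀ {A X}, X ∈ F → A ⊆ X → cl A ⊆ X := fun {A X} hX hA =>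
    closed X hX ▸ implClosure_mono S hA
  have mem : ∀ A, ∀ X ∈ F, A ⊆ X → cl A ∈ F := fun A X hX hA =>
    (mem_closedSets_iff S).2 ⟨saturate_implClosure S A, fun I hI he hs =>
      ((mem_closedSets_iff S).1 hX).2 I hI he (hs.trans (min hX hA))⟩
  have inter : ∀ X ∈ F, ∀ Y ∈ F, X ∩ Y ∈ F := fun X hX Y hY I hI =>
    ⟨fun hne hs => Finset.subset_inter
      ((hX I hI).1 hne (hs.trans Finset.inter_subset_left))
      ((hY I hI).1 hne (hs.trans Finset.inter_subset_right)),
      fun he hs => (hX I hI).2 he (hs.trans Finset.inter_subset_left)⟩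
  -- Simplicity makes `closurePt F p` a member containing `p`; in particular some member contains
  -- `p`, so its closure is a member.
  have hpt : ∀ p, cl {p} = closurePt F p ∧ cl {p} ∈ F := by
    intro p
    obtain ⟨hX, -⟩ := hs.mapsTo (Set.mem_univ p)
    have hp : p ∈ closurePt F p := by simp [closurePt]
    have hmem : cl {p} ∈ F := mem _ _ hX (by simpa using hp)
    refine ⟨(min hX (by simpa using hp)).antisymm fun f hf => ?_, hmem⟩
    have hf' : ∀ X ∈ F, p ∈ X → f ∈ X := by simpa [closurePt] using hf
    exact hf' _ hmem (hle _ (by simp))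
  have hinj : ∀ p q, cl {p} = cl {q} → p = q := fun p q e =>
    hs.injOn (Set.mem_univ p) (Set.mem_univ q) (by rw [← (hpt p).1, ← (hpt q).1, e])
  have lub : ∀ {X Y : Finset (Fin n)} (hX : X ∈ F) (hY : Y ∈ F) (hj : cl (X ∪ Y) ∈ F),
      IsLUB {(⟨X, hX⟩ : F), ⟨Y, hY⟩} ⟨cl (X ∪ Y), hj⟩ := by
    intro X Y hX hY hj
    constructor
    · rintro _ (rfl | rfl)
      · exact Finset.subset_union_left.trans (hle _)
      · exact Finset.subset_union_right.trans (hle _)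
    · intro Z hZ
      exact min Z.2 (Finset.union_subset (hZ (by simp) : (⟨X, hX⟩ : F) ≤ Z)
        (hZ (by simp) : (⟨Y, hY⟩ : F) ≤ Z))
  refine ⟨hle, fun _ _ => implClosure_mono S,
    fun A => implClosure_eq_self S (saturate_implClosure S A), closed, mem, inter, ?_, ?_,
    fun p => (hpt p).2, ?_⟩
  · intro X hX Y hY Z hZ hXZ hW
    -- The modular law is used in the ideal below `W`. Its lattice operations are only known through
    -- the order, hence the passage to explicit bounds.
    set W : F := ⟨cl (Y ∪ Z), hW⟩ with hWdef
    have hYW : Y ⊆ cl (Y ∪ Z) := Finset.subset_union_left.trans (hle _)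
    have hZW : Z ⊆ cl (Y ∪ Z) := Finset.subset_union_right.trans (hle _)
    have sub : ∀ {A}, A ⊆ cl (Y ∪ Z) → cl A ⊆ cl (Y ∪ Z) := fun hA => min hW hA
    have hXYW := Finset.union_subset (hXZ.trans hZW) hYW
    have hYZ : Y ∩ Z ∈ F := inter Y hY Z hZ
    have hXYZ : X ∪ (Y ∩ Z) ⊆ cl (Y ∪ Z) :=
      Finset.union_subset (hXZ.trans hZW) (Finset.inter_subset_right.trans hZW)
    let mk : ∀ A : Finset (Fin n), A ∈ F → A ⊆ cl (Y ∪ Z) → Set.Iic W := fun A hA hs => ⟨⟨A, hA⟩, hs⟩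
    have le_iff : ∀ (A B : Set.Iic W), A ≤ B ↔ (A : F).1 ⊆ (B : F).1 := fun _ _ => Iff.rfl
    have h := le_of_exists_modular (hm.ideal_modular W) (x := mk X hX (hXZ.trans hZW))
      (y := mk Y hY hYW) (z := mk Z hZ hZW) (j := mk (cl (X ∪ Y)) (mem _ _ hW hXYW) (sub hXYW))
      (i := mk (cl (X ∪ Y) ∩ Z) (inter _ (mem _ _ hW hXYW) _ hZ)
        (Finset.inter_subset_right.trans hZW))
      (k := mk (Y ∩ Z) hYZ (Finset.inter_subset_right.trans hZW))
      (t := mk (cl (X ∪ (Y ∩ Z))) (mem _ _ hW hXYZ) (sub hXYZ))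
      hXZ ?_ ?_ ?_ ?_
    · exact h
    · refine ⟨?_, fun U hU => min (U : F).2 (Finset.union_subset
        ((le_iff _ _).1 (hU (by simp : mk X hX (hXZ.trans hZW) ∈ _)))
        ((le_iff _ _).1 (hU (by simp : mk Y hY hYW ∈ _))))⟩
      rintro _ (rfl | rfl)
      · exact Finset.subset_union_left.trans (hle _)
      · exact Finset.subset_union_right.trans (hle _)
    · refine ⟨?_, fun U hU => Finset.subset_inter
        ((le_iff _ _).1 (hU (by simp : mk (cl (X ∪ Y)) (mem _ _ hW hXYW) (sub hXYW) ∈ _)))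
        ((le_iff _ _).1 (hU (by simp : mk Z hZ hZW ∈ _)))⟩
      rintro _ (rfl | rfl)
      · exact Finset.inter_subset_left
      · exact Finset.inter_subset_right
    · refine ⟨?_, fun U hU => Finset.subset_inter
        ((le_iff _ _).1 (hU (by simp : mk Y hY hYW ∈ _)))
        ((le_iff _ _).1 (hU (by simp : mk Z hZ hZW ∈ _)))⟩
      rintro _ (rfl | rfl)
      · exact Finset.inter_subset_left
      · exact Finset.inter_subset_right
    · refine ⟨?_, fun U hU => min (U : F).2 (Finset.union_subset
        ((le_iff _ _).1 (hU (by simp : mk X hX (hXZ.trans hZW) ∈ _)))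
        ((le_iff _ _).1 (hU (by simp : mk (Y ∩ Z) hYZ (Finset.inter_subset_right.trans hZW) ∈ _))))⟩
      rintro _ (rfl | rfl)
      · exact Finset.subset_union_left.trans (hle _)
      · exact Finset.subset_union_right.trans (hle _)
  · intro X hX Y hY Z hZ h₁ h₂ h₃
    obtain ⟨j, hj, -⟩ := hm.join_exists ⟨X, hX⟩ ⟨Y, hY⟩ ⟨Z, hZ⟩ ⟨_, lub hX hY h₁⟩ ⟨_, lub hY hZ h₂⟩
      ⟨_, lub hZ hX h₃⟩
    exact mem _ _ j.2 (Finset.union_subset (Finset.union_subset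
      (hj (by simp) : (⟨X, hX⟩ : F) ≤ j) (hj (by simp) : (⟨Y, hY⟩ : F) ≤ j))
      (hj (by simp) : (⟨Z, hZ⟩ : F) ≤ j))
  · intro p
    obtain ⟨hX, hirr⟩ : cl {p} ∈ irreducibles F := by
      rw [(hpt p).1]
      exact hs.mapsTo (Set.mem_univ p)
    obtain ⟨Y, hY⟩ := not_isMin_iff.1 hirr.1
    obtain ⟨M, hM, -⟩ := exists_lowerCover Y.2 (show Y.1 ⊂ cl {p} from hY)
    -- Two different lower covers would have join `cl {p}`, against irreducibility.
    have below : ∀ y ∈ F, y ⊂ cl {p} → y ⊆ M := by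
      intro y hy hlt
      obtain ⟨M', hM', hyM'⟩ := exists_lowerCover hy hlt
      by_cases e : M' = M
      · exact e ▸ hyM'
      exfalso
      have hlub : IsLUB {(⟨M, hM.1⟩ : F), ⟨M', hM'.1⟩} ⟨cl {p}, hX⟩ := by
        constructor
        · rintro _ (rfl | rfl)
          · exact hM.2.1.1
          · exact hM'.2.1.1
        · intro U hU
          have h1 : M ⊆ U.1 := (hU (by simp) : (⟨M, hM.1⟩ : F) ≤ U)
          have h2 : M' ⊆ U.1 := (hU (by simp) : (⟨M', hM'.1⟩ : F) ≤ U)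
          have h3 := (hM.2.2 _ (inter _ U.2 _ hX) (Finset.subset_inter h1 hM.2.1.1)
            Finset.inter_subset_right).resolve_left fun e' =>
              e (hM'.eq_of_subset hM (e' ▸ Finset.subset_inter h2 hM'.2.1.1))
          exact Finset.inter_eq_right.1 h3
      rcases hirr.2 _ _ hlub with e' | e'
      · exact hM.2.1.ne (congrArg Subtype.val e').symm
      · exact hM'.2.1.ne (congrArg Subtype.val e').symm
    have hpM : p ∉ M := fun h' => hM.2.1.2 (min hM.1 (by simpa using h'))
    -- A point `q ≠ p` of `cl {p}` has a different closure by injectivity, so its closure is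
    -- properly smaller and lies in `M`.
    have : cl {p} \ {p} = M := by
      apply Finset.Subset.antisymm
      · intro q hq
        simp only [Finset.mem_sdiff, Finset.mem_singleton] at hq
        refine below _ (hpt q).2 (Finset.ssubset_iff_subset_ne.2 ⟨min hX (by simpa using hq.1),
          fun e => hq.2 (hinj q p e)⟩) (hle _ (by simp))
      · intro q hq
        simp only [Finset.mem_sdiff, Finset.mem_singleton]
        exact ⟨hM.2.1.1 hq, fun e => hpM (e ▸ hq)⟩
    rw [this]
    exact hM.1

end Family

section Output

variable {n : ℕ} (S : List (Implication (Fin n)))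

/-! ### Irredundant subsets, lowest elements and successors -/

/-- One pass suffices: a point that cannot be dropped from a set cannot be dropped from a smaller
one, by monotonicity of the closure. -/
theorem irredundant_spec (D : Finset (Fin n)) :
    irredundant S D ⊆ D ∧ D ⊆ implClosure S (irredundant S D) ∧
      ∀ q ∈ irredundant S D, ¬ D ⊆ implClosure S (irredundant S D \ {q}) := by
  have key : ∀ (l : List (Fin n)) (B : Finset (Fin n)), D ⊆ implClosure S B →
      let R := l.foldl (fun B q => if D ⊆ implClosure S (B \ {q}) then B \ {q} else B) B
      R ⊆ B ∧ D ⊆ implClosure S R ∧ ∀ q ∈ l, q ∈ R → ¬ D ⊆ implClosure S (R \ {q}) := by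
    intro l
    induction l with
    | nil => exact fun B hB => ⟨subset_rfl, hB, by simp⟩
    | cons q l ih =>
      intro B hB
      by_cases hq : D ⊆ implClosure S (B \ {q})
      · obtain ⟨h1, h2, h3⟩ := ih (B \ {q}) hq
        simp only [List.foldl_cons, if_pos hq]
        refine ⟨h1.trans Finset.sdiff_subset, h2, ?_⟩
        intro r hr hr'
        rcases List.mem_cons.1 hr with rfl | hr
        · simpa using h1 hr'
        · exact h3 r hr hr'
      · obtain ⟨h1, h2, h3⟩ := ih B hB
        simp only [List.foldl_cons, if_neg hq]
        refine ⟨h1, h2, ?_⟩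
        intro r hr hr'
        rcases List.mem_cons.1 hr with rfl | hr
        · exact fun h' => hq (h'.trans (implClosure_mono S (Finset.sdiff_subset_sdiff h1 subset_rfl)))
        · exact h3 r hr hr'
  obtain ⟨h1, h2, h3⟩ := key (List.finRange n) D (subset_implClosure S D)
  exact ⟨h1, h2, fun q hq => h3 q (List.mem_finRange q) hq⟩

theorem lowest_empty : lowest (∅ : Finset (Fin n)) = ∅ := by
  rw [lowest_eq_find, List.find?_eq_none.2 (by simp)]
  rfl

theorem lowest_card_le (X : Finset (Fin n)) : (lowest X).card ≤ 1 := by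
  rcases X.eq_empty_or_nonempty with rfl | hX
  · simp [lowest_empty]
  · obtain ⟨p, -, hp, -⟩ := exists_lowest hX
    simp [hp]

theorem lowest_subset (X : Finset (Fin n)) : lowest X ⊆ X := by
  rcases X.eq_empty_or_nonempty with rfl | hX
  · simp [lowest_empty]
  · obtain ⟨p, hpX, hp, -⟩ := exists_lowest hX
    simpa [hp] using hpX

theorem lowest_nonempty {X : Finset (Fin n)} (hX : X.Nonempty) : (lowest X).Nonempty := by
  obtain ⟨p, -, hp, -⟩ := exists_lowest hX
  simp [hp]

theorem next_card_le (U : Finset (Fin n)) (q : Fin n) : (next U q).card ≤ 1 := by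
  rw [next]; split_ifs <;> exact lowest_card_le _

theorem next_subset (U : Finset (Fin n)) (q : Fin n) : next U q ⊆ U := by
  rw [next]
  split_ifs
  · exact (lowest_subset _).trans (Finset.filter_subset _ _)
  · exact lowest_subset _

theorem next_nonempty {U : Finset (Fin n)} (hU : U.Nonempty) (q : Fin n) :
    (next U q).Nonempty := by
  rw [next]
  split_ifs with h
  · exact lowest_nonempty h
  · exact lowest_nonempty hU

/-- A set that contains an element of `U` and is closed under successors contains `U`. -/
theorem subset_of_next_subset {U X : Finset (Fin n)} {v : Fin n} (hv : v ∈ U) (hvX : v ∈ X)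
    (hnext : ∀ v ∈ U, v ∈ X → next U v ⊆ X) : U ⊆ X := by
  obtain ⟨m, hmU, hm, hmin⟩ := exists_lowest (⟨v, hv⟩ : U.Nonempty)
  -- The successor of the greatest element of `U ∩ X` is in `X`, so it cannot be greater: it wraps
  -- around to the least element of `U`.
  have hmX : m ∈ X := by
    set t := (U ∩ X).max' ⟨v, Finset.mem_inter.2 ⟨hv, hvX⟩⟩ with ht
    have htm := Finset.mem_inter.1 ((U ∩ X).max'_mem ⟨v, Finset.mem_inter.2 ⟨hv, hvX⟩⟩)
    have h1 := hnext t htm.1 htm.2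
    rw [next] at h1
    split_ifs at h1 with hne
    · obtain ⟨s, hs, hs', -⟩ := exists_lowest hne
      rw [hs', Finset.singleton_subset_iff] at h1
      rw [Finset.mem_filter] at hs
      exact absurd hs.2 (not_lt.2 (Finset.le_max' _ _ (Finset.mem_inter.2 ⟨hs.1, h1⟩)))
    · simpa [hm] using h1
  by_contra hsub
  obtain ⟨w, hw, -, hwmin⟩ := exists_lowest (Finset.sdiff_nonempty.2 hsub)
  rw [Finset.mem_sdiff] at hw
  have hne : (U.filter (· < w)).Nonempty := ⟨m, by
    rw [Finset.mem_filter]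
    exact ⟨hmU, lt_of_le_of_ne (hmin w hw.1) fun e => hw.2 (e ▸ hmX)⟩⟩
  -- The predecessor in `U` of the least missing element `w` is in `X`, and its successor is `w`.
  set t := (U.filter (· < w)).max' hne with ht
  have htm := Finset.mem_filter.1 ((U.filter (· < w)).max'_mem hne)
  have htX : t ∈ X := by
    by_contra htX
    exact absurd htm.2 (not_lt.2 (hwmin t (Finset.mem_sdiff.2 ⟨htm.1, htX⟩)))
  have h1 := hnext t htm.1 htX
  have hne' : (U.filter (t < ·)).Nonempty := ⟨w, Finset.mem_filter.2 ⟨hw.1, htm.2⟩⟩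
  obtain ⟨s, hs, hs', hsmin⟩ := exists_lowest hne'
  rw [next, if_pos hne', hs', Finset.singleton_subset_iff] at h1
  have hsw := hsmin w (Finset.mem_filter.2 ⟨hw.1, htm.2⟩)
  rw [Finset.mem_filter] at hs
  have hlt : s < w := lt_of_le_of_ne hsw fun e => hw.2 (e ▸ h1)
  exact absurd hs.2 (not_lt.2 (Finset.le_max' _ _ (Finset.mem_filter.2 ⟨hs.1, hlt⟩)))

/-! ### The output as a list -/

theorem foldl_push {α β : Type*} (P : α → Prop) [DecidablePred P] (g : α → β) (l : List α)
    (acc : List β) : l.foldl (fun acc a => if P a then g a :: acc else acc) acc =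
      ((l.filter P).map g).reverse ++ acc := by
  induction l generalizing acc with
  | nil => rfl
  | cons a l ih =>
    rw [List.foldl_cons, ih]
    by_cases h : P a <;> simp [h]

open Classical in
theorem optimalBase_eq : optimalBase S =
    (((List.finRange n ×ˢ List.finRange n).filter fun s => IsSelected S s.1 s.2).map
      fun s => ({s.1} ∪ {s.2}, conclusion S s.1 s.2)).reverse ++
    (((List.finRange n).filter fun p => (irredundant S (below S p)).Nonempty).map
      fun p => ({p}, irredundant S (below S p))).reverse := by
  have h₁ := foldl_push (fun p => (irredundant S (below S p)).Nonempty)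
    (fun p => (({p} : Finset (Fin n)), irredundant S (below S p))) (List.finRange n) []
  rw [List.append_nil] at h₁
  rw [← h₁, ← foldl_push, optimalBase, singleImplications]
  simp only [SProd.sprod, List.product, List.foldl_flatMap, List.foldl_map]

theorem mem_optimalBase {I : Implication (Fin n)} : I ∈ optimalBase S ↔
    (∃ p q, IsSelected S p q ∧ I = ({p} ∪ {q}, conclusion S p q)) ∨
    ∃ p, (irredundant S (below S p)).Nonempty ∧ I = ({p}, irredundant S (below S p)) := by
  classical
  rw [optimalBase_eq]
  simp [eq_comm, SProd.sprod]

theorem optimalBase_nodup : (optimalBase S).Nodup := by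
  classical
  rw [optimalBase_eq, List.nodup_append]
  refine ⟨?_, ?_, ?_⟩
  · rw [List.nodup_reverse]
    refine List.Nodup.map_on ?_
      (((List.nodup_finRange n).product (List.nodup_finRange n)).filter _)
    rintro ⟨p, q⟩ hp ⟨p', q'⟩ hp' e
    simp only [List.mem_filter, decide_eq_true_eq] at hp hp'
    have h1 : ({p} ∪ {q} : Finset (Fin n)) = {p'} ∪ {q'} := congrArg Prod.fst e
    have e₁ := hp.2.1
    have e₂ := hp'.2.1
    have l1 := (lowest_eq_singleton (X := {p} ∪ {q}) (p := p)).2 (by simp [e₁.le])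
    have l2 := (lowest_eq_singleton (X := {p'} ∪ {q'}) (p := p')).2 (by simp [e₂.le])
    rw [h1, l2] at l1
    have hpp : p' = p := by simpa using l1
    subst hpp
    have : q ∈ ({p'} ∪ {q'} : Finset (Fin n)) := h1 ▸ by simp
    simp only [Finset.mem_union, Finset.mem_singleton] at this
    rw [this.resolve_left e₁.ne']
  · rw [List.nodup_reverse]
    refine List.Nodup.map_on ?_ ((List.nodup_finRange n).filter _)
    intro p _ q _ e
    simpa using congrArg Prod.fst e
  · intro I hI J hJ e
    simp only [List.mem_reverse, List.mem_map, List.mem_filter, decide_eq_true_eq] at hI hJ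
    obtain ⟨⟨p, q⟩, ⟨-, hpq⟩, rfl⟩ := hI
    obtain ⟨r, -, rfl⟩ := hJ
    have h1 : ({p} ∪ {q} : Finset (Fin n)) = {r} := congrArg Prod.fst e
    have h2 := congrArg Finset.card h1
    rw [← Finset.insert_eq, Finset.card_pair hpq.1.ne, Finset.card_singleton] at h2
    omega

open Classical in
theorem famSize_optimalBase_le : famSize (optimalBase S).toFinset ≤
    (∑ s : Fin n × Fin n with IsSelected S s.1 s.2, (2 + (conclusion S s.1 s.2).card)) +
    ∑ p : Fin n with (irredundant S (below S p)).Nonempty,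
      (1 + (irredundant S (below S p)).card) := by
  have e : (optimalBase S).toFinset =
      (Finset.univ.filter fun s : Fin n × Fin n => IsSelected S s.1 s.2).image
        (fun s => (({s.1} ∪ {s.2} : Finset (Fin n)), conclusion S s.1 s.2)) ∪
      (Finset.univ.filter fun p => (irredundant S (below S p)).Nonempty).image
        (fun p => (({p} : Finset (Fin n)), irredundant S (below S p))) := by
    ext I
    simp [mem_optimalBase, eq_comm]
  rw [famSize, e]
  refine (Finset.sum_union_inter (f := fun I : Implication (Fin n) => I.1.card + I.2.card)
    ▸ Nat.le_add_right _ _ : _ ≤ _).trans (add_le_add ?_ ?_)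
  · refine (Finset.sum_image_le_of_nonneg fun _ _ => Nat.zero_le _).trans
      (Finset.sum_le_sum fun s _ => ?_)
    have := Finset.card_union_le ({s.1} : Finset (Fin n)) {s.2}
    simp only [Finset.card_singleton] at this
    simpa using this
  · refine (Finset.sum_image_le_of_nonneg fun _ _ => Nat.zero_le _).trans
      (Finset.sum_le_sum fun p _ => ?_)
    simp

end Output

/-! ### The output is a base -/

section Base

variable {n : ℕ} {S : List (Implication (Fin n))}
  (h : IsModularFamily (closedSets S.toFinset) (implClosure S)) {p q : Fin n}

theorem side_eq_flank (S : List (Implication (Fin n))) (p q : Fin n) :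
    side S p q = flank (implClosure S) p q := rfl

theorem conclusion_of_not_mem (hx : implClosure S ({p} ∪ {q}) ∉ closedSets S.toFinset) :
    conclusion S p q = ∅ := by
  exact if_neg hx

theorem conclusion_card_le : (conclusion S p q).card ≤ 1 := by
  simp only [conclusion]
  split_ifs
  · exact next_card_le _ _
  · exact lowest_card_le _
  · simp

include h

theorem conclusion_spec (hs : IsSelected S p q)
    (hx : implClosure S ({p} ∪ {q}) ∈ closedSets S.toFinset) :
    (conclusion S p q).Nonempty ∧ conclusion S p q ⊆ implClosure S ({p} ∪ {q}) := by
  obtain ⟨-, hc, h1, h2⟩ := hs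
  set x := implClosure S ({p} ∪ {q}) with hxdef
  have hl : OnLine (closedSets S.toFinset) (implClosure S) (side S p q ∩ side S q p) x p q :=
    ⟨hc, rfl, rfl⟩
  have hpx : p ∈ x := h.le_cl _ (by simp)
  have hqx : q ∈ x := h.le_cl _ (by simp)
  have hpd : p ∉ side S p q ∩ side S q p := fun h' =>
    h.not_mem_flank hc (Finset.mem_inter.1 h').2
  have hqa : q ∉ side S p q := h.not_mem_flank (CriticalPair.symm hc)
  simp only [conclusion, ← hxdef, if_pos hx, Finset.sdiff_sdiff_self_left]
  split_ifs with hm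
  · have hq : q ∈ representatives S x (side S p q) (side S p q ∩ side S q p) := by
      simp only [representatives, Finset.mem_filter, Finset.mem_sdiff]
      refine ⟨⟨hqx, hqa⟩, ?_⟩
      rw [IsModularFamily.OnLine.cl_union h hl.symm, ← side_eq_flank,
        show side S q p \ (side S p q ∩ side S q p) = side S q p \ side S p q by simp, h2]
    exact ⟨next_nonempty ⟨q, hq⟩ _, (next_subset _ _).trans
      ((Finset.filter_subset _ _).trans Finset.sdiff_subset)⟩
  · exact ⟨lowest_nonempty ⟨p, Finset.mem_sdiff.2 ⟨hpx, hpd⟩⟩,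
      (lowest_subset _).trans Finset.sdiff_subset⟩

/-- Two representatives in `X` produce the least point `m` of the line. From `m` and any other
representative, the cyclic rule runs through all representatives outside the class of `m`. -/
theorem representatives_subset {d x X : Finset (Fin n)}
    (hX : X ∈ closedSets (optimalBase S).toFinset) (hx : x ∈ closedSets S.toFinset)
    (hl : OnLine (closedSets S.toFinset) (implClosure S) d x p q)
    (ha : flank (implClosure S) p q ⊆ X) (hb : flank (implClosure S) q p ⊆ X) {r : Fin n}
    (hrx : r ∈ x) (hrd : r ∉ d) (hr : lowest (implClosure S (d ∪ {r}) \ d) = {r}) : r ∈ X := by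
  set cl := implClosure S with hcl
  set F := closedSets S.toFinset with hF
  have hdF := IsModularFamily.OnLine.mem h hl
  -- classes
  have self : ∀ u : Fin n, u ∈ cl (d ∪ {u}) := fun u => h.le_cl _ (by simp)
  have eq_of_mem : ∀ u ∈ x, u ∉ d → ∀ v ∈ cl (d ∪ {u}), v ∉ d → cl (d ∪ {v}) = cl (d ∪ {u}) := by
    intro u hu hud v hv hvd
    obtain ⟨s, hs⟩ := IsModularFamily.OnLine.partner h hl hx hu hud
    rw [IsModularFamily.OnLine.cl_union h hs] at hv ⊢
    exact IsModularFamily.OnLine.eq_of_mem h hs hv hvd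
  have class_subset : ∀ u ∈ x, u ∉ d → cl (d ∪ {u}) ⊆ x := by
    intro u hu hud
    obtain ⟨s, hs⟩ := IsModularFamily.OnLine.partner h hl hx hu hud
    rw [IsModularFamily.OnLine.cl_union h hs]
    exact IsModularFamily.OnLine.flank_subset h hs hx
  -- pairs of representatives
  have pair : ∀ u ∈ x, u ∉ d → lowest (cl (d ∪ {u}) \ d) = {u} → ∀ v ∈ x, v ∉ d →
      lowest (cl (d ∪ {v}) \ d) = {v} → u < v → v ∉ cl (d ∪ {u}) ∧
      (u ∈ X → v ∈ X → (if lowest (x \ d) = {u} then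
        next (representatives S x (cl (d ∪ {u})) d) v else lowest (x \ d)) ⊆ X) := by
    intro u hu hud hul v hv hvd hvl huv
    have hne : v ∉ cl (d ∪ {u}) := fun h' => by
      rw [eq_of_mem u hu hud v h' hvd, hul] at hvl
      exact huv.ne (by simpa using hvl)
    refine ⟨hne, fun huX hvX => ?_⟩
    have hl' := IsModularFamily.OnLine.pair h hl hx hu hv hud hvd hne
    have e₁ := IsModularFamily.OnLine.cl_union h hl'
    have e₂ := IsModularFamily.OnLine.cl_union h hl'.symm
    have e₃ : flank cl u v \ flank cl v u = flank cl u v \ d := by rw [← hl'.2.2]; simp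
    have e₄ : flank cl v u \ flank cl u v = flank cl v u \ d := by rw [← hl'.2.2]; simp
    have hsel : IsSelected S u v := by
      refine ⟨huv, hl'.1, ?_, ?_⟩
      · rw [side_eq_flank, side_eq_flank, ← hcl, e₃, ← e₁, hul]
      · rw [side_eq_flank, side_eq_flank, ← hcl, e₄, ← e₂, hvl]
    have hcon : conclusion S u v = if lowest (x \ d) = {u} then
        next (representatives S x (cl (d ∪ {u})) d) v else lowest (x \ d) := by
      simp only [conclusion, Finset.sdiff_sdiff_self_left]
      rw [side_eq_flank, side_eq_flank, ← hcl, hl'.2.1, if_pos hx, hl'.2.2, e₁]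
    rw [← hcon]
    refine (hX ({u} ∪ {v}, conclusion S u v) ?_).1 ?_ ?_
    · rw [List.mem_toFinset, mem_optimalBase]
      exact .inl ⟨u, v, hsel, rfl⟩
    · exact (conclusion_spec h hsel (show cl ({u} ∪ {v}) ∈ F by rwa [hl'.2.1])).1
    · exact Finset.union_subset (by simpa using huX) (by simpa using hvX)
  -- representatives of classes
  have rep : ∀ u ∈ x, u ∉ d → ∃ v ∈ cl (d ∪ {u}), v ∈ x ∧ v ∉ d ∧ cl (d ∪ {v}) = cl (d ∪ {u}) ∧
      lowest (cl (d ∪ {v}) \ d) = {v} := by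
    intro u hu hud
    obtain ⟨v, hv, hvl, -⟩ := exists_lowest ⟨u, Finset.mem_sdiff.2 ⟨self u, hud⟩⟩
    rw [Finset.mem_sdiff] at hv
    have e := eq_of_mem u hu hud v hv.1 hv.2
    exact ⟨v, hv.1, class_subset u hu hud hv.1, hv.2, e, e ▸ hvl⟩
  have hpx : p ∈ x := hl.2.1 ▸ h.le_cl _ (by simp)
  have hqx : q ∈ x := hl.2.1 ▸ h.le_cl _ (by simp)
  have hpd : p ∉ d := fun h' => h.not_mem_flank hl.1 (Finset.mem_inter.1 (hl.2.2 ▸ h')).2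
  have hqd : q ∉ d := fun h' => h.not_mem_flank hl.1.symm (Finset.mem_inter.1 (hl.2.2 ▸ h')).1
  obtain ⟨m, hm, hml, hmin⟩ := exists_lowest (X := x \ d) ⟨p, Finset.mem_sdiff.2 ⟨hpx, hpd⟩⟩
  rw [Finset.mem_sdiff] at hm
  have hmrep : lowest (cl (d ∪ {m}) \ d) = {m} := lowest_eq_singleton.2
    ⟨Finset.mem_sdiff.2 ⟨self m, hm.2⟩, fun t ht => hmin t
      (Finset.sdiff_subset_sdiff (class_subset m hm.1 hm.2) subset_rfl ht)⟩
  have start : ∀ u ∈ x, u ∉ d → lowest (cl (d ∪ {u}) \ d) = {u} → ∀ v ∈ x, v ∉ d →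
      lowest (cl (d ∪ {v}) \ d) = {v} → u < v → u ∈ X → v ∈ X →
      m ∈ X ∧ ∃ w ∈ representatives S x (cl (d ∪ {m})) d, w ∈ X := by
    intro u hu hud hul v hv hvd hvl huv huX hvX
    have hmX : m ∈ X := by
      by_cases e : m = u
      · exact e ▸ huX
      have := (pair u hu hud hul v hv hvd hvl huv).2 huX hvX
      rw [if_neg (by rw [hml]; simpa using e), hml] at this
      simpa using this
    refine ⟨hmX, v, ?_, hvX⟩
    have hmv : m < v := (hmin u (Finset.mem_sdiff.2 ⟨hu, hud⟩)).trans_lt huv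
    simp only [representatives, Finset.mem_filter, Finset.mem_sdiff]
    exact ⟨⟨hv, (pair m hm.1 hm.2 hmrep v hv hvd hvl hmv).1⟩, hvl⟩
  obtain ⟨hmX, w, hw, hwX⟩ : m ∈ X ∧ ∃ w ∈ representatives S x (cl (d ∪ {m})) d, w ∈ X := by
    obtain ⟨u, hu, hux, hud, eu, hul⟩ := rep p hpx hpd
    obtain ⟨v, hv, hvx, hvd, ev, hvl⟩ := rep q hqx hqd
    have huX : u ∈ X := ha (IsModularFamily.OnLine.cl_union h hl ▸ hu)
    have hvX : v ∈ X := hb (IsModularFamily.OnLine.cl_union h hl.symm ▸ hv)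
    rcases lt_trichotomy u v with hlt | rfl | hlt
    · exact start u hux hud hul v hvx hvd hvl hlt huX hvX
    · refine absurd ?_ (h.not_mem_flank hl.1)
      rw [← IsModularFamily.OnLine.cl_union h hl.symm, ← ev, eu]
      exact self p
    · exact start v hvx hvd hvl u hux hud hul hlt hvX huX
  have hU : representatives S x (cl (d ∪ {m})) d ⊆ X := by
    refine subset_of_next_subset hw hwX fun v hv hvX => ?_
    simp only [representatives, Finset.mem_filter, Finset.mem_sdiff] at hv
    obtain ⟨⟨hvx, hvm⟩, hvl⟩ := hv
    have hvd : v ∉ d := fun h' => hvm (h.le_cl _ (Finset.mem_union_left _ h'))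
    have hmv : m < v := lt_of_le_of_ne (hmin v (Finset.mem_sdiff.2 ⟨hvx, hvd⟩))
      fun e => hvm (e ▸ self m)
    have := (pair m hm.1 hm.2 hmrep v hvx hvd hvl hmv).2 hmX hvX
    rwa [if_pos hml] at this
  by_cases e : r = m
  · exact e ▸ hmX
  have hmr : m < r := lt_of_le_of_ne (hmin r (Finset.mem_sdiff.2 ⟨hrx, hrd⟩)) (Ne.symm e)
  refine hU ?_
  simp only [representatives, Finset.mem_filter, Finset.mem_sdiff]
  exact ⟨⟨hrx, (pair m hm.1 hm.2 hmrep r hrx hrd hr hmr).1⟩, hr⟩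

theorem optimalBase_isImplBase (hE : ∅ ∈ closedSets S.toFinset) :
    IsImplBase (optimalBase S).toFinset (closedSets S.toFinset) := by
  apply Set.Subset.antisymm
  · intro X hX
    refine h.mem_of_generated hE ?_ ?_ ?_
    · intro p hp
      obtain ⟨h1, h2, -⟩ := irredundant_spec S (below S p)
      refine ⟨irredundant S (below S p), ?_, h1, h2⟩
      rcases (irredundant S (below S p)).eq_empty_or_nonempty with he | hne
      · simp [he]
      · refine (hX ({p}, irredundant S (below S p)) ?_).1 hne (by simpa using hp)
        rw [List.mem_toFinset, mem_optimalBase]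
        exact .inr ⟨p, hne, rfl⟩
    · intro d x p q hx hl ha hb r hr hrd
      obtain ⟨s, hs⟩ := IsModularFamily.OnLine.partner h hl hx hr hrd
      have e := IsModularFamily.OnLine.cl_union h hs
      obtain ⟨u, hu, hul, -⟩ := exists_lowest (X := implClosure S (d ∪ {r}) \ d)
        ⟨r, Finset.mem_sdiff.2 ⟨h.le_cl _ (by simp), hrd⟩⟩
      rw [Finset.mem_sdiff] at hu
      have hux : u ∈ x := IsModularFamily.OnLine.flank_subset h hs hx (e ▸ hu.1)
      have hue := IsModularFamily.OnLine.eq_of_mem h hs (e ▸ hu.1) hu.2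
      refine ⟨u, representatives_subset h hX hx hl ha hb hux hu.2 ?_, hu.2, hu.1⟩
      rw [hue, ← e, hul]
    · intro p q hc hpq ha hb
      -- By exchange, the least points on both sides form a critical pair of the same class; up to
      -- order it is the selected one.
      obtain ⟨u, hu, hul, -⟩ := exists_lowest
        (X := flank (implClosure S) p q \ flank (implClosure S) q p)
        ⟨p, Finset.mem_sdiff.2 ⟨h.mem_flank p q, h.not_mem_flank hc⟩⟩
      obtain ⟨v, hv, hvl, -⟩ := exists_lowest
        (X := flank (implClosure S) q p \ flank (implClosure S) p q)
        ⟨q, Finset.mem_sdiff.2 ⟨h.mem_flank q p, h.not_mem_flank hc.symm⟩⟩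
      rw [Finset.mem_sdiff] at hu hv
      obtain ⟨e₁, e₂, hc'⟩ := h.exchange hc hu.1 hu.2 hv.1 hv.2
      have hnF := h.exchange_not_mem hc hpq hu.1 hu.2 hv.1 hv.2
      have violated : ∀ u v, IsSelected S u v →
          implClosure S ({u} ∪ {v}) ∉ closedSets S.toFinset → u ∈ X → v ∈ X → False := by
        intro u v hs hnF hu hv
        refine (hX ({u} ∪ {v}, conclusion S u v) ?_).2 (conclusion_of_not_mem hnF)
          (Finset.union_subset (by simpa using hu) (by simpa using hv))
        rw [List.mem_toFinset, mem_optimalBase]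
        exact .inl ⟨u, v, hs, rfl⟩
      have hl₁ : lowest (side S u v \ side S v u) = {u} := by
        rw [side_eq_flank, side_eq_flank, e₁, e₂, hul]
      have hl₂ : lowest (side S v u \ side S u v) = {v} := by
        rw [side_eq_flank, side_eq_flank, e₁, e₂, hvl]
      rcases lt_trichotomy u v with hlt | rfl | hlt
      · exact violated u v ⟨hlt, hc', hl₁, hl₂⟩ hnF (ha hu.1) (hb hv.1)
      · exact hu.2 hv.1
      · exact violated v u ⟨hlt, hc'.symm, hl₂, hl₁⟩ (by rwa [Finset.union_comm]) (hb hv.1)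
          (ha hu.1)
  · intro X hX I hI
    rw [List.mem_toFinset, mem_optimalBase] at hI
    rcases hI with ⟨p, q, hs, rfl⟩ | ⟨p, hne, rfl⟩
    · by_cases hx : implClosure S ({p} ∪ {q}) ∈ closedSets S.toFinset
      · obtain ⟨h1, h2⟩ := conclusion_spec h hs hx
        exact ⟨fun _ hpq => h2.trans (h.cl_subset hX hpq), fun he => absurd he h1.ne_empty⟩
      · have he := conclusion_of_not_mem hx
        exact ⟨fun hne => absurd he hne.ne_empty, fun _ hpq => hx (h.mem_of_subset _ X hX hpq)⟩
    · refine ⟨fun _ hp => ?_, fun he => absurd he hne.ne_empty⟩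
      exact (irredundant_spec S (below S p)).1.trans
        (h.lower_subset_of_mem hX (by simpa using hp))

/-! ### The output is optimal -/

theorem famSize_le_of_isImplBase {T : Finset (Implication (Fin n))}
    (hT : IsImplBase T (closedSets S.toFinset)) :
    famSize (optimalBase S).toFinset ≤ famSize T := by
  classical
  refine (famSize_optimalBase_le S).trans ?_
  set cl := implClosure S with hcl
  set F := closedSets S.toFinset with hF
  set K₁ : Fin n × Fin n → Finset (Implication (Fin n)) := fun s => T.filter fun I =>
    I.1 ⊆ flank cl s.1 s.2 ∪ flank cl s.2 s.1 ∧ ¬ I.1 ⊆ flank cl s.1 s.2 ∧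
      ¬ I.1 ⊆ flank cl s.2 s.1 with hK₁
  set K₂ : Fin n → Finset (Implication (Fin n)) := fun p => T.filter fun I =>
    p ∈ I.1 ∧ I.1 ⊆ cl {p} with hK₂
  set P₁ := Finset.univ.filter fun s : Fin n × Fin n => IsSelected S s.1 s.2 with hP₁
  set P₂ := Finset.univ.filter fun p => (irredundant S (below S p)).Nonempty with hP₂
  have size₁ : ∀ s ∈ P₁, 2 + (conclusion S s.1 s.2).card ≤ ∑ I ∈ K₁ s, (I.1.card + I.2.card) := by
    rintro ⟨p, q⟩ hs
    obtain ⟨I, hI, h1, h2, h3, h4, h5⟩ :=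
      h.exists_critical_premise hT (Finset.mem_filter.1 hs).2.2.1
    have hIK : I ∈ K₁ (p, q) := Finset.mem_filter.2 ⟨hI, h1, h2, h3⟩
    refine le_trans ?_ (Finset.single_le_sum
      (f := fun I : Implication (Fin n) => I.1.card + I.2.card) (fun _ _ => Nat.zero_le _) hIK)
    refine add_le_add h4 ?_
    by_cases hx : cl ({p} ∪ {q}) ∈ F
    · exact conclusion_card_le.trans (h5 hx)
    · simp [conclusion_of_not_mem hx]
  have size₂ : ∀ p ∈ P₂, 1 + (irredundant S (below S p)).card ≤
      ∑ I ∈ K₂ p, (I.1.card + I.2.card) := by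
    intro p hp
    obtain ⟨h1, h2, h3⟩ := irredundant_spec S (below S p)
    exact h.card_le_sum_single hT (Finset.mem_filter.1 hp).2 h1 h2 h3
  have split : ∀ {p q : Fin n} {I : Implication (Fin n)}, I ∈ K₁ (p, q) →
      ∃ u ∈ I.1, ∃ v ∈ I.1, u ∈ flank cl p q ∧ u ∉ flank cl q p ∧ v ∈ flank cl q p ∧
        v ∉ flank cl p q := by
    intro p q I hI
    obtain ⟨-, h1, h2, h3⟩ := Finset.mem_filter.1 hI
    obtain ⟨u, hu, hu'⟩ := Finset.not_subset.1 h3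
    obtain ⟨v, hv, hv'⟩ := Finset.not_subset.1 h2
    exact ⟨u, hu, v, hv, (Finset.mem_union.1 (h1 hu)).resolve_right hu', hu',
      (Finset.mem_union.1 (h1 hv)).resolve_left hv', hv'⟩
  have disj₁ : (P₁ : Set (Fin n × Fin n)).PairwiseDisjoint K₁ := by
    rintro ⟨p, q⟩ hs ⟨p', q'⟩ hs' hne
    simp only [hP₁, Finset.coe_filter, Finset.mem_univ, true_and, Set.mem_ofPred_eq] at hs hs'
    obtain ⟨hlt, hc, hl₁, hl₂⟩ := hs
    obtain ⟨hlt', hc', hl₁', hl₂'⟩ := hs'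
    refine Finset.disjoint_left.2 fun I hI hI' => hne ?_
    obtain ⟨u, hu, v, hv, hu1, hu2, hv1, hv2⟩ := split hI
    obtain ⟨e₁, e₂, -⟩ := h.exchange hc hu1 hu2 hv1 hv2
    obtain ⟨-, h1, h2, h3⟩ := Finset.mem_filter.1 hI
    obtain ⟨-, h1', h2', h3'⟩ := Finset.mem_filter.1 hI'
    -- A member with `u` and `v` contains both flanks and so the whole premise. Hence `u` and `v`
    -- lie on different sides of the second pair as well, so both pairs have the same flanks up to
    -- order, hence the same least points. The condition `p < q` excludes the reversed order.
    have notboth : ∀ X ∈ F, u ∈ X → v ∈ X → I.1 ⊆ X := by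
      intro X hX huX hvX
      have hs₁ := h.flank_subset_of_join hX huX hvX
      have hs₂ := h.flank_subset_of_join hX hvX huX
      rw [e₁] at hs₁
      rw [e₂] at hs₂
      exact h1.trans (Finset.union_subset hs₁ hs₂)
    have hu' := Finset.mem_union.1 (h1' hu)
    have hv' := Finset.mem_union.1 (h1' hv)
    by_cases hup : u ∈ flank cl p' q'
    · have hvp : v ∉ flank cl p' q' := fun h' => h2' (notboth _ hc'.1 hup h')
      have hvq := hv'.resolve_left hvp
      have huq : u ∉ flank cl q' p' := fun h' => h3' (notboth _ hc'.2.1 h' hvq)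
      obtain ⟨e₁', e₂', -⟩ := h.exchange hc' hup huq hvq hvp
      rw [side_eq_flank, side_eq_flank, ← hcl] at hl₁ hl₁' hl₂ hl₂'
      rw [← e₁, ← e₂] at hl₁ hl₂
      rw [← e₁', ← e₂'] at hl₁' hl₂'
      rw [hl₁] at hl₁'
      rw [hl₂] at hl₂'
      exact Prod.ext (by simpa using hl₁') (by simpa using hl₂')
    · have huq := hu'.resolve_left hup
      have hvq : v ∉ flank cl q' p' := fun h' => h3' (notboth _ hc'.2.1 huq h')
      have hvp := hv'.resolve_right hvq
      obtain ⟨e₁', e₂', -⟩ := h.exchange hc' hvp hvq huq hup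
      rw [side_eq_flank, side_eq_flank, ← hcl] at hl₁ hl₁' hl₂ hl₂'
      rw [← e₁, ← e₂] at hl₁ hl₂
      rw [← e₁', ← e₂'] at hl₁' hl₂'
      rw [hl₁] at hl₂'
      rw [hl₂] at hl₁'
      have e₃ : p = q' := by simpa using hl₂'
      have e₄ : q = p' := by simpa using hl₁'
      rw [e₃, e₄] at hlt
      exact absurd hlt hlt'.not_gt
  have disj₂ : (P₂ : Set (Fin n)).PairwiseDisjoint K₂ := by
    intro p _ q _ hne
    refine Finset.disjoint_left.2 fun I hI hI' => hne ?_
    obtain ⟨-, h1, h2⟩ := Finset.mem_filter.1 hI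
    obtain ⟨-, h1', h2'⟩ := Finset.mem_filter.1 hI'
    exact h.cl_point_injective ((h.cl_point_subset (h.point_mem q) (h2' h1)).antisymm
      (h.cl_point_subset (h.point_mem p) (h2 h1')))
  -- A premise inside the closure of one of its own points lies in any flank that contains this
  -- point, so it cannot separate two flanks.
  have disj : Disjoint (P₁.biUnion K₁) (P₂.biUnion K₂) := by
    refine Finset.disjoint_left.2 fun I hI hI' => ?_
    obtain ⟨⟨p, q⟩, hs, hI⟩ := Finset.mem_biUnion.1 hI
    obtain ⟨r, -, hI'⟩ := Finset.mem_biUnion.1 hI'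
    have hc := (Finset.mem_filter.1 hs).2.2.1
    obtain ⟨-, h1, h2, h3⟩ := Finset.mem_filter.1 hI
    obtain ⟨-, hr, hr'⟩ := Finset.mem_filter.1 hI'
    rcases Finset.mem_union.1 (h1 hr) with h' | h'
    · exact h2 (hr'.trans (h.cl_point_subset hc.1 h'))
    · exact h3 (hr'.trans (h.cl_point_subset hc.2.1 h'))
  calc _ ≤ ∑ s ∈ P₁, ∑ I ∈ K₁ s, (I.1.card + I.2.card) +
        ∑ p ∈ P₂, ∑ I ∈ K₂ p, (I.1.card + I.2.card) :=
        add_le_add (Finset.sum_le_sum size₁) (Finset.sum_le_sum size₂)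
    _ = ∑ I ∈ P₁.biUnion K₁ ∪ P₂.biUnion K₂, (I.1.card + I.2.card) := by
        rw [Finset.sum_union disj, Finset.sum_biUnion disj₁, Finset.sum_biUnion disj₂]
    _ ≤ famSize T := Finset.sum_le_sum_of_subset (Finset.union_subset
        (Finset.biUnion_subset.2 fun _ _ => Finset.filter_subset _ _)
        (Finset.biUnion_subset.2 fun _ _ => Finset.filter_subset _ _))

end Base

/-! ### The main result -/

theorem algorithmOutput_spec {n : ℕ} {S : List (Implication (Fin n))} (hnd : S.Nodup)
    (hs : IsSimple S.toFinset) (hm : IsModularSemilattice (closedSets S.toFinset)) :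
    (algorithmOutput S).Nodup ∧
      IsOptimalBase (algorithmOutput S).toFinset (closedSets S.toFinset) := by
  rw [algorithmOutput]
  split_ifs with hn
  · subst hn
    refine ⟨hnd, rfl, fun T _ => ?_⟩
    have : famSize S.toFinset = 0 := by
      refine Finset.sum_eq_zero fun I _ => ?_
      simp [Finset.eq_empty_of_isEmpty]
    omega
  · have h := isModularFamily hs hm
    have hE := h.empty_mem (h.point_mem ⟨0, Nat.pos_of_ne_zero hn⟩)
    exact ⟨optimalBase_nodup S, optimalBase_isImplBase h hE, fun T => famSize_le_of_isImplBase h⟩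

/-- All implications but the empty one have positive size. -/
theorem length_le_famSize_add_one {n : ℕ} {S : List (Implication (Fin n))} (hnd : S.Nodup) :
    S.length ≤ famSize S.toFinset + 1 := by
  rw [← List.toFinset_card_of_nodup hnd]
  have h1 := Finset.card_le_card_sdiff_add_card (s := S.toFinset) (t := {(∅, ∅)})
  rw [Finset.card_singleton] at h1
  refine h1.trans (Nat.add_le_add_right ?_ 1)
  rw [Finset.card_eq_sum_ones]
  refine (Finset.sum_le_sum fun I hI => ?_).trans
    (Finset.sum_le_sum_of_subset (Finset.sdiff_subset (s := S.toFinset) (t := {(∅, ∅)})))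
  simp only [Finset.mem_sdiff, Finset.mem_singleton] at hI
  by_contra hlt
  have h2 : I.1.card = 0 ∧ I.2.card = 0 := by omega
  exact hI.2 (Prod.ext (Finset.card_eq_zero.1 h2.1) (Finset.card_eq_zero.1 h2.2))

end ImplBase

theorem mainTheorem8 :
    ∃ (c : Program) (p : Polynomial ℕ),
      ∀ (n : ℕ) (S : List (Implication (Fin n))),
        S.Nodup →
        IsSimple S.toFinset →
        IsModularSemilattice (closedSets S.toFinset) →
        ∃ T : List (Implication (Fin n)),
          T.Nodup ∧
          IsOptimalBase T.toFinset (closedSets S.toFinset) ∧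
          Computes c (encodeInput n S) (encodeFamily T) (p.eval (n + famSize S.toFinset)) := by
  obtain ⟨c, p, hc⟩ := exists_program
  -- The time is bounded in terms of the number of implications, which may exceed the size by one
  -- because of `∅ → ∅`.
  refine ⟨c, p.comp (Polynomial.X + 1), fun n S hnd hs hm => ?_⟩
  obtain ⟨h1, h2⟩ := algorithmOutput_spec hnd hs hm
  refine ⟨algorithmOutput S, h1, h2, ?_⟩
  obtain ⟨τ, t, hr, hτ, ht⟩ := hc n S
  refine ⟨τ, t, hr, hτ, ht.trans ?_⟩
  rw [Polynomial.eval_comp]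
  refine polynomial_eval_mono p ?_
  have := length_le_famSize_add_one hnd
  simp
  omega
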